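/- **Setting.** Let $m\ge 1$ be an integer, $B>0$, and let $\mathcal F$ be a family of probability distributions on $[0,1]$ whose distribution functions $F$ satisfy: on a common right neighbourhood of $0$ every $F\in\mathcal F$ is $m$ times differentiable (derivatives at $0$ are right derivatives); $F(0)=F'(0)=\dots=F^{(m-1)}(0)=0$ and $F^{(m)}(0)\in[1/B,B]$; and the $m$-th derivatives $F^{(m)}$, $F\in\mathcal F$, are equicontinuous at $0$. Put $C_F=F^{(m)}(0)/m!$, so that $F(x)=C_Fx^m+o(x^m)$ as $x\downarrow 0$. *Streaming bandits.* There are $N\ge1$ Bernoulli bandits, whose means are drawn i.i.d. from $F$, and $K\ge 1$ pulls. The bandits are presented one at a time. At each stage the player, knowing all past outcomes, either pulls the current bandit (a head is a loss of $1$, a tail a loss of $0$) or moves on to the next one, never to return; at the last bandit the player must use up all remaining pulls. The expected total loss $S_F(N,K)$ of a strategy $S$ is its expected number of heads. *Estimator.* For samples $x_1,x_2,\dots$ and $n\ge 1$, take $\lfloor n^{7/10}\rfloor$ disjoint consecutive pools of $\lfloor n^{1/5}\rfloor$ samples each, average the minima of the pools, and multiply by $n^{1/(5m)}/\Gamma(1+\frac1m)$.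 Let $\widehat E_n$ be the result for the samples $x_i=(m!)^{1/m}\mu_i$, where bandit $i$ is pulled until its first head and $\mu_i$ is the reciprocal of the number of tails before it (and $\mu_i=1$ if there is none). *Algorithm.* Let $n=\min\{N,\lfloor K^{m/(m+1)}\rfloor\}$ (so $n=N$ if $K\ge N^{(m+1)/m}$). Use only the first $n$ bandits, staying at the $n$-th one for ever once it is reached. Estimation phase: pull each of the first $M=\lfloor n^{7/10}\rfloor\lfloor n^{1/5}\rfloor$ bandits until its first head, and compute $\widehat E_n$. Then, with $f_i=\bigl(\tfrac{m!}{2}(n-i+1)\bigr)^{1/m}/\widehat E_n$, keep pulling bandit $i$ ($M<i<n$) as long as it has given no head, or once it has been pulled more than $f_i$ times; otherwise move on. The algorithm uses $m,N,K$ but not $F$. Denote its expected total loss by $\mathrm{Alg}_F(N,K)$. **Claim.** 1. (The estimator works with the $\mu_i$ as samples.) There are $\varepsilon,A>0$ such that for all $F\in\mathcal F$, all $N\ge1$, and every $w$ with $|F^{(m)}(x)-F^{(m)}(0)|\le w$ for $0\le x\le N^{-\varepsilon}$, $$\Pr\bigl(|\widehat E_N-C_F^{-1/m}|>A(N^{-\varepsilon}+w)\bigr)\le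 A\exp(-N^{\varepsilon}).$$ In particular, the estimate of $C_F^{-1/m}$ is uniformly consistent over $\mathcal F$ with exponentially high probability, and it is accurate to $O(N^{-\varepsilon'})$ for some $\varepsilon'>0$ if the $F^{(m)}$ are uniformly Hölder continuous at $0$. 2. (Cost of the estimation phase.) For every $\eta>0$ there is $n_0$ such that whenever $n=\min\{N,\lfloor K^{m/(m+1)}\rfloor\}\ge n_0$, the loss incurred in the estimation phase is, whatever the outcomes are, at most $n^{9/10}\le\eta\,K/n^{1/m}$. Thus it is $o(K/N^{1/m})$ when $K\ge N^{(m+1)/m}$. 3. (Optimality.) There is a constant $c>0$, depending only on $m$, $B$ and the family $\mathcal F$, such that for all $F\in\mathcal F$ and all $N,K\ge1$, with $n=\min\{N,\lfloor K^{m/(m+1)}\rfloor\}$, we have $\mathrm{Alg}_F(N,K)\le c\,K/n^{1/m}$, and every strategy $S$ (which may depend on $F,N,K$) satisfies $$\frac{K}{n^{1/m}}\le c\,S_F(N,K)\qquad\text{and}\qquad \mathrm{Alg}_F(N,K)\le c\,S_F(N,K).$$ -/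

import Mathlib

open MeasureTheory ProbabilityTheory Set
open scoped Nat

noncomputable section

namespace StreamingBandit

/-! ### The game -/

/-- What the player has seen, latest event first: `none` records that the stream was advanced,
`some b` records a pull of the then current bandit with outcome `b` (`true` = head = loss `1`,
`false` = tail = loss `0`). -/
abbrev History : Type := List (Option Bool)

/-- Index (starting from `0`) of the bandit that is currently presented to the player. -/
def History.pos (h : History) : ℕ := h.count none

/-- Number of pulls of bandit `i` recorded in the history that had outcome `b`. -/
def History.countAt (i : ℕ) (b : Bool) : History → ℕ
  | [] => 0
  | none :: h => History.countAt i b h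
  | some b' :: h => History.countAt i b h + if History.pos h = i ∧ b' = b then 1 else 0

/-- Number of pulls of bandit `i`. -/
def History.pullsAt (i : ℕ) (h : History) : ℕ := h.countAt i true + h.countAt i false

/-- Total number of pulls. -/
def History.pulls (h : History) : ℕ := h.count (some true) + h.count (some false)

/-- Total number of heads, that is, the loss. -/
def History.heads (h : History) : ℕ := h.count (some true)

/-- A strategy decides from the history whether to pull the current bandit (`true`) or to advance
the stream (`false`). -/
abbrev Strategy : Type := History → Bool

/-- One step of the game with `N` bandits and `K` pulls; `X i j` is the outcome of the `j`-th pull of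
bandit `i` (both counted from `0`). Nothing happens any more once `K` pulls are used up. The stream
cannot be advanced beyond the last bandit: there the player has to use up the remaining pulls. -/
def step (N K : ℕ) (S : Strategy) (X : ℕ → ℕ → Bool) (h : History) : History :=
  if K ≤ h.pulls then h
  else if h.pos + 1 < N ∧ S h = false then none :: h
  else some (X h.pos (h.pullsAt h.pos)) :: h

/-- The complete history of a game. Each step before the end of the game is one of at most `N - 1`
advances or one of `K` pulls, so the game is over after `N + K` steps. -/
def play (N K : ℕ) (S : Strategy) (X : ℕ → ℕ → Bool) : History :=
  (step N K S X)^[N + K] []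

/-! ### The random environment -/

/-- A sample point: for each bandit `i` its mean `(ω i).1`, and a sequence `(ω i).2` of uniform
random numbers that generate its outcomes. -/
abbrev Env : Type := ℕ → ℝ × (ℕ → unitInterval)

/-- The means are i.i.d. with law `F`; the uniform variables are i.i.d. and independent of them. -/
def envLaw (F : ProbabilityMeasure ℝ) : Measure Env :=
  Measure.infinitePi fun _ : ℕ =>
    (F : Measure ℝ).prod (Measure.infinitePi fun _ : ℕ => (volume : Measure unitInterval))

/-- Outcome of the `j`-th pull of bandit `i`. Given the means, these are independent, and
`outcome ω i j` is Bernoulli distributed with mean `(ω i).1`. -/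
def outcome (ω : Env) (i j : ℕ) : Bool := decide (((ω i).2 j : ℝ) < (ω i).1)

/-- Expected total loss of a strategy with `N` bandits whose means are drawn from `F`, and `K` pulls:
the expected number of heads. -/
def expectedLoss (F : ProbabilityMeasure ℝ) (N K : ℕ) (S : Strategy) : ℝ :=
  ∫ ω, ((play N K S (outcome ω)).heads : ℝ) ∂(envLaw F)

/-! ### The family of distributions -/

/-- The `k`-th derivative of the distribution function of `F`, as a function on `[0, ∞)` (so the
derivatives at `0` are right derivatives). -/
def cdfDeriv (F : ProbabilityMeasure ℝ) (k : ℕ) (x : ℝ) : ℝ :=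
  iteratedDerivWithin k (fun y => cdf (F : Measure ℝ) y) (Ici 0) x

/-- The families of distributions under consideration: laws on `[0,1]` with distribution functions
that are `m` times differentiable on a common (right) neighbourhood of `0`, that vanish at `0`
together with their first `m - 1` derivatives, whose `m`-th derivatives at `0` lie in `[1/B, B]`,
and whose `m`-th derivatives are equicontinuous at `0`. -/
structure IsAdmissibleFamily (m : ℕ) (B : ℝ) (𝓕 : Set (ProbabilityMeasure ℝ)) : Prop where
  support : ∀ F ∈ 𝓕, (F : Measure ℝ) (Icc 0 1) = 1
  differentiable : ∃ δ > (0 : ℝ), ∀ F ∈ 𝓕, ∀ k < m, ∀ x ∈ Ico (0 : ℝ) δ,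
    DifferentiableWithinAt ℝ (cdfDeriv F k) (Ici 0) x
  lower_deriv_zero : ∀ F ∈ 𝓕, ∀ k < m, cdfDeriv F k 0 = 0
  deriv_mem : ∀ F ∈ 𝓕, cdfDeriv F m 0 ∈ Icc (1 / B) B
  equicontinuous : ∀ η > (0 : ℝ), ∃ δ > (0 : ℝ), ∀ F ∈ 𝓕, ∀ x ∈ Ico (0 : ℝ) δ,
    |cdfDeriv F m x - cdfDeriv F m 0| ≤ η

/-- The leading coefficient `C` of the distribution function `C x ^ m + o(x ^ m)` at `0`. -/
def leadingCoeff (m : ℕ) (F : ProbabilityMeasure ℝ) : ℝ := cdfDeriv F m 0 / m !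

/-! ### The estimator -/

/-- Number of samples in a pool, `⌊n ^ (1/5)⌋`. -/
def poolSize (n : ℕ) : ℕ := ⌊(n : ℝ) ^ (1 / 5 : ℝ)⌋₊

/-- Number of pools, `⌊n ^ (7/10)⌋`. -/
def poolCount (n : ℕ) : ℕ := ⌊(n : ℝ) ^ (7 / 10 : ℝ)⌋₊

/-- Total number of samples (at most `n ^ (9/10)`). -/
def sampleCount (n : ℕ) : ℕ := poolCount n * poolSize n

/-- The estimator of `C ^ (-1/m)` from samples `x 0, x 1, …`: average the minima of the pools and
multiply by `n ^ (1/(5m)) / Γ(1 + 1/m)`. -/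
def minEstimator (m n : ℕ) (x : ℕ → ℝ) : ℝ :=
  (n : ℝ) ^ (1 / (5 * m) : ℝ) / Real.Gamma (1 + 1 / m) *
    ((∑ k ∈ Finset.range (poolCount n), ⨅ j : Fin (poolSize n), x (k * poolSize n + j)) /
      poolCount n)

/-- The sample obtained from a bandit that gave `T` tails before its first head: the reciprocal of
`T`, and the largest possible mean `1` if `T = 0`. -/
def recipTails (T : ℕ) : ℝ := 1 / max (T : ℝ) 1

/-- The estimator applied to the rescaled samples `(m!) ^ (1/m) μ_i`, where `μ_i` is the reciprocal
of the number `T i` of tails of bandit `i` before its first head. -/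
def bernoulliEstimator (m n : ℕ) (T : ℕ → ℕ) : ℝ :=
  minEstimator m n fun i => ((m ! : ℕ) : ℝ) ^ (1 / m : ℝ) * recipTails (T i)

/-- Number of tails that bandit `i` gives before its first head. (A bandit of mean `0`, which never
gives a head, occurs with probability zero for the laws under consideration.) -/
def tailsBeforeHead (ω : Env) (i : ℕ) : ℕ := sInf {j | outcome ω i j = true}

/-! ### The algorithm -/

/-- Number of machines that are used; the others are ignored. This equals `N` if
`K ≥ N ^ ((m+1)/m)`. -/
def machines (m N K : ℕ) : ℕ := min N ⌊(K : ℝ) ^ ((m : ℝ) / (m + 1))⌋₊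

/-- The number of flips `f_i = ((m!/2) (n - i)) ^ (1/m)` after which the strategy for the
distribution function `x ^ m` settles on bandit `i` (counted from `0`), divided by the estimate `e` of
`C ^ (-1/m)`. -/
def settleTime (m n : ℕ) (e : ℝ) (i : ℕ) : ℝ :=
  (((m ! : ℕ) : ℝ) / 2 * ((n : ℝ) - i)) ^ (1 / m : ℝ) / e

/-- The algorithm, which knows `m`, `N`, `K` but not `F`. With `n = machines m N K`:
* it stays on the `n`-th bandit for ever if it arrives there;
* estimation phase: each of the first `sampleCount n` bandits is pulled until it gives a head;
* afterwards the current bandit is pulled as long as it has given no head, or once it has been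
  pulled more than `settleTime` times, the threshold being computed from the estimate; otherwise the
  stream is advanced. -/
def algorithm (m N K : ℕ) : Strategy := fun h =>
  let n := machines m N K
  let i := h.pos
  if n ≤ i + 1 then true
  else if i < sampleCount n then decide (h.countAt i true = 0)
  else
    let f := settleTime m n (bernoulliEstimator m n fun j => h.countAt j false) i
    decide ((h.countAt i true = 0 ∧ (h.pullsAt i : ℝ) ≤ f) ∨ f < h.pullsAt i)

/-- The loss of the algorithm in its estimation phase: the number of heads of the first
`sampleCount n` bandits, as a function of the outcomes `X`. -/
def estimationLoss (m N K : ℕ) (X : ℕ → ℕ → Bool) : ℕ :=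
  ∑ i ∈ Finset.range (sampleCount (machines m N K)),
    (play N K (algorithm m N K) X).countAt i true

end StreamingBandit

end

noncomputable section

namespace StreamingBandit

/-! ### Product measures -/

/-! Write a = F^(m)(0) and let μ be the mean of a bandit. Everything rests on two moments: the
probability E(1-μ)^k of k initial tails is a/k^m up to lower order, and the probability E μ(1-μ)^k
that a later pull then gives a head is O(k^(-m-1)). Both follow by integrating the expansion of the
distribution function against (k+1)(1-x)^k (`surv_estimate`, `survHead_le`).

Lower bound. Let L be the loss and D the expected number of bandits pulled at all. Whether a bandit
is pulled at all is independent of its mean, so the first pulls alone give L ≥ D·Eμ. Moreover some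
pulled bandit has mean below t with probability at most F(t)·D, and otherwise each of the K pulls
costs t; hence tK ≤ L + tK·C·t^m·D. If n = N, use D ≤ N and t of order N^(-1/m). Otherwise use D ≤
L/Eμ and t = K^(-1/(m+1)).

Estimator. The reciprocal number of tails has distribution function about a·t^m near 0, so the
minimum of a pool of q samples, times q^(1/m), is nearly Weibull with mean Γ(1+1/m)·a^(-1/m). Since
C_F = a/m!, the factor (m!)^(1/m) turns this into C_F^(-1/m). `mean_estimate` bounds the bias, and
Hoeffding's inequality over the independent pools bounds the fluctuation.

Upper bound. The settling time is chosen so that bandit i (counted from 0) is kept with probability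
about 2/(n-i). A small error of the estimate still leaves at least (3/2)/(n-i), except near the end,
so bandit i is reached with probability O(((n-i)/n)^(3/2)). Once kept, it costs in expectation at
most K times O((n-i)^(-1-1/m)). The sum over i is O(K/n^(1/m)); the exponent 3/2 exceeds 1, which
avoids a logarithm when m = 1. The last bandit contributes O(K·n^(-3/2)), and the bandits that are
left cost at most one head each, where n ≤ K/n^(1/m). The random settling times are sandwiched
between deterministic ones off a bad event of probability O(1/n). This replaces conditioning on the
estimate and keeps the events for different bandits independent. -/

theorem measurable_update_prod {ι : Type*} [DecidableEq ι] {X : ι → Type*}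
    [∀ i, MeasurableSpace (X i)] (i : ι) :
    Measurable (fun p : (∀ i, X i) × X i => Function.update p.1 i p.2) := by
  rw [measurable_pi_iff]
  intro j
  by_cases hj : j = i
  · subst hj; simpa using measurable_snd
  · simp only [ne_eq, hj, not_false_eq_true, Function.update_of_ne]
    exact (measurable_pi_apply j).comp measurable_fst

/-- A product measure is unchanged if one coordinate is sampled afresh. -/
theorem infinitePi_map_update {ι : Type*} [DecidableEq ι] {X : ι → Type*}
    [∀ i, MeasurableSpace (X i)] (μ : ∀ i, Measure (X i)) [∀ i, IsProbabilityMeasure (μ i)] (i : ι) :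
    ((Measure.infinitePi μ).prod (μ i)).map (fun p => Function.update p.1 i p.2)
      = Measure.infinitePi μ := by
  have hmeas := measurable_update_prod (X := X) i
  refine Measure.eq_infinitePi μ fun s t ht => ?_
  rw [Measure.map_apply hmeas (MeasurableSet.pi s.countable_toSet (fun i _ => ht i))]
  by_cases hi : i ∈ s
  · have : (fun p : (∀ i, X i) × X i => Function.update p.1 i p.2) ⁻¹' ((s : Set ι).pi t)
        = (((s.erase i : Finset ι) : Set ι).pi t) ×ˢ (t i) := by
      ext p
      simp only [mem_preimage, Set.mem_pi, mem_prod, Finset.mem_coe, Finset.mem_erase]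
      constructor
      · intro h
        refine ⟨fun j hj => ?_, by simpa using h i hi⟩
        simpa [Function.update_of_ne hj.1] using h j hj.2
      · rintro ⟨h, h'⟩ j hj
        by_cases hji : j = i
        · subst hji; simpa using h'
        · simpa [Function.update_of_ne hji] using h j ⟨hji, hj⟩
    rw [this, Measure.prod_prod, Measure.infinitePi_pi _ (fun i _ => ht i), mul_comm,
      Finset.mul_prod_erase s (fun j => μ j (t j)) hi]
  · have : (fun p : (∀ i, X i) × X i => Function.update p.1 i p.2) ⁻¹' ((s : Set ι).pi t)
        = ((s : Set ι).pi t) ×ˢ univ := by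
      ext p
      simp only [mem_preimage, Set.mem_pi, mem_prod, Finset.mem_coe, mem_univ, and_true]
      refine forall₂_congr fun j hj => ?_
      rw [Function.update_of_ne (by rintro rfl; exact hi hj)]
    rw [this, Measure.prod_prod, Measure.infinitePi_pi _ (fun i _ => ht i), measure_univ, mul_one]

/-- The form in which independence enters the analysis of the game: freeze all coordinates but one
and integrate that one afresh. -/
theorem lintegral_infinitePi_update {ι : Type*} [DecidableEq ι] {X : ι → Type*}
    [∀ i, MeasurableSpace (X i)] (μ : ∀ i, Measure (X i)) [∀ i, IsProbabilityMeasure (μ i)] (i : ι)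
    {f : (∀ i, X i) → ENNReal} (hf : Measurable f) :
    ∫⁻ x, f x ∂(Measure.infinitePi μ)
      = ∫⁻ x, ∫⁻ y, f (Function.update x i y) ∂(μ i) ∂(Measure.infinitePi μ) := by
  have hmeas := measurable_update_prod (X := X) i
  conv_lhs => rw [← infinitePi_map_update μ i]
  rw [lintegral_map hf hmeas]
  exact lintegral_prod _ (hf.comp hmeas).aemeasurable

/-! ### The outcomes of a single bandit -/

/-- The mean `x`, moved to the nearest point of `[0, 1]`: the probability that a bandit of mean `x`
gives a head. -/
def headProb (x : ℝ) : ℝ := max 0 (min x 1)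

theorem headProb_nonneg (x : ℝ) : 0 ≤ headProb x := le_max_left _ _

theorem headProb_le_one (x : ℝ) : headProb x ≤ 1 := by simp [headProb]

theorem one_sub_headProb_nonneg (x : ℝ) : 0 ≤ 1 - headProb x := sub_nonneg.2 (headProb_le_one x)

theorem continuous_headProb : Continuous headProb := by unfold headProb; fun_prop

@[fun_prop]
theorem measurable_headProb : Measurable headProb := continuous_headProb.measurable

theorem le_headProb {t x : ℝ} (ht : t ≤ 1) (h : t ≤ x) : t ≤ headProb x :=
  le_max_of_le_right (le_min h ht)

theorem volume_coe_lt (p : ℝ) :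
    (volume : Measure unitInterval) {u | (u : ℝ) < p} = ENNReal.ofReal (headProb p) := by
  rw [unitInterval.volume_apply]
  have : (Subtype.val '' {u : unitInterval | (u : ℝ) < p}) =ᵐ[volume] Ico 0 (headProb p) := by
    -- For p > 1 the set on the left contains 1, which the half-open interval misses; there is no
    -- other difference.
    have hsub : ∀ x : ℝ, x ≠ 1 →
        (x ∈ (Subtype.val '' {u : unitInterval | (u : ℝ) < p}) ↔ x ∈ Ico 0 (headProb p)) := by
      intro x hx
      simp only [mem_image, mem_ofPred_eq, Subtype.exists, mem_Icc, mem_Ico, headProb, lt_max_iff,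
        lt_min_iff]
      constructor
      · rintro ⟨a, ha, hap, rfl⟩
        exact ⟨ha.1, Or.inr ⟨hap, lt_of_le_of_ne ha.2 hx⟩⟩
      · rintro ⟨h0, h | h⟩
        · exact absurd h0 (not_le.2 h)
        · exact ⟨x, ⟨h0, h.2.le⟩, h.1, rfl⟩
    have : ∀ᵐ x : ℝ, x ≠ 1 := by simp [ae_iff]
    filter_upwards [this] with x hx
    exact propext (hsub x hx)
  rw [measure_congr this]
  simp

theorem volume_not_coe_lt (p : ℝ) :
    (volume : Measure unitInterval) {u | ¬ (u : ℝ) < p} = ENNReal.ofReal (1 - headProb p) := by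
  have hm : MeasurableSet {u : unitInterval | (u : ℝ) < p} :=
    measurableSet_lt (by fun_prop) (by fun_prop)
  have := prob_compl_eq_one_sub (μ := (volume : Measure unitInterval)) hm
  rw [volume_coe_lt] at this
  rw [ENNReal.ofReal_sub _ (headProb_nonneg p), ENNReal.ofReal_one, ← this]
  rfl

/-- The law of a bandit: its mean and the uniform variables that generate its outcomes. -/
def rowLaw (F : ProbabilityMeasure ℝ) : Measure (ℝ × (ℕ → unitInterval)) :=
  (F : Measure ℝ).prod (Measure.infinitePi fun _ : ℕ => (volume : Measure unitInterval))

instance (F : ProbabilityMeasure ℝ) : IsProbabilityMeasure (rowLaw F) := by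
  unfold rowLaw; infer_instance

theorem envLaw_eq (F : ProbabilityMeasure ℝ) :
    envLaw F = Measure.infinitePi fun _ : ℕ => rowLaw F := rfl

instance (F : ProbabilityMeasure ℝ) : IsProbabilityMeasure (envLaw F) := by
  rw [envLaw_eq]; infer_instance

/-- The first `k` outcomes are tails. -/
def tailSet (k : ℕ) : Set (ℝ × (ℕ → unitInterval)) := {r | ∀ j < k, ¬ (r.2 j : ℝ) < r.1}

/-- The outcome number `j` is a head. -/
def headSet (j : ℕ) : Set (ℝ × (ℕ → unitInterval)) := {r | (r.2 j : ℝ) < r.1}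

theorem measurableSet_headSet (j : ℕ) : MeasurableSet (headSet j) := by
  unfold headSet
  exact measurableSet_lt (by fun_prop) (by fun_prop)

theorem tailSet_eq (k : ℕ) : tailSet k = ⋂ j ∈ Finset.range k, (headSet j)ᶜ := by
  ext r; simp [tailSet, headSet]

theorem measurableSet_tailSet (k : ℕ) : MeasurableSet (tailSet k) := by
  rw [tailSet_eq]
  exact Finset.measurableSet_biInter _ fun j _ => (measurableSet_headSet j).compl

/-- The probability that the first `k` outcomes of a bandit are tails. -/
def surv (F : ProbabilityMeasure ℝ) (k : ℕ) : ℝ := ∫ x, (1 - headProb x) ^ k ∂(F : Measure ℝ)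

/-- The probability that the first `k` outcomes of a bandit are tails and a given further outcome is
a head. -/
def survHead (F : ProbabilityMeasure ℝ) (k : ℕ) : ℝ :=
  ∫ x, headProb x * (1 - headProb x) ^ k ∂(F : Measure ℝ)

theorem pow_mul_pow_mem_Icc (k l : ℕ) (x : ℝ) :
    headProb x ^ l * (1 - headProb x) ^ k ∈ Icc (0 : ℝ) 1 := by
  have h0 := headProb_nonneg x
  have h1 := headProb_le_one x
  have h2 := one_sub_headProb_nonneg x
  exact ⟨by positivity, mul_le_one₀ (pow_le_one₀ h0 h1) (by positivity)
    (pow_le_one₀ h2 (by linarith))⟩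

theorem integrable_pow_mul_pow (F : ProbabilityMeasure ℝ) (k l : ℕ) :
    Integrable (fun x => headProb x ^ l * (1 - headProb x) ^ k) (F : Measure ℝ) := by
  refine Integrable.of_bound (C := 1) (by fun_prop) (ae_of_all _ fun x => ?_)
  have := pow_mul_pow_mem_Icc k l x
  rw [Real.norm_eq_abs, abs_of_nonneg this.1]; exact this.2

theorem integrable_surv (F : ProbabilityMeasure ℝ) (k : ℕ) :
    Integrable (fun x => (1 - headProb x) ^ k) (F : Measure ℝ) := by
  simpa using integrable_pow_mul_pow F k 0

theorem integrable_survHead (F : ProbabilityMeasure ℝ) (k : ℕ) :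
    Integrable (fun x => headProb x * (1 - headProb x) ^ k) (F : Measure ℝ) := by
  simpa using integrable_pow_mul_pow F k 1

theorem surv_nonneg (F : ProbabilityMeasure ℝ) (k : ℕ) : 0 ≤ surv F k :=
  integral_nonneg fun x => pow_nonneg (one_sub_headProb_nonneg x) k

theorem survHead_nonneg (F : ProbabilityMeasure ℝ) (k : ℕ) : 0 ≤ survHead F k :=
  integral_nonneg fun x => mul_nonneg (headProb_nonneg x) (pow_nonneg (one_sub_headProb_nonneg x) k)

theorem surv_antitone (F : ProbabilityMeasure ℝ) : Antitone (surv F) := fun k l h =>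
  integral_mono (integrable_surv F l) (integrable_surv F k) fun x =>
    pow_le_pow_of_le_one (one_sub_headProb_nonneg x) (by linarith [headProb_nonneg x]) h

theorem survHead_antitone (F : ProbabilityMeasure ℝ) : Antitone (survHead F) := fun k l h =>
  integral_mono (integrable_survHead F l) (integrable_survHead F k) fun x =>
    mul_le_mul_of_nonneg_left (pow_le_pow_of_le_one (one_sub_headProb_nonneg x)
      (by linarith [headProb_nonneg x]) h) (headProb_nonneg x)

theorem surv_zero (F : ProbabilityMeasure ℝ) : surv F 0 = 1 := by simp [surv]

theorem surv_le_one (F : ProbabilityMeasure ℝ) (k : ℕ) : surv F k ≤ 1 :=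
  (surv_antitone F (Nat.zero_le k)).trans (surv_zero F).le

/-- Given the mean, the outcomes are functions of independent uniform variables, so k tails have as
probability a k-th power, which is then averaged over the mean. -/
theorem rowLaw_tailSet (F : ProbabilityMeasure ℝ) (k : ℕ) :
    rowLaw F (tailSet k) = ENNReal.ofReal (surv F k) := by
  rw [rowLaw, Measure.prod_apply (measurableSet_tailSet k), surv,
    ofReal_integral_eq_lintegral_ofReal (integrable_surv F k)
      (ae_of_all _ fun x => pow_nonneg (one_sub_headProb_nonneg x) k)]
  refine lintegral_congr fun x => ?_
  have : Prod.mk x ⁻¹' tailSet k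
      = ((Finset.range k : Finset ℕ) : Set ℕ).pi fun _ => {u : unitInterval | ¬ (u : ℝ) < x} := by
    ext u; simp [tailSet, Set.mem_pi]
  have hm : MeasurableSet {u : unitInterval | ¬ (u : ℝ) < x} :=
    (measurableSet_lt measurable_subtype_coe measurable_const).compl
  rw [this, Measure.infinitePi_pi _ (fun i _ => hm), Finset.prod_const, volume_not_coe_lt,
    Finset.card_range, ENNReal.ofReal_pow (one_sub_headProb_nonneg x)]

theorem rowLaw_tailSet_inter_headSet (F : ProbabilityMeasure ℝ) {k j : ℕ} (h : k ≤ j) :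
    rowLaw F (tailSet k ∩ headSet j) = ENNReal.ofReal (survHead F k) := by
  rw [rowLaw, Measure.prod_apply ((measurableSet_tailSet k).inter (measurableSet_headSet j)),
    survHead, ofReal_integral_eq_lintegral_ofReal (integrable_survHead F k)
      (ae_of_all _ fun x =>
        mul_nonneg (headProb_nonneg x) (pow_nonneg (one_sub_headProb_nonneg x) k))]
  refine lintegral_congr fun x => ?_
  let t : ℕ → Set unitInterval := fun i => if i = j then {u : unitInterval | (u : ℝ) < x} else
    {u : unitInterval | ¬ (u : ℝ) < x}
  have hm : MeasurableSet {u : unitInterval | (u : ℝ) < x} :=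
    measurableSet_lt (by fun_prop) (by fun_prop)
  have hne : ∀ i ∈ Finset.range k, i ≠ j := fun i hi => by
    have := Finset.mem_range.1 hi; omega
  have : Prod.mk x ⁻¹' (tailSet k ∩ headSet j)
      = ((insert j (Finset.range k) : Finset ℕ) : Set ℕ).pi t := by
    ext u
    simp only [tailSet, headSet, mem_preimage, mem_inter_iff, mem_ofPred_eq, Set.mem_pi,
      Finset.coe_insert, Set.forall_mem_insert, t, if_true, Finset.mem_coe]
    rw [and_comm]
    refine and_congr Iff.rfl ⟨fun h i hi => ?_, fun h i hi => ?_⟩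
    · rw [if_neg (hne i hi)]; exact h i (Finset.mem_range.1 hi)
    · have := h i (Finset.mem_range.2 hi)
      rwa [if_neg (hne i (Finset.mem_range.2 hi))] at this
  rw [this, Measure.infinitePi_pi, Finset.prod_insert (by simpa using h)]
  · have : ∀ i ∈ Finset.range k, (volume : Measure unitInterval) (t i)
        = ENNReal.ofReal (1 - headProb x) := fun i hi => by
      simp only [t, if_neg (hne i hi)]; exact volume_not_coe_lt x
    rw [Finset.prod_congr rfl this, Finset.prod_const, Finset.card_range]
    simp only [t, if_true]
    rw [volume_coe_lt, ENNReal.ofReal_mul (headProb_nonneg x),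
      ENNReal.ofReal_pow (one_sub_headProb_nonneg x)]
  · intro i _
    simp only [t]
    split_ifs
    exacts [hm, hm.compl]

/-! ### Resampling the environment -/

theorem lintegral_envLaw_update (F : ProbabilityMeasure ℝ) (i : ℕ) {f : Env → ENNReal}
    (hf : Measurable f) :
    ∫⁻ ω, f ω ∂(envLaw F) = ∫⁻ ω, ∫⁻ r, f (Function.update ω i r) ∂(rowLaw F) ∂(envLaw F) :=
  lintegral_infinitePi_update (fun _ => rowLaw F) i hf

theorem lintegral_rowLaw_update (F : ProbabilityMeasure ℝ) (j : ℕ)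
    {f : ℝ × (ℕ → unitInterval) → ENNReal} (hf : Measurable f) :
    ∫⁻ r, f r ∂(rowLaw F)
      = ∫⁻ r, ∫⁻ u : unitInterval, f (r.1, Function.update r.2 j u) ∂volume ∂(rowLaw F) := by
  have hm : Measurable fun p : (ℝ × (ℕ → unitInterval)) × unitInterval =>
      f (p.1.1, Function.update p.1.2 j p.2) := by
    exact hf.comp (Measurable.prodMk (by fun_prop) ((measurable_update_prod
      (X := fun _ : ℕ => unitInterval) j).comp
        ((measurable_snd.comp measurable_fst).prodMk measurable_snd)))
  have hm2 : Measurable fun r : ℝ × (ℕ → unitInterval) =>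
      ∫⁻ u : unitInterval, f (r.1, Function.update r.2 j u) ∂volume := hm.lintegral_prod_right'
  rw [rowLaw, lintegral_prod _ hf.aemeasurable, lintegral_prod _ hm2.aemeasurable]
  refine lintegral_congr fun x => ?_
  exact lintegral_infinitePi_update (fun _ : ℕ => (volume : Measure unitInterval)) j
    (hf.comp measurable_prodMk_left)

/-- If an event does not depend on bandit `i`, it is independent of that bandit. -/
theorem lintegral_envLaw_indicator_mul (F : ProbabilityMeasure ℝ) (i : ℕ) {A : Set Env}
    (hA : MeasurableSet A) (hA' : ∀ ω r, Function.update ω i r ∈ A ↔ ω ∈ A)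
    {g : ℝ × (ℕ → unitInterval) → ENNReal} (hg : Measurable g) :
    ∫⁻ ω, A.indicator (fun ω => g (ω i)) ω ∂(envLaw F) = envLaw F A * ∫⁻ r, g r ∂(rowLaw F) := by
  have hm : Measurable (A.indicator fun ω : Env => g (ω i)) :=
    (hg.comp (measurable_pi_apply i)).indicator hA
  rw [lintegral_envLaw_update F i hm]
  have : ∀ ω : Env, ∫⁻ r, A.indicator (fun ω => g (ω i)) (Function.update ω i r) ∂(rowLaw F)
      = A.indicator (fun _ => ∫⁻ r, g r ∂(rowLaw F)) ω := by
    intro ω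
    by_cases h : ω ∈ A
    · rw [indicator_of_mem h]
      refine lintegral_congr fun r => ?_
      rw [indicator_of_mem ((hA' ω r).2 h)]; simp
    · rw [indicator_of_notMem h]
      have : ∀ r, A.indicator (fun ω : Env => g (ω i)) (Function.update ω i r) = 0 := fun r =>
        indicator_of_notMem (fun h' => h ((hA' ω r).1 h')) _
      simp [this]
  simp_rw [this]
  rw [lintegral_indicator hA, lintegral_const, Measure.restrict_apply_univ, mul_comm]

theorem lintegral_rowLaw_fst (F : ProbabilityMeasure ℝ) {g : ℝ → ENNReal} (hg : Measurable g) :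
    ∫⁻ r, g r.1 ∂(rowLaw F) = ∫⁻ x, g x ∂(F : Measure ℝ) := by
  have h := lintegral_prod (μ := (F : Measure ℝ))
    (ν := Measure.infinitePi fun _ : ℕ => (volume : Measure unitInterval)) _
    (hg.comp measurable_fst).aemeasurable
  simpa [rowLaw] using h

theorem mem_headSet_iff (ω : Env) (i j : ℕ) : ω i ∈ headSet j ↔ outcome ω i j = true := by
  simp [headSet, outcome]

theorem mem_tailSet_iff (ω : Env) (i k : ℕ) : ω i ∈ tailSet k ↔ ∀ j < k, outcome ω i j = false := by
  simp [tailSet, outcome]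

/-- If an event does not depend on the outcome `j` of bandit `i`, then given the means it is
independent of that outcome. -/
theorem envLaw_inter_head (F : ProbabilityMeasure ℝ) (i j : ℕ) {A : Set Env}
    (hA : MeasurableSet A)
    (hA' : ∀ ω u, Function.update ω i ((ω i).1, Function.update (ω i).2 j u) ∈ A ↔ ω ∈ A) :
    envLaw F (A ∩ {ω | outcome ω i j = true})
      = ∫⁻ ω, A.indicator (fun ω => ENNReal.ofReal (headProb (ω i).1)) ω ∂(envLaw F) := by
  have hH : MeasurableSet {ω : Env | outcome ω i j = true} := by
    simp_rw [← mem_headSet_iff]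
    exact (measurable_pi_apply i) (measurableSet_headSet j)
  rw [← lintegral_indicator_one (hA.inter hH)]
  have hm1 : Measurable ((A ∩ {ω : Env | outcome ω i j = true}).indicator (1 : Env → ENNReal)) :=
    measurable_one.indicator (hA.inter hH)
  have hm2 : Measurable (A.indicator fun ω : Env => ENNReal.ofReal (headProb (ω i).1)) :=
    (by fun_prop : Measurable fun ω : Env => ENNReal.ofReal (headProb (ω i).1)).indicator hA
  have hupd : ∀ ω : Env, Measurable fun r => Function.update ω i r := fun ω =>
    (measurable_update_prod (X := fun _ : ℕ => ℝ × (ℕ → unitInterval)) i).comp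
      measurable_prodMk_left
  -- Resample the row of bandit i on both sides, then the j-th uniform variable on the left only.
  -- Membership in A does not react to the latter, so it contributes the volume of {u < mean}.
  rw [lintegral_envLaw_update F i hm1, lintegral_envLaw_update F i hm2]
  refine lintegral_congr fun ω => ?_
  refine (lintegral_rowLaw_update F j (hm1.comp (hupd ω))).trans ?_
  simp only [Function.comp_apply]
  refine lintegral_congr fun r => ?_
  set ω' : Env := Function.update ω i r with hω'
  have hi : ω' i = r := by simp [hω']
  have hsame : ∀ u : unitInterval, Function.update ω i (r.1, Function.update r.2 j u)
      = Function.update ω' i ((ω' i).1, Function.update (ω' i).2 j u) := fun u => by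
    rw [hi, hω', Function.update_idem]
  by_cases h : ω' ∈ A
  · rw [indicator_of_mem h, hi, ← volume_coe_lt, ← lintegral_indicator_one
      (measurableSet_lt (by fun_prop) (by fun_prop))]
    refine lintegral_congr fun u => ?_
    have h1 := (hA' ω' u).2 h
    rw [← hsame] at h1
    by_cases hu : (u : ℝ) < r.1
    · exact (indicator_of_mem (s := A ∩ {ω : Env | outcome ω i j = true})
        ⟨h1, by simp [outcome, hu]⟩ (1 : Env → ENNReal)).trans
        (indicator_of_mem (s := {u : unitInterval | (u : ℝ) < r.1}) hu (1 : unitInterval → ENNReal)).symm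
    · refine (indicator_of_notMem (s := A ∩ {ω : Env | outcome ω i j = true}) ?_ (1 : Env → ENNReal)).trans
        (indicator_of_notMem (s := {u : unitInterval | (u : ℝ) < r.1}) hu (1 : unitInterval → ENNReal)).symm
      rintro ⟨-, h2⟩
      exact hu (by simpa [outcome] using h2)
  · rw [indicator_of_notMem h]
    have : ∀ u : unitInterval, (A ∩ {ω : Env | outcome ω i j = true}).indicator (1 : Env → ENNReal)
        (Function.update ω i (r.1, Function.update r.2 j u)) = 0 := fun u => by
      refine indicator_of_notMem (fun h' => h ?_) _
      have := h'.1
      rw [hsame] at this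
      exact (hA' ω' u).1 this
    simp [this]

/-! ### Histories -/

namespace History

theorem pos_none_cons (h : History) : pos (none :: h) = pos h + 1 := by simp [pos]

theorem pos_some_cons (b : Bool) (h : History) : pos (some b :: h) = pos h := by simp [pos]

theorem countAt_none_cons (i : ℕ) (b : Bool) (h : History) :
    countAt i b (none :: h) = countAt i b h := rfl

theorem countAt_some_cons_self (b c : Bool) (h : History) :
    countAt (pos h) b (some c :: h) = countAt (pos h) b h + if c = b then 1 else 0 := by
  simp [countAt]

theorem countAt_some_cons_of_ne {i : ℕ} (b c : Bool) {h : History} (hi : i ≠ pos h) :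
    countAt i b (some c :: h) = countAt i b h := by
  simp [countAt, hi.symm]

theorem pullsAt_none_cons (i : ℕ) (h : History) : pullsAt i (none :: h) = pullsAt i h := rfl

theorem pullsAt_some_cons_self (c : Bool) (h : History) :
    pullsAt (pos h) (some c :: h) = pullsAt (pos h) h + 1 := by
  cases c <;> simp [pullsAt, countAt_some_cons_self] <;> omega

theorem pullsAt_some_cons_of_ne {i : ℕ} (c : Bool) {h : History} (hi : i ≠ pos h) :
    pullsAt i (some c :: h) = pullsAt i h := by
  simp [pullsAt, countAt_some_cons_of_ne _ _ hi]

theorem pulls_none_cons (h : History) : pulls (none :: h) = pulls h := by simp [pulls]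

theorem pulls_some_cons (c : Bool) (h : History) : pulls (some c :: h) = pulls h + 1 := by
  cases c <;> simp [pulls] <;> omega

theorem countAt_eq_zero {i : ℕ} (b : Bool) : ∀ {h : History}, pos h < i → countAt i b h = 0
  | [], _ => rfl
  | none :: h, hi => by
    rw [pos_none_cons] at hi
    exact countAt_eq_zero b (h := h) (by omega)
  | some c :: h, hi => by
    rw [pos_some_cons] at hi
    rw [countAt_some_cons_of_ne _ _ (by omega), countAt_eq_zero b hi]

theorem pullsAt_eq_zero {i : ℕ} {h : History} (hi : pos h < i) : pullsAt i h = 0 := by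
  simp [pullsAt, countAt_eq_zero _ hi]

theorem count_some_eq_sum (b : Bool) {L : ℕ} :
    ∀ {h : History}, pos h < L → h.count (some b) = ∑ i ∈ Finset.range L, countAt i b h
  | [], _ => by simp [countAt]
  | none :: h, hL => by
    rw [pos_none_cons] at hL
    simp only [countAt_none_cons]
    rw [← count_some_eq_sum b (h := h) (by omega)]
    simp
  | some c :: h, hL => by
    rw [pos_some_cons] at hL
    have hmem : pos h ∈ Finset.range L := Finset.mem_range.2 hL
    rw [← Finset.add_sum_erase _ _ hmem, countAt_some_cons_self,
      Finset.sum_congr rfl (fun i hi => countAt_some_cons_of_ne b c (Finset.ne_of_mem_erase hi)),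
      add_right_comm, Finset.add_sum_erase _ (fun i => countAt i b h) hmem,
      ← count_some_eq_sum b hL, List.count_cons]
    simp

theorem heads_eq_sum {L : ℕ} {h : History} (hL : pos h < L) :
    heads h = ∑ i ∈ Finset.range L, countAt i true h := count_some_eq_sum true hL

theorem pulls_eq_sum {L : ℕ} {h : History} (hL : pos h < L) :
    pulls h = ∑ i ∈ Finset.range L, pullsAt i h := by
  simp only [pulls, pullsAt, Finset.sum_add_distrib]
  rw [count_some_eq_sum true hL, count_some_eq_sum false hL]

theorem heads_le_pulls (h : History) : heads h ≤ pulls h := Nat.le_add_right _ _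

end History

open History

/-! ### The course of a game -/

/-- The history after `t` steps. -/
def run (N K : ℕ) (S : Strategy) (X : ℕ → ℕ → Bool) (t : ℕ) : History := (step N K S X)^[t] []

theorem run_zero (N K : ℕ) (S : Strategy) (X : ℕ → ℕ → Bool) : run N K S X 0 = [] := rfl

theorem run_succ (N K : ℕ) (S : Strategy) (X : ℕ → ℕ → Bool) (t : ℕ) :
    run N K S X (t + 1) = step N K S X (run N K S X t) := Function.iterate_succ_apply' _ _ _

theorem play_eq_run (N K : ℕ) (S : Strategy) (X : ℕ → ℕ → Bool) :
    play N K S X = run N K S X (N + K) := rfl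

/-- Steps after the last pull change nothing, so an invariant need only survive an advance and a
pull. A pull may be forced at the last bandit, hence the implication in place of `S h = true`. -/
theorem run_induction {N K : ℕ} {S : Strategy} {X : ℕ → ℕ → Bool} {P : History → Prop}
    (h0 : P [])
    (hadv : ∀ h, P h → h.pulls < K → h.pos + 1 < N → S h = false → P (none :: h))
    (hpull : ∀ h, P h → h.pulls < K → (h.pos + 1 < N → S h = true) →
      P (some (X h.pos (h.pullsAt h.pos)) :: h)) (t : ℕ) : P (run N K S X t) := by
  induction t with
  | zero => exact h0
  | succ t ih =>
    rw [run_succ, step]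
    split_ifs with h1 h2
    · exact ih
    · exact hadv _ ih (not_le.1 h1) h2.1 h2.2
    · refine hpull _ ih (not_le.1 h1) fun h => ?_
      by_contra h'
      exact h2 ⟨h, by simpa using h'⟩

theorem pos_run_lt {N : ℕ} (hN : 1 ≤ N) (K : ℕ) (S : Strategy) (X : ℕ → ℕ → Bool) (t : ℕ) :
    (run N K S X t).pos < N := by
  refine run_induction (P := fun h => h.pos < N) hN ?_ ?_ t
  · intro h _ _ h2 _; rw [pos_none_cons]; exact h2
  · intro h h1 _ _; rw [pos_some_cons]; exact h1

theorem pulls_run_le (N K : ℕ) (S : Strategy) (X : ℕ → ℕ → Bool) (t : ℕ) :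
    (run N K S X t).pulls ≤ K := by
  refine run_induction (P := fun h => h.pulls ≤ K) (Nat.zero_le _) ?_ ?_ t
  · intro h h1 _ _ _; rw [pulls_none_cons]; exact h1
  · intro h _ h1 _; rw [pulls_some_cons]; exact h1

theorem pulls_play {N : ℕ} (hN : 1 ≤ N) (K : ℕ) (S : Strategy) (X : ℕ → ℕ → Bool) :
    (play N K S X).pulls = K := by
  -- Until the pulls are used up, each step is one pull or one advance. Fewer than N advances are
  -- possible, so N + K steps finish the game.
  have key : ∀ t, (run N K S X t).pulls = K ∨
      (run N K S X t).pulls + (run N K S X t).pos = t := by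
    intro t
    induction t with
    | zero => right; rfl
    | succ t ih =>
      rw [run_succ, step]
      split_ifs with h1 h2
      · left; exact le_antisymm (pulls_run_le _ _ _ _ _) h1
      · rcases ih with ih | ih
        · exact absurd ih.ge h1
        · right; rw [pulls_none_cons, pos_none_cons]; omega
      · rcases ih with ih | ih
        · exact absurd ih.ge h1
        · right; rw [pulls_some_cons, pos_some_cons]; omega
  rw [play_eq_run]
  have h1 := pos_run_lt hN K S X (N + K)
  have h2 := pulls_run_le N K S X (N + K)
  rcases key (N + K) with h | h <;> omega

/-- The heads of bandit `i` are the heads among its outcomes up to the number of its pulls. -/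
theorem countAt_true_run (N K : ℕ) (S : Strategy) (X : ℕ → ℕ → Bool) (i t : ℕ) :
    (run N K S X t).countAt i true
      = ∑ j ∈ Finset.range ((run N K S X t).pullsAt i), if X i j = true then 1 else 0 := by
  refine run_induction (P := fun h => h.countAt i true
    = ∑ j ∈ Finset.range (h.pullsAt i), if X i j = true then 1 else 0) rfl ?_ ?_ t
  · intro h ih _ _ _; exact ih
  · intro h ih _ _
    by_cases hi : i = h.pos
    · subst hi
      rw [countAt_some_cons_self, pullsAt_some_cons_self, Finset.sum_range_succ, ih]
    · rw [countAt_some_cons_of_ne _ _ hi, pullsAt_some_cons_of_ne _ hi, ih]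

/-- Whether bandit `i` is pulled more than `j` times does not depend on its outcomes from number `j`
on. -/
theorem lt_pullsAt_run_congr (N K : ℕ) (S : Strategy) {X X' : ℕ → ℕ → Bool} {i j : ℕ}
    (hX : ∀ i' j', i' ≠ i ∨ j' < j → X i' j' = X' i' j') (t : ℕ) :
    j < (run N K S X t).pullsAt i ↔ j < (run N K S X' t).pullsAt i := by
  have hmono : ∀ (Y : ℕ → ℕ → Bool) (h : History), j < h.pullsAt i →
      j < (step N K S Y h).pullsAt i := by
    intro Y h hj
    rw [step]
    split_ifs
    · exact hj
    · exact hj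
    · by_cases hi : i = h.pos
      · subst hi; rw [pullsAt_some_cons_self]; omega
      · rw [pullsAt_some_cons_of_ne _ hi]; exact hj
  -- The two runs can separate only through the outcome of pull j of bandit i, and from that step on
  -- both have more than j pulls of it.
  have key : (run N K S X t = run N K S X' t ∧ (run N K S X t).pullsAt i ≤ j) ∨
      (j < (run N K S X t).pullsAt i ∧ j < (run N K S X' t).pullsAt i) := by
    induction t with
    | zero => left; exact ⟨rfl, Nat.zero_le _⟩
    | succ t ih =>
      rw [run_succ, run_succ]
      rcases ih with ⟨h1, h2⟩ | ⟨h1, h2⟩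
      · rw [← h1]
        set h := run N K S X t
        by_cases hcase : i = h.pos ∧ h.pullsAt i = j
        · obtain ⟨hi, hj⟩ := hcase
          rw [step, step]
          split_ifs with h3 h4
          · left; exact ⟨rfl, h2⟩
          · left; exact ⟨rfl, h2⟩
          · right; subst hi
            rw [pullsAt_some_cons_self, pullsAt_some_cons_self]; omega
        · have hXX : X h.pos (h.pullsAt h.pos) = X' h.pos (h.pullsAt h.pos) := by
            apply hX
            by_cases hi : i = h.pos
            · right; subst hi
              exact lt_of_le_of_ne h2 fun h' => hcase ⟨rfl, h'⟩
            · left; exact fun h' => hi h'.symm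
          have hstep : step N K S X h = step N K S X' h := by rw [step, step, hXX]
          rw [← hstep]
          rcases le_or_gt ((step N K S X h).pullsAt i) j with h' | h'
          · left; exact ⟨rfl, h'⟩
          · right; exact ⟨h', h'⟩
      · right; exact ⟨hmono _ _ h1, hmono _ _ h2⟩
  rcases key with ⟨h1, h2⟩ | ⟨h1, h2⟩
  · rw [← h1]
  · exact ⟨fun _ => h2, fun _ => h1⟩

/-! ### Measurability -/

theorem measurableSet_outcome (i j : ℕ) : MeasurableSet {ω : Env | outcome ω i j = true} := by
  simp_rw [← mem_headSet_iff]
  exact (measurable_pi_apply i) (measurableSet_headSet j)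

/-- There are countably many histories, so one may take the union over the history before the last
step, which depends on a single further outcome. -/
theorem measurableSet_run_eq (N K : ℕ) (S : Strategy) (t : ℕ) (h : History) :
    MeasurableSet {ω | run N K S (outcome ω) t = h} := by
  induction t generalizing h with
  | zero => simp only [run_zero]; exact MeasurableSet.const _
  | succ t ih =>
    have : {ω | run N K S (outcome ω) (t + 1) = h}
        = ⋃ h' : History, {ω | run N K S (outcome ω) t = h'} ∩
          {ω | step N K S (outcome ω) h' = h} := by
      ext ω; simp [run_succ]
    rw [this]
    refine MeasurableSet.iUnion fun h' => (ih h').inter ?_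
    simp only [step]
    split_ifs
    · exact MeasurableSet.const _
    · exact MeasurableSet.const _
    · have hm := measurableSet_outcome h'.pos (h'.pullsAt h'.pos)
      have : {ω | some (outcome ω h'.pos (h'.pullsAt h'.pos)) :: h' = h}
          = ({ω | outcome ω h'.pos (h'.pullsAt h'.pos) = true} ∩ {_ω | some true :: h' = h}) ∪
            ({ω | outcome ω h'.pos (h'.pullsAt h'.pos) = true}ᶜ ∩ {_ω | some false :: h' = h}) := by
        ext ω
        by_cases ho : outcome ω h'.pos (h'.pullsAt h'.pos) <;> simp [ho]
      rw [this]
      exact (hm.inter (MeasurableSet.const _)).union (hm.compl.inter (MeasurableSet.const _))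

theorem measurableSet_play_mem (N K : ℕ) (S : Strategy) (Q : Set History) :
    MeasurableSet {ω | play N K S (outcome ω) ∈ Q} := by
  have : {ω | play N K S (outcome ω) ∈ Q}
      = ⋃ h ∈ Q, {ω | run N K S (outcome ω) (N + K) = h} := by
    ext ω; simp [play_eq_run]
  rw [this]
  exact MeasurableSet.biUnion (to_countable Q) fun h _ => measurableSet_run_eq N K S _ h

theorem measurable_play_comp (N K : ℕ) (S : Strategy) (f : History → ℕ) :
    Measurable fun ω => f (play N K S (outcome ω)) := by
  refine measurable_to_countable' fun x => ?_
  exact measurableSet_play_mem N K S {h | f h = x}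

theorem expectedLoss_eq_lintegral (F : ProbabilityMeasure ℝ) (N K : ℕ) (S : Strategy) :
    ENNReal.ofReal (expectedLoss F N K S)
      = ∫⁻ ω, ((play N K S (outcome ω)).heads : ENNReal) ∂(envLaw F) := by
  have hmeas := measurable_play_comp N K S heads
  rw [expectedLoss, ofReal_integral_eq_lintegral_ofReal]
  · refine lintegral_congr fun ω => ?_
    rw [ENNReal.ofReal_natCast]
  · refine Integrable.of_bound (C := K) ?_ (ae_of_all _ fun ω => ?_)
    · exact (measurable_from_nat.comp hmeas : Measurable fun ω =>
        ((play N K S (outcome ω)).heads : ℝ)).aestronglyMeasurable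
    · simp only [Real.norm_natCast, Nat.cast_le]
      exact (heads_le_pulls _).trans (pulls_run_le _ _ _ _ _)
  · exact ae_of_all _ fun ω => Nat.cast_nonneg _

theorem expectedLoss_nonneg (F : ProbabilityMeasure ℝ) (N K : ℕ) (S : Strategy) :
    0 ≤ expectedLoss F N K S := integral_nonneg fun _ => Nat.cast_nonneg _

theorem expectedLoss_le_pulls (F : ProbabilityMeasure ℝ) (N K : ℕ) (S : Strategy) :
    expectedLoss F N K S ≤ K := by
  rw [← ENNReal.ofReal_le_ofReal_iff (Nat.cast_nonneg K), expectedLoss_eq_lintegral,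
    ENNReal.ofReal_natCast]
  calc ∫⁻ ω, ((play N K S (outcome ω)).heads : ENNReal) ∂(envLaw F)
      ≤ ∫⁻ _ω, (K : ENNReal) ∂(envLaw F) := lintegral_mono fun ω => by
        simp only [Nat.cast_le]
        exact (heads_le_pulls _).trans (pulls_run_le _ _ _ _ _)
    _ = K := by simp

/-! ### Lower bounds for the loss of a strategy -/

/-- Bandit `i` is pulled more than `j` times. -/
def pulledSet (N K : ℕ) (S : Strategy) (i j : ℕ) : Set Env :=
  {ω | j < (play N K S (outcome ω)).pullsAt i}

theorem measurableSet_pulledSet (N K : ℕ) (S : Strategy) (i j : ℕ) :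
    MeasurableSet (pulledSet N K S i j) := measurableSet_play_mem N K S {h | j < h.pullsAt i}

theorem outcome_update_of_ne (ω : Env) {i i' : ℕ} (r : ℝ × (ℕ → unitInterval)) (h : i' ≠ i)
    (j : ℕ) : outcome (Function.update ω i r) i' j = outcome ω i' j := by
  simp [outcome, Function.update_of_ne h]

/-- Whether bandit i is pulled at all is decided before anything about its row has been seen. -/
theorem update_mem_pulledSet_zero (N K : ℕ) (S : Strategy) (i : ℕ) (ω : Env)
    (r : ℝ × (ℕ → unitInterval)) :
    Function.update ω i r ∈ pulledSet N K S i 0 ↔ ω ∈ pulledSet N K S i 0 := by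
  refine lt_pullsAt_run_congr N K S (fun i' j' h => ?_) _
  rcases h with h | h
  · exact outcome_update_of_ne ω r h j'
  · omega

theorem update_mem_pulledSet (N K : ℕ) (S : Strategy) (i j : ℕ) (ω : Env) (u : unitInterval) :
    Function.update ω i ((ω i).1, Function.update (ω i).2 j u) ∈ pulledSet N K S i j ↔
      ω ∈ pulledSet N K S i j := by
  refine lt_pullsAt_run_congr N K S (fun i' j' h => ?_) _
  by_cases hi : i' = i
  · subst hi
    have : j' ≠ j := by rcases h with h | h; exacts [absurd rfl h, h.ne]
    simp [outcome, Function.update_of_ne this]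
  · exact outcome_update_of_ne ω _ hi j'

theorem pos_play_lt {N : ℕ} (hN : 1 ≤ N) (K : ℕ) (S : Strategy) (X : ℕ → ℕ → Bool) :
    (play N K S X).pos < N := pos_run_lt hN K S X (N + K)

theorem pullsAt_play_le {N : ℕ} (hN : 1 ≤ N) (K : ℕ) (S : Strategy) (X : ℕ → ℕ → Bool) (i : ℕ) :
    (play N K S X).pullsAt i ≤ K := by
  have h1 := pulls_eq_sum (L := N + i + 1) (h := play N K S X)
    (by have := pos_play_lt hN K S X; omega)
  rw [pulls_play hN] at h1
  refine le_trans ?_ h1.ge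
  exact Finset.single_le_sum (f := fun i => (play N K S X).pullsAt i) (fun _ _ => Nat.zero_le _)
    (Finset.mem_range.2 (by omega : i < N + i + 1))

theorem sum_range_ite_lt {M : Type*} [AddCommMonoid M] {c K : ℕ} (h : c ≤ K) (f : ℕ → M) :
    ∑ j ∈ Finset.range c, f j = ∑ j ∈ Finset.range K, if j < c then f j else 0 := by
  rw [← Finset.sum_filter]
  congr 1
  ext j; simp; omega

/-- The expected loss is the expectation of the sum of the means of the bandits that are pulled. -/
theorem lintegral_heads_eq (F : ProbabilityMeasure ℝ) {N : ℕ} (hN : 1 ≤ N) (K : ℕ) (S : Strategy) :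
    ∫⁻ ω, ((play N K S (outcome ω)).heads : ENNReal) ∂(envLaw F)
      = ∑ i ∈ Finset.range N, ∑ j ∈ Finset.range K, ∫⁻ ω, (pulledSet N K S i j).indicator
          (fun ω => ENNReal.ofReal (headProb (ω i).1)) ω ∂(envLaw F) := by
  have h1 : ∀ ω, ((play N K S (outcome ω)).heads : ENNReal)
      = ∑ i ∈ Finset.range N, ∑ j ∈ Finset.range K,
        (pulledSet N K S i j ∩ {ω | outcome ω i j = true}).indicator (1 : Env → ENNReal) ω := by
    intro ω
    rw [heads_eq_sum (L := N) (pos_play_lt hN K S _), Nat.cast_sum]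
    refine Finset.sum_congr rfl fun i _ => ?_
    have h2 := countAt_true_run N K S (outcome ω) i (N + K)
    rw [← play_eq_run] at h2
    rw [h2, sum_range_ite_lt (pullsAt_play_le hN K S _ i), Nat.cast_sum]
    refine Finset.sum_congr rfl fun j _ => ?_
    by_cases hj : j < (play N K S (outcome ω)).pullsAt i
    · by_cases ho : outcome ω i j = true
      · have hmem : ω ∈ pulledSet N K S i j ∩ {ω | outcome ω i j = true} := ⟨hj, ho⟩
        rw [indicator_of_mem hmem]; simp [hj, ho]
      · rw [indicator_of_notMem (fun h => ho h.2)]; simp [ho]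
    · rw [indicator_of_notMem (fun h => hj h.1)]; simp [hj]
  simp_rw [h1]
  have hm : ∀ i j, MeasurableSet (pulledSet N K S i j ∩ {ω | outcome ω i j = true}) := fun i j =>
    (measurableSet_pulledSet N K S i j).inter (measurableSet_outcome i j)
  rw [lintegral_finsetSum _ fun i _ => Finset.measurable_sum _ fun j _ =>
    measurable_one.indicator (hm i j)]
  refine Finset.sum_congr rfl fun i _ => ?_
  rw [lintegral_finsetSum _ fun j _ => measurable_one.indicator (hm i j)]
  refine Finset.sum_congr rfl fun j _ => ?_
  -- The decision to make pull j precedes its outcome, so the head may be replaced by its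
  -- conditional probability given the mean.
  rw [lintegral_indicator_one (hm i j), envLaw_inter_head F i j (measurableSet_pulledSet N K S i j)
    (update_mem_pulledSet N K S i j)]

theorem lintegral_headProb (F : ProbabilityMeasure ℝ) :
    ∫⁻ r, ENNReal.ofReal (headProb r.1) ∂(rowLaw F) = ENNReal.ofReal (survHead F 0) := by
  rw [lintegral_rowLaw_fst F (g := fun x => ENNReal.ofReal (headProb x)) (by fun_prop), survHead,
    ofReal_integral_eq_lintegral_ofReal (integrable_survHead F 0)
      (ae_of_all _ fun x => by simpa using headProb_nonneg x)]
  simp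

/-- The expected number of bandits that are pulled. -/
def expectedPulled (F : ProbabilityMeasure ℝ) (N K : ℕ) (S : Strategy) : ℝ :=
  ∑ i ∈ Finset.range N, (envLaw F).real (pulledSet N K S i 0)

theorem expectedPulled_nonneg (F : ProbabilityMeasure ℝ) (N K : ℕ) (S : Strategy) :
    0 ≤ expectedPulled F N K S := Finset.sum_nonneg fun _ _ => measureReal_nonneg

theorem expectedPulled_le (F : ProbabilityMeasure ℝ) (N K : ℕ) (S : Strategy) :
    expectedPulled F N K S ≤ N := by
  calc expectedPulled F N K S ≤ ∑ _i ∈ Finset.range N, (1 : ℝ) :=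
        Finset.sum_le_sum fun _ _ => measureReal_le_one
    _ = N := by simp

theorem ofReal_expectedPulled (F : ProbabilityMeasure ℝ) (N K : ℕ) (S : Strategy) :
    ENNReal.ofReal (expectedPulled F N K S)
      = ∑ i ∈ Finset.range N, envLaw F (pulledSet N K S i 0) := by
  rw [expectedPulled, ENNReal.ofReal_sum_of_nonneg fun _ _ => measureReal_nonneg]
  exact Finset.sum_congr rfl fun i _ => ofReal_measureReal

/-- The first pulls of the bandits cost at least the mean of a bandit each. -/
theorem mean_mul_expectedPulled_le (F : ProbabilityMeasure ℝ) {N K : ℕ} (hN : 1 ≤ N) (hK : 1 ≤ K)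
    (S : Strategy) : survHead F 0 * expectedPulled F N K S ≤ expectedLoss F N K S := by
  rw [← ENNReal.ofReal_le_ofReal_iff (expectedLoss_nonneg F N K S), expectedLoss_eq_lintegral,
    lintegral_heads_eq F hN, ENNReal.ofReal_mul (survHead_nonneg F 0), ofReal_expectedPulled,
    Finset.mul_sum]
  refine Finset.sum_le_sum fun i _ => ?_
  have h1 := lintegral_envLaw_indicator_mul F i (measurableSet_pulledSet N K S i 0)
    (update_mem_pulledSet_zero N K S i)
    (g := fun r => ENNReal.ofReal (headProb r.1)) (by fun_prop)
  rw [lintegral_headProb, mul_comm] at h1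
  rw [← h1]
  exact Finset.single_le_sum (f := fun j => ∫⁻ ω, (pulledSet N K S i j).indicator
    (fun ω => ENNReal.ofReal (headProb (ω i).1)) ω ∂(envLaw F)) (fun _ _ => zero_le)
    (Finset.mem_range.2 hK)

/-- Pulls of bandits of mean at least `t` cost `t` each; there are few bandits of smaller mean. -/
theorem mul_pulls_le (F : ProbabilityMeasure ℝ) {N : ℕ} (hN : 1 ≤ N) (K : ℕ) (S : Strategy)
    {t : ℝ} (ht0 : 0 ≤ t) (ht1 : t ≤ 1) :
    t * K ≤ expectedLoss F N K S
      + t * K * ((F : Measure ℝ).real (Iio t) * expectedPulled F N K S) := by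
  have hD := expectedPulled_nonneg F N K S
  have hm1 : ∀ i j, Measurable ((pulledSet N K S i j).indicator
      fun ω : Env => ENNReal.ofReal (headProb (ω i).1)) := fun i j =>
    Measurable.indicator (by fun_prop) (measurableSet_pulledSet N K S i j)
  have hm2 : ∀ i : ℕ, Measurable ((pulledSet N K S i 0).indicator
      fun ω : Env => (Iio t).indicator (1 : ℝ → ENNReal) (ω i).1) := fun i =>
    Measurable.indicator ((measurable_one.indicator measurableSet_Iio).comp (by fun_prop))
      (measurableSet_pulledSet N K S i 0)
  -- Either a pulled bandit has mean below t, and then the second sum is at least 1, or all K pulls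
  -- have head probability at least t.
  have hpt : ∀ ω : Env, ENNReal.ofReal t * K
      ≤ (∑ i ∈ Finset.range N, ∑ j ∈ Finset.range K, (pulledSet N K S i j).indicator
          (fun ω => ENNReal.ofReal (headProb (ω i).1)) ω)
        + ENNReal.ofReal t * K * ∑ i ∈ Finset.range N, (pulledSet N K S i 0).indicator
          (fun ω => (Iio t).indicator (1 : ℝ → ENNReal) (ω i).1) ω := by
    intro ω
    by_cases hex : ∃ i ∈ Finset.range N, ω ∈ pulledSet N K S i 0 ∧ (ω i).1 < t
    · obtain ⟨i, hi, hp, ht⟩ := hex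
      refine le_add_left ?_
      refine le_mul_of_one_le_right zero_le ?_
      refine le_trans ?_ (Finset.single_le_sum (f := fun i => (pulledSet N K S i 0).indicator
          (fun ω => (Iio t).indicator (1 : ℝ → ENNReal) (ω i).1) ω) (fun _ _ => zero_le) hi)
      rw [indicator_of_mem hp, indicator_of_mem (show (ω i).1 ∈ Iio t from ht)]
      rfl
    · push Not at hex
      refine le_add_right ?_
      have h1 : (K : ENNReal) = ∑ i ∈ Finset.range N, ∑ j ∈ Finset.range K,
          (pulledSet N K S i j).indicator (1 : Env → ENNReal) ω := by
        have h2 := pulls_eq_sum (L := N) (pos_play_lt hN K S (outcome ω))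
        rw [pulls_play hN] at h2
        conv_lhs => rw [h2]
        rw [Nat.cast_sum]
        refine Finset.sum_congr rfl fun i _ => ?_
        have h3 : (play N K S (outcome ω)).pullsAt i
            = ∑ _j ∈ Finset.range ((play N K S (outcome ω)).pullsAt i), 1 := by simp
        rw [h3, sum_range_ite_lt (pullsAt_play_le hN K S _ i), Nat.cast_sum]
        refine Finset.sum_congr rfl fun j _ => ?_
        by_cases hj : j < (play N K S (outcome ω)).pullsAt i <;> simp [indicator, pulledSet, hj]
      rw [h1, Finset.mul_sum]
      refine Finset.sum_le_sum fun i hi => ?_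
      rw [Finset.mul_sum]
      refine Finset.sum_le_sum fun j _ => ?_
      by_cases hj : ω ∈ pulledSet N K S i j
      · rw [indicator_of_mem hj, indicator_of_mem hj]
        have h0 : ω ∈ pulledSet N K S i 0 := lt_of_le_of_lt (Nat.zero_le j) hj
        simpa using ENNReal.ofReal_le_ofReal (le_headProb ht1 (hex i hi h0))
      · simp [indicator_of_notMem hj]
  have hint := lintegral_mono (μ := envLaw F) hpt
  rw [lintegral_const, measure_univ, mul_one, lintegral_add_left (Finset.measurable_sum _ fun i _ =>
      Finset.measurable_sum _ fun j _ => hm1 i j),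
    lintegral_finsetSum _ (fun i _ => Finset.measurable_sum _ fun j _ => hm1 i j),
    lintegral_const_mul _ (Finset.measurable_sum _ fun i _ => hm2 i),
    lintegral_finsetSum _ (fun i _ => hm2 i)] at hint
  simp_rw [lintegral_finsetSum (Finset.range K) (fun j (_ : j ∈ Finset.range K) => hm1 _ j)] at hint
  rw [← lintegral_heads_eq F hN, ← expectedLoss_eq_lintegral] at hint
  have h4 : ∀ i, ∫⁻ ω, (pulledSet N K S i 0).indicator
      (fun ω => (Iio t).indicator (1 : ℝ → ENNReal) (ω i).1) ω ∂(envLaw F)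
      = envLaw F (pulledSet N K S i 0) * (F : Measure ℝ) (Iio t) := by
    intro i
    have h1 := lintegral_envLaw_indicator_mul F i (measurableSet_pulledSet N K S i 0)
      (update_mem_pulledSet_zero N K S i)
      (g := fun r => (Iio t).indicator (1 : ℝ → ENNReal) r.1)
      ((measurable_one.indicator measurableSet_Iio).comp measurable_fst)
    rw [lintegral_rowLaw_fst F (g := (Iio t).indicator (1 : ℝ → ENNReal))
      (measurable_one.indicator measurableSet_Iio), lintegral_indicator_one measurableSet_Iio] at h1
    exact h1
  simp_rw [h4] at hint
  rw [← Finset.sum_mul, ← ofReal_expectedPulled, ← ofReal_measureReal (μ := (F : Measure ℝ)),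
    ← ENNReal.ofReal_natCast, ← ENNReal.ofReal_mul ht0, ← ENNReal.ofReal_mul hD,
    ← ENNReal.ofReal_mul (by positivity), ← ENNReal.ofReal_add (expectedLoss_nonneg F N K S)
      (mul_nonneg (by positivity) (mul_nonneg hD measureReal_nonneg)),
    ENNReal.ofReal_le_ofReal_iff (add_nonneg (expectedLoss_nonneg F N K S)
      (mul_nonneg (by positivity) (mul_nonneg hD measureReal_nonneg)))] at hint
  rwa [mul_comm ((F : Measure ℝ).real (Iio t))]

/-! ### Expansion of the distribution function at `0` -/

theorem hasDerivWithinAt_cdfDeriv {F : ProbabilityMeasure ℝ} {k : ℕ} {x : ℝ} (hx : 0 ≤ x)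
    (h : DifferentiableWithinAt ℝ (cdfDeriv F k) (Ici 0) x) :
    HasDerivWithinAt (cdfDeriv F k) (cdfDeriv F (k + 1) x) (Ici x) x := by
  have h1 := h.hasDerivWithinAt.mono (Ici_subset_Ici.2 hx)
  have h2 : cdfDeriv F (k + 1) x = derivWithin (cdfDeriv F k) (Ici 0) x := by
    simp only [cdfDeriv, iteratedDerivWithin_succ]
    rfl
  rwa [h2]

theorem cdfDeriv_zero (F : ProbabilityMeasure ℝ) : cdfDeriv F 0 = cdf (F : Measure ℝ) := by
  ext x; simp [cdfDeriv]

/-- Taylor's formula with the modulus of continuity of the highest derivative. -/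
theorem abs_cdfDeriv_sub_le {F : ProbabilityMeasure ℝ} {m : ℕ} {δ r w : ℝ} (hr : r < δ)
    (hd : ∀ k < m, ∀ x ∈ Ico (0 : ℝ) δ, DifferentiableWithinAt ℝ (cdfDeriv F k) (Ici 0) x)
    (h0 : ∀ k < m, cdfDeriv F k 0 = 0)
    (hw : ∀ x ∈ Icc (0 : ℝ) r, |cdfDeriv F m x - cdfDeriv F m 0| ≤ w) :
    ∀ k ≤ m, ∀ x ∈ Icc (0 : ℝ) r,
      |cdfDeriv F (m - k) x - cdfDeriv F m 0 * (x ^ k / k !)| ≤ w * (x ^ k / k !) := by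
  intro k
  induction k with
  | zero => intro _ x hx; simpa using hw x hx
  | succ k ih =>
    intro hk
    have hsub : m - k = m - (k + 1) + 1 := by omega
    have hlt : m - (k + 1) < m := by omega
    have hpow : ∀ x : ℝ, HasDerivAt (fun y : ℝ => y ^ (k + 1) / ((k + 1)! : ℝ)) (x ^ k / k !) x := by
      intro x
      refine ((hasDerivAt_pow (k + 1) x).div_const ((k + 1)! : ℝ)).congr_deriv ?_
      rw [Nat.factorial_succ]
      push_cast
      field_simp
    -- The bound for the derivative of order m - k, integrated from 0, where everything vanishes, is
    -- the bound for order m - (k + 1).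
    have key := image_norm_le_of_norm_deriv_right_le_deriv_boundary (a := 0) (b := r)
      (f := fun x => cdfDeriv F (m - (k + 1)) x - cdfDeriv F m 0 * (x ^ (k + 1) / (k + 1)!))
      (f' := fun x => cdfDeriv F (m - k) x - cdfDeriv F m 0 * (x ^ k / k !))
      (B := fun x => w * (x ^ (k + 1) / (k + 1)!)) (B' := fun x => w * (x ^ k / k !))
      ?_ ?_ ?_ ?_ ?_
    · intro x hx; exact key hx
    · refine ContinuousOn.sub (fun x hx => ?_) (by fun_prop)
      exact ((hd _ hlt x ⟨hx.1, hx.2.trans_lt hr⟩).continuousWithinAt).mono Icc_subset_Ici_self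
    · intro x hx
      have h1 := hasDerivWithinAt_cdfDeriv hx.1 (hd _ hlt x ⟨hx.1, hx.2.trans hr⟩)
      rw [← hsub] at h1
      exact h1.sub ((hpow x).const_mul _).hasDerivWithinAt
    · simp [h0 _ hlt]
    · intro x; exact (hpow x).const_mul w
    · intro x hx; exact ih (by omega) x ⟨hx.1, hx.2.le⟩

/-- Taylor's formula up to r. Beyond r both terms on the left lie in [0, 1 + B] and (x/r)^(m+1) ≥ 1,
so the last summand pays for everything. The bound thus holds on all of [0, 1] and can be
integrated. -/
theorem abs_cdf_sub_le {F : ProbabilityMeasure ℝ} {m : ℕ} {B δ r w : ℝ} (hr : r < δ) (hr0 : 0 < r)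
    (hd : ∀ k < m, ∀ x ∈ Ico (0 : ℝ) δ, DifferentiableWithinAt ℝ (cdfDeriv F k) (Ici 0) x)
    (h0 : ∀ k < m, cdfDeriv F k 0 = 0) (ha : cdfDeriv F m 0 ∈ Icc 0 B)
    (hw : ∀ x ∈ Icc (0 : ℝ) r, |cdfDeriv F m x - cdfDeriv F m 0| ≤ w) {x : ℝ}
    (hx : x ∈ Icc (0 : ℝ) 1) :
    |cdf (F : Measure ℝ) x - cdfDeriv F m 0 / m ! * x ^ m|
      ≤ w / m ! * x ^ m + (1 + B) / r ^ (m + 1) * x ^ (m + 1) := by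
  have hw0 : 0 ≤ w := (abs_nonneg _).trans (hw 0 ⟨le_rfl, hr0.le⟩)
  have hB0 : 0 ≤ B := ha.1.trans ha.2
  have hx0 := hx.1
  rcases le_or_gt x r with h | h
  · have := abs_cdfDeriv_sub_le hr hd h0 hw m le_rfl x ⟨hx.1, h⟩
    rw [Nat.sub_self, cdfDeriv_zero] at this
    have h2 : 0 ≤ (1 + B) / r ^ (m + 1) * x ^ (m + 1) := by positivity
    calc _ = |cdf (F : Measure ℝ) x - cdfDeriv F m 0 * (x ^ m / m !)| := by ring_nf
      _ ≤ w * (x ^ m / m !) := this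
      _ = w / m ! * x ^ m := by ring
      _ ≤ _ := by linarith
  · have h1 : 1 ≤ (x / r) ^ (m + 1) := one_le_pow₀ ((one_le_div hr0).2 h.le)
    have h2 : (1 + B) / r ^ (m + 1) * x ^ (m + 1) = (1 + B) * (x / r) ^ (m + 1) := by
      rw [div_pow]; ring
    have h3 : 0 ≤ w / m ! * x ^ m := by positivity
    have h4 := cdf_nonneg (F : Measure ℝ) x
    have h5 := cdf_le_one (F : Measure ℝ) x
    have h6 : cdfDeriv F m 0 / m ! * x ^ m ≤ B := by
      have : (1 : ℝ) ≤ m ! := by exact_mod_cast Nat.one_le_iff_ne_zero.2 (Nat.factorial_ne_zero m)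
      calc cdfDeriv F m 0 / m ! * x ^ m ≤ cdfDeriv F m 0 / m ! * 1 := by
            gcongr
            · exact div_nonneg ha.1 (by positivity)
            · exact pow_le_one₀ hx.1 hx.2
        _ ≤ cdfDeriv F m 0 := by rw [mul_one]; exact div_le_self ha.1 this
        _ ≤ B := ha.2
    have h7 : 0 ≤ cdfDeriv F m 0 / m ! * x ^ m :=
      mul_nonneg (div_nonneg ha.1 (by positivity)) (by positivity)
    rw [h2, abs_le]
    have h8 : 1 + B ≤ (1 + B) * (x / r) ^ (m + 1) := le_mul_of_one_le_right (by linarith) h1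
    constructor <;> linarith

/-! ### Moments -/

/-- Euler's Beta integral, by integration by parts in j. -/
theorem integral_pow_mul_one_sub_pow (j k : ℕ) :
    ∫ x in (0 : ℝ)..1, x ^ j * (1 - x) ^ k = (j ! * k ! : ℝ) / (j + k + 1)! := by
  induction j generalizing k with
  | zero =>
    have : ∫ x in (0 : ℝ)..1, (1 - x) ^ k = ∫ x in (0 : ℝ)..1, x ^ k := by
      simpa using intervalIntegral.integral_comp_sub_left (a := 0) (b := 1)
        (fun x : ℝ => x ^ k) (1 : ℝ)
    simp only [pow_zero, one_mul, this, integral_pow, zero_add, Nat.factorial_succ]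
    have : (k ! : ℝ) ≠ 0 := by positivity
    push_cast
    field_simp
    simp
  | succ j ih =>
    have hderiv : ∀ x : ℝ, HasDerivAt (fun x : ℝ => x ^ (j + 1) * (1 - x) ^ (k + 1))
        ((j + 1) * (x ^ j * (1 - x) ^ (k + 1)) - (k + 1) * (x ^ (j + 1) * (1 - x) ^ k)) x := by
      intro x
      have h1 := hasDerivAt_pow (j + 1) x
      have h2 := ((hasDerivAt_id x).const_sub 1).pow (k + 1)
      refine (h1.mul h2).congr_deriv ?_
      simp
      ring
    have h := intervalIntegral.integral_eq_sub_of_hasDerivAt (a := 0) (b := 1)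
      (fun x _ => hderiv x) (by apply Continuous.intervalIntegrable; fun_prop)
    rw [intervalIntegral.integral_sub (by apply Continuous.intervalIntegrable; fun_prop)
      (by apply Continuous.intervalIntegrable; fun_prop), intervalIntegral.integral_const_mul,
      intervalIntegral.integral_const_mul, ih (k + 1)] at h
    have h3 : (j : ℕ) + (k + 1) + 1 = j + 1 + k + 1 := by ring
    rw [h3] at h
    have h4 : ((k : ℝ) + 1) ≠ 0 := by positivity
    have h5 : ((j + 1 + k + 1)! : ℝ) ≠ 0 := by positivity
    rw [Nat.factorial_succ j]
    rw [Nat.factorial_succ k] at h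
    push_cast at h ⊢
    simp at h
    rw [eq_div_iff h5]
    field_simp at h
    have : ((k : ℝ) + 1) * ((∫ x in (0 : ℝ)..1, x ^ (j + 1) * (1 - x) ^ k) * (j + 1 + k + 1)!)
        = (k + 1) * ((j + 1) * j ! * k !) := by linarith
    exact mul_left_cancel₀ h4 this

/-- The moment of order `k` of `1 - μ`, in terms of the distribution function. -/
theorem surv_succ_eq_integral (F : ProbabilityMeasure ℝ) (k : ℕ) :
    surv F (k + 1) = ∫ x in (0 : ℝ)..1, (k + 1) * (1 - x) ^ k * cdf (F : Measure ℝ) x := by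
  -- The power is the integral of (k+1)(1-x)^k over x from the clipped mean to 1; Fubini then
  -- produces the distribution function.
  have hpt : ∀ y : ℝ, (1 - headProb y) ^ (k + 1)
      = ∫ x in Ioc (0 : ℝ) 1, (Ici (headProb y)).indicator (fun x => (k + 1) * (1 - x) ^ k) x := by
    intro y
    have h0 := headProb_nonneg y
    have h1 := headProb_le_one y
    have hset : (Ioc (0 : ℝ) 1 ∩ Ici (headProb y) : Set ℝ) =ᵐ[volume] Ioc (headProb y) 1 := by
      have h2 : (Ioc (0 : ℝ) 1 ∩ Ici (headProb y) : Set ℝ) =ᵐ[volume]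
          (Ioc (0 : ℝ) 1 ∩ Ioi (headProb y) : Set ℝ) :=
        (Filter.EventuallyEq.refl _ _).inter Ioi_ae_eq_Ici.symm
      have h3 : (Ioc (0 : ℝ) 1 ∩ Ioi (headProb y) : Set ℝ) = Ioc (headProb y) 1 := by
        ext x; simp only [mem_inter_iff, mem_Ioc, mem_Ioi]
        constructor
        · rintro ⟨⟨_, h⟩, h'⟩; exact ⟨h', h⟩
        · rintro ⟨h, h'⟩; exact ⟨⟨h0.trans_lt h, h'⟩, h⟩
      rw [← h3]; exact h2
    rw [setIntegral_indicator measurableSet_Ici, setIntegral_congr_set hset,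
      ← intervalIntegral.integral_of_le h1]
    have hd : ∀ x : ℝ, HasDerivAt (fun x : ℝ => -(1 - x) ^ (k + 1)) ((k + 1) * (1 - x) ^ k) x := by
      intro x
      refine (((hasDerivAt_id x).const_sub 1).pow (k + 1)).neg.congr_deriv ?_
      simp
    rw [intervalIntegral.integral_eq_sub_of_hasDerivAt (fun x _ => hd x)
      (by apply Continuous.intervalIntegrable; fun_prop)]
    simp
  have hm : Measurable fun p : ℝ × ℝ => (Ici (headProb p.1)).indicator
      (fun x : ℝ => ((k : ℝ) + 1) * (1 - x) ^ k) p.2 := by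
    have : (fun p : ℝ × ℝ => (Ici (headProb p.1)).indicator
        (fun x : ℝ => ((k : ℝ) + 1) * (1 - x) ^ k) p.2)
        = {p : ℝ × ℝ | headProb p.1 ≤ p.2}.indicator
          fun p => ((k : ℝ) + 1) * (1 - p.2) ^ k := by
      ext p; simp [indicator]
    rw [this]
    exact Measurable.indicator (by fun_prop) (measurableSet_le (by fun_prop) (by fun_prop))
  have hint : Integrable (fun p : ℝ × ℝ => (Ici (headProb p.1)).indicator
      (fun x : ℝ => ((k : ℝ) + 1) * (1 - x) ^ k) p.2)
      ((F : Measure ℝ).prod (volume.restrict (Ioc (0 : ℝ) 1))) := by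
    refine Integrable.of_bound (C := k + 1) hm.aestronglyMeasurable ?_
    have hae : ∀ᵐ p ∂((F : Measure ℝ).prod (volume.restrict (Ioc (0 : ℝ) 1))),
        p.2 ∈ Ioc (0 : ℝ) 1 := by
      have h1 : ∀ᵐ x ∂(volume.restrict (Ioc (0 : ℝ) 1)), x ∈ Ioc (0 : ℝ) 1 :=
        ae_restrict_mem measurableSet_Ioc
      exact Measure.quasiMeasurePreserving_snd.ae h1
    filter_upwards [hae] with p hp
    refine (norm_indicator_le_norm_self _ _).trans ?_
    have h0 : 0 ≤ 1 - p.2 := by linarith [hp.2]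
    rw [Real.norm_eq_abs, abs_of_nonneg (by positivity)]
    exact mul_le_of_le_one_right (by positivity) (pow_le_one₀ h0 (by linarith [hp.1]))
  rw [surv, intervalIntegral.integral_of_le zero_le_one]
  simp_rw [hpt]
  rw [integral_integral_swap hint]
  -- The point 1 is removed because `headProb y ≤ x` and `y ≤ x` are equivalent only for 0 ≤ x < 1.
  rw [← integral_Ico_eq_integral_Ioc, ← integral_Ico_eq_integral_Ioc]
  refine integral_congr_ae ?_
  have h0 : ∀ᵐ x : ℝ ∂(volume.restrict (Ico (0 : ℝ) 1)), x ∈ Ico (0 : ℝ) 1 :=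
    ae_restrict_mem measurableSet_Ico
  filter_upwards [h0] with x hx
  have : (fun y => (Ici (headProb y)).indicator (fun x : ℝ => ((k : ℝ) + 1) * (1 - x) ^ k) x)
      = (Iic x).indicator fun _ => ((k : ℝ) + 1) * (1 - x) ^ k := by
    ext y
    have : headProb y ≤ x ↔ y ≤ x := by
      rw [headProb, max_le_iff, min_le_iff]
      constructor
      · rintro ⟨_, h | h⟩
        · exact h
        · exact absurd h (not_le.2 hx.2)
      · intro h; exact ⟨hx.1, Or.inl h⟩
    simp [indicator, this]
  rw [this, integral_indicator_const _ measurableSet_Iic, cdf_eq_real, smul_eq_mul, mul_comm]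

/-! ### Asymptotics of the probability of a run of tails -/

/-- The ratio `k! / (k + j)!`. -/
def factRatio (j k : ℕ) : ℝ := (k ! : ℝ) / (k + j)!

theorem factRatio_le (j k : ℕ) : factRatio j k ≤ 1 / ((k : ℝ) + 1) ^ j := by
  rw [factRatio, div_le_div_iff₀ (by positivity) (by positivity), one_mul]
  exact_mod_cast Nat.factorial_mul_pow_le_factorial

theorem le_factRatio (j k : ℕ) (hk : 1 ≤ k) : 1 / ((k : ℝ) + j) ^ j ≤ factRatio j k := by
  have : (0 : ℝ) < k := by exact_mod_cast hk
  rw [factRatio, div_le_div_iff₀ (by positivity) (by positivity), one_mul]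
  have h1 : (k + 1).ascFactorial j ≤ (k + j) ^ j := Nat.ascFactorial_le_pow_add k j
  have h2 := Nat.factorial_mul_ascFactorial k j
  rw [← h2]
  exact_mod_cast Nat.mul_le_mul_left _ h1

/-- The bound on the distribution function is integrated against k(1-x)^(k-1), under which x^j has
integral j!·k!/(k+j)! by the Beta integral. -/
theorem abs_surv_sub_le {F : ProbabilityMeasure ℝ} {c d e : ℝ} {j l : ℕ}
    (h : ∀ x ∈ Icc (0 : ℝ) 1, |cdf (F : Measure ℝ) x - c * x ^ j| ≤ d * x ^ j + e * x ^ l)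
    {k : ℕ} (hk : 1 ≤ k) :
    |surv F k - c * (j ! * factRatio j k)|
      ≤ d * (j ! * factRatio j k) + e * (l ! * factRatio l k) := by
  obtain ⟨k, rfl⟩ : ∃ k', k = k' + 1 := ⟨k - 1, by omega⟩
  have hI : ∀ j : ℕ, ∫ x in (0 : ℝ)..1, (k + 1) * (1 - x) ^ k * x ^ j
      = j ! * factRatio j (k + 1) := by
    intro j
    have : ∀ x : ℝ, ((k : ℝ) + 1) * (1 - x) ^ k * x ^ j = (k + 1) * (x ^ j * (1 - x) ^ k) := by
      intro x; ring
    simp_rw [this]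
    rw [intervalIntegral.integral_const_mul, integral_pow_mul_one_sub_pow, factRatio,
      show j + k + 1 = k + 1 + j by ring, Nat.factorial_succ k]
    push_cast; ring
  have hcdf : IntervalIntegrable (fun x => ((k : ℝ) + 1) * (1 - x) ^ k * cdf (F : Measure ℝ) x)
      volume 0 1 := by
    refine IntervalIntegrable.continuousOn_mul ?_ (by fun_prop)
    exact (monotone_cdf (F : Measure ℝ)).intervalIntegrable
  have hpow : ∀ j : ℕ, IntervalIntegrable (fun x : ℝ => ((k : ℝ) + 1) * (1 - x) ^ k * x ^ j)
      volume 0 1 := fun j => by apply Continuous.intervalIntegrable; fun_prop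
  rw [surv_succ_eq_integral, ← hI, ← hI, ← intervalIntegral.integral_const_mul,
    ← intervalIntegral.integral_const_mul, ← intervalIntegral.integral_const_mul,
    ← intervalIntegral.integral_sub hcdf ((hpow j).const_mul c),
    ← intervalIntegral.integral_add ((hpow j).const_mul d) ((hpow l).const_mul e)]
  refine (intervalIntegral.abs_integral_le_integral_abs zero_le_one).trans ?_
  refine intervalIntegral.integral_mono_on zero_le_one
    (hcdf.sub ((hpow j).const_mul c)).abs
    (((hpow j).const_mul d).add ((hpow l).const_mul e)) fun x hx => ?_
  have h0 : 0 ≤ 1 - x := by linarith [hx.2]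
  have h1 : 0 ≤ ((k : ℝ) + 1) * (1 - x) ^ k := by positivity
  calc _ = |((k : ℝ) + 1) * (1 - x) ^ k * (cdf (F : Measure ℝ) x - c * x ^ j)| := by ring_nf
    _ = ((k : ℝ) + 1) * (1 - x) ^ k * |cdf (F : Measure ℝ) x - c * x ^ j| := by
      rw [abs_mul, abs_of_nonneg h1]
    _ ≤ ((k : ℝ) + 1) * (1 - x) ^ k * (d * x ^ j + e * x ^ l) :=
      mul_le_mul_of_nonneg_left (h x hx) h1
    _ = _ := by ring

/-- The probability of `k` tails is `F^(m)(0) / k ^ m`, up to lower order terms. -/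
theorem surv_estimate {F : ProbabilityMeasure ℝ} {m : ℕ} {B δ r w : ℝ} (hr : r < δ) (hr0 : 0 < r)
    (hr1 : r ≤ 1)
    (hd : ∀ k < m, ∀ x ∈ Ico (0 : ℝ) δ, DifferentiableWithinAt ℝ (cdfDeriv F k) (Ici 0) x)
    (h0 : ∀ k < m, cdfDeriv F k 0 = 0) (ha : cdfDeriv F m 0 ∈ Icc 0 B)
    (hw : ∀ x ∈ Icc (0 : ℝ) r, |cdfDeriv F m x - cdfDeriv F m 0| ≤ w) {k : ℕ} (hk : 1 ≤ k) :
    |surv F k - cdfDeriv F m 0 / k ^ m|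
      ≤ (w + (B * m ^ 2 + (1 + B) * (m + 1)!) / r ^ (m + 1) / k) / k ^ m := by
  have hw0 : 0 ≤ w := (abs_nonneg _).trans (hw 0 ⟨le_rfl, hr0.le⟩)
  have hB0 : 0 ≤ B := ha.1.trans ha.2
  have hk0 : (0 : ℝ) < k := by exact_mod_cast hk
  have h1 := abs_surv_sub_le (fun x hx => abs_cdf_sub_le hr hr0 hd h0 ha hw hx) hk
  set a := cdfDeriv F m 0
  have hf : (m ! : ℝ) ≠ 0 := by positivity
  have e1 : a / m ! * (m ! * factRatio m k) = a * factRatio m k := by field_simp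
  have e2 : w / m ! * (m ! * factRatio m k) = w * factRatio m k := by field_simp
  rw [e1, e2] at h1
  have hb1 : ∀ j, factRatio j k ≤ 1 / (k : ℝ) ^ j := fun j =>
    (factRatio_le j k).trans (one_div_le_one_div_of_le (by positivity)
      (pow_le_pow_left₀ hk0.le (by linarith) j))
  -- The ratio is at least (k+m)^(-m), and Bernoulli's inequality for (1 - m/(k+m))^m compares this
  -- with k^(-m).
  have hb2 : (1 - (m : ℝ) ^ 2 / k) / k ^ m ≤ factRatio m k := by
    refine le_trans ?_ (le_factRatio m k hk)
    have hb : 1 + (m : ℝ) * (-(m / (k + m))) ≤ (1 + -((m : ℝ) / (k + m))) ^ m := by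
      refine one_add_mul_le_pow ?_ m
      have : (m : ℝ) / (k + m) ≤ 1 := by rw [div_le_one (by positivity)]; linarith
      linarith
    have h3 : (1 + -((m : ℝ) / (k + m))) = k / (k + m) := by field_simp; ring
    rw [h3, div_pow] at hb
    have h4 : (m : ℝ) * (m / (k + m)) ≤ m ^ 2 / k := by
      rw [sq, mul_div_assoc]
      gcongr
      linarith [(Nat.cast_nonneg m : (0 : ℝ) ≤ m)]
    rw [div_le_iff₀ (by positivity), one_div_mul_eq_div]
    linarith
  have h3 : |a * factRatio m k - a / k ^ m| ≤ B * (m ^ 2 / k / k ^ m) := by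
    have h4 : a * factRatio m k - a / k ^ m = -(a * (1 / k ^ m - factRatio m k)) := by ring
    rw [h4, abs_neg, abs_mul, abs_of_nonneg ha.1, abs_of_nonneg (by linarith [hb1 m])]
    refine mul_le_mul ha.2 ?_ (by linarith [hb1 m]) hB0
    have : (1 - (m : ℝ) ^ 2 / k) / k ^ m = 1 / k ^ m - m ^ 2 / k / k ^ m := by ring
    linarith
  have hr2 : 1 ≤ 1 / r ^ (m + 1) := by
    rw [le_div_iff₀ (by positivity), one_mul]; exact pow_le_one₀ hr0.le hr1
  calc |surv F k - a / k ^ m|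
      ≤ |surv F k - a * factRatio m k| + |a * factRatio m k - a / k ^ m| := abs_sub_le _ _ _
    _ ≤ (w * factRatio m k + (1 + B) / r ^ (m + 1) * ((m + 1)! * factRatio (m + 1) k))
        + B * (m ^ 2 / k / k ^ m) := add_le_add h1 h3
    _ ≤ (w * (1 / (k : ℝ) ^ m) + (1 + B) / r ^ (m + 1) * ((m + 1)! * (1 / (k : ℝ) ^ (m + 1))))
        + (1 / r ^ (m + 1)) * (B * (m ^ 2 / k / k ^ m)) := by
      refine add_le_add ?_ (le_mul_of_one_le_left (by positivity) hr2)
      gcongr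
      · exact hb1 m
      · exact hb1 (m + 1)
    _ = _ := by field_simp; ring

/-- Half of the tails pays for the head: y(1-y)^l ≤ 1/(l+1), because (1 + ly)(1-y)^l ≤ (1 - y²)^l ≤
1. The other half integrates to `surv F l`. -/
theorem survHead_le (F : ProbabilityMeasure ℝ) (k : ℕ) :
    survHead F k ≤ 2 / ((k : ℝ) + 1) * surv F (k / 2) := by
  set l := k / 2 with hl
  have hkl : (k : ℝ) + 1 ≤ 2 * (l + 1) := by
    have : k + 1 ≤ 2 * (l + 1) := by omega
    exact_mod_cast this
  have h1 : survHead F (l + l) ≤ 1 / ((l : ℝ) + 1) * surv F l := by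
    rw [survHead, surv, ← integral_const_mul]
    refine integral_mono (integrable_survHead F _) ((integrable_surv F l).const_mul _) fun x => ?_
    set y := headProb x with hy
    have hy0 : 0 ≤ y := headProb_nonneg x
    have hy1 : 0 ≤ 1 - y := one_sub_headProb_nonneg x
    have h3 : y * (1 - y) ^ l ≤ 1 / ((l : ℝ) + 1) := by
      rw [le_div_iff₀ (by positivity)]
      calc y * (1 - y) ^ l * (l + 1) = (y + l * y) * (1 - y) ^ l := by ring
        _ ≤ (1 + l * y) * (1 - y) ^ l := by gcongr; linarith
        _ ≤ (1 + y) ^ l * (1 - y) ^ l := by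
          gcongr; exact one_add_mul_le_pow (by linarith) l
        _ = ((1 + y) * (1 - y)) ^ l := (mul_pow _ _ _).symm
        _ ≤ 1 := pow_le_one₀ (by positivity) (by nlinarith)
    calc y * (1 - y) ^ (l + l) = (y * (1 - y) ^ l) * (1 - y) ^ l := by rw [pow_add]; ring
      _ ≤ _ := by gcongr
  calc survHead F k ≤ survHead F (l + l) := survHead_antitone F (by omega)
    _ ≤ 1 / ((l : ℝ) + 1) * surv F l := h1
    _ ≤ _ := by
      gcongr ?_ * _
      · exact surv_nonneg F l
      · rw [div_le_div_iff₀ (by positivity) (by positivity)]; linarith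

/-- Markov's inequality for the clipped mean. -/
theorem survHead_zero_ge (F : ProbabilityMeasure ℝ) {t : ℝ} (ht1 : t ≤ 1) :
    t * (1 - cdf (F : Measure ℝ) t) ≤ survHead F 0 := by
  have h1 : (F : Measure ℝ).real (Ioi t) = 1 - cdf (F : Measure ℝ) t := by
    rw [cdf_eq_real, ← compl_Iic, probReal_compl_eq_one_sub measurableSet_Iic]
  rw [← h1, mul_comm, ← smul_eq_mul, ← integral_indicator_const _ measurableSet_Ioi, survHead]
  refine integral_mono ((integrable_const t).indicator measurableSet_Ioi)
    (integrable_survHead F 0) fun x => ?_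
  by_cases hx : x ∈ Ioi t
  · simpa [indicator_of_mem hx] using le_headProb ht1 (le_of_lt hx)
  · simpa [indicator_of_notMem hx] using headProb_nonneg x

/-! ### Upper bounds uniform over the family -/

theorem IsAdmissibleFamily.deriv_mem_Icc {m : ℕ} {B : ℝ} {𝓕 : Set (ProbabilityMeasure ℝ)}
    (hB : 0 < B) (h𝓕 : IsAdmissibleFamily m B 𝓕) {F : ProbabilityMeasure ℝ} (hF : F ∈ 𝓕) :
    cdfDeriv F m 0 ∈ Icc 0 B :=
  ⟨(one_div_pos.2 hB).le.trans (h𝓕.deriv_mem F hF).1, (h𝓕.deriv_mem F hF).2⟩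

/-- The distribution functions of an admissible family are uniformly `O(x ^ m)`. -/
theorem IsAdmissibleFamily.exists_cdf_le {m : ℕ} {B : ℝ} {𝓕 : Set (ProbabilityMeasure ℝ)}
    (hB : 0 < B) (h𝓕 : IsAdmissibleFamily m B 𝓕) :
    ∃ C ≥ (1 : ℝ), ∀ F ∈ 𝓕, ∀ x ∈ Icc (0 : ℝ) 1, cdf (F : Measure ℝ) x ≤ C * x ^ m := by
  obtain ⟨δ, hδ, hd⟩ := h𝓕.differentiable
  obtain ⟨δ', hδ', hw⟩ := h𝓕.equicontinuous 1 one_pos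
  set r := min δ δ' / 2 with hr
  have hr0 : 0 < r := by positivity
  have hrd : r < δ := by have := min_le_left δ δ'; linarith
  have hrd' : r < δ' := by have := min_le_right δ δ'; linarith
  have hC : 0 ≤ (1 + B) / r ^ (m + 1) := by positivity
  refine ⟨1 + B + 1 + (1 + B) / r ^ (m + 1), by linarith, fun F hF x hx => ?_⟩
  have ha := h𝓕.deriv_mem_Icc hB hF
  have h1 := (abs_le.1 (abs_cdf_sub_le hrd hr0 (hd F hF) (h𝓕.lower_deriv_zero F hF) ha
    (fun x hx => hw F hF x ⟨hx.1, hx.2.trans_lt hrd'⟩) hx)).2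
  have hf : (1 : ℝ) ≤ m ! := by exact_mod_cast Nat.one_le_iff_ne_zero.2 (Nat.factorial_ne_zero m)
  have hx0 : 0 ≤ x ^ m := pow_nonneg hx.1 m
  have h2 : cdfDeriv F m 0 / m ! * x ^ m ≤ B * x ^ m := by
    gcongr; exact (div_le_self ha.1 hf).trans ha.2
  have h3 : (1 : ℝ) / m ! * x ^ m ≤ 1 * x ^ m := by
    gcongr; exact div_le_self zero_le_one hf
  have h4 : (1 + B) / r ^ (m + 1) * x ^ (m + 1) ≤ (1 + B) / r ^ (m + 1) * x ^ m :=
    mul_le_mul_of_nonneg_left (pow_le_pow_of_le_one hx.1 hx.2 (Nat.le_succ m)) hC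
  nlinarith

theorem surv_le_of_cdf_le {F : ProbabilityMeasure ℝ} {m : ℕ} {C : ℝ} (hC : 1 ≤ C)
    (h : ∀ x ∈ Icc (0 : ℝ) 1, cdf (F : Measure ℝ) x ≤ C * x ^ m) (k : ℕ) :
    surv F k ≤ C * m ! / ((k : ℝ) + 1) ^ m := by
  rcases Nat.eq_zero_or_pos k with rfl | hk
  · rw [surv_zero]
    have : (1 : ℝ) ≤ m ! := by exact_mod_cast Nat.one_le_iff_ne_zero.2 (Nat.factorial_ne_zero m)
    simp
    nlinarith
  · have h1 := abs_surv_sub_le (F := F) (c := 0) (d := C) (e := 0) (j := m) (l := 0)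
      (fun x hx => by
        rw [zero_mul, sub_zero, abs_of_nonneg (cdf_nonneg _ x), zero_mul, add_zero]
        exact h x hx) hk
    simp only [zero_mul, sub_zero, add_zero] at h1
    refine (le_abs_self _).trans (h1.trans ?_)
    have := factRatio_le m k
    calc C * (m ! * factRatio m k) ≤ C * (m ! * (1 / ((k : ℝ) + 1) ^ m)) := by gcongr
      _ = _ := by ring

theorem survHead_le_of_cdf_le {F : ProbabilityMeasure ℝ} {m : ℕ} {C : ℝ} (hC : 1 ≤ C)
    (h : ∀ x ∈ Icc (0 : ℝ) 1, cdf (F : Measure ℝ) x ≤ C * x ^ m) (k : ℕ) :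
    survHead F k ≤ C * m ! * 2 ^ (m + 1) / ((k : ℝ) + 1) ^ (m + 1) := by
  have h1 := surv_le_of_cdf_le hC h (k / 2)
  have hkl : ((k : ℝ) + 1) / 2 ≤ ((k / 2 : ℕ) : ℝ) + 1 := by
    have : k + 1 ≤ 2 * (k / 2 + 1) := by omega
    have : (k : ℝ) + 1 ≤ 2 * (((k / 2 : ℕ) : ℝ) + 1) := by exact_mod_cast this
    linarith
  calc survHead F k ≤ 2 / ((k : ℝ) + 1) * surv F (k / 2) := survHead_le F k
    _ ≤ 2 / ((k : ℝ) + 1) * (C * m ! / (((k : ℝ) + 1) / 2) ^ m) := by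
      gcongr
      refine h1.trans ?_
      gcongr
    _ = _ := by rw [div_pow]; field_simp; ring

/-! ### The lower bound -/

/-- Every strategy loses at least a constant times `K / n ^ (1/m)`. -/
theorem IsAdmissibleFamily.exists_lower_bound {m : ℕ} (hm : 1 ≤ m) {B : ℝ}
    {𝓕 : Set (ProbabilityMeasure ℝ)} (hB : 0 < B) (h𝓕 : IsAdmissibleFamily m B 𝓕) :
    ∃ c > (0 : ℝ), ∀ F ∈ 𝓕, ∀ N K : ℕ, 1 ≤ N → 1 ≤ K → ∀ S : Strategy,
      K / (machines m N K : ℝ) ^ (1 / m : ℝ) ≤ c * expectedLoss F N K S := by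
  obtain ⟨C, hC, hcdf⟩ := h𝓕.exists_cdf_le hB
  have hm0 : (0 : ℝ) < m := by exact_mod_cast hm
  -- A lower bound for the expected mean: at most half of the mass lies below 1/(2C).
  set p : ℝ := 1 / (4 * C) with hp
  have hp0 : 0 < p := by positivity
  refine ⟨2 * (2 * C) ^ (1 / m : ℝ) + 2 * (1 + C / p), by positivity, ?_⟩
  intro F hF N K hN hK S
  have hK0 : (0 : ℝ) < K := by exact_mod_cast hK
  have hN0 : (0 : ℝ) < N := by exact_mod_cast hN
  set L := expectedLoss F N K S
  set D := expectedPulled F N K S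
  have hL0 : 0 ≤ L := expectedLoss_nonneg F N K S
  have hD0 : 0 ≤ D := expectedPulled_nonneg F N K S
  have hDN : D ≤ N := expectedPulled_le F N K S
  have hmean : p ≤ survHead F 0 := by
    have ht0 : 0 ≤ 1 / (2 * C) := by positivity
    have ht1 : 1 / (2 * C) ≤ 1 := by rw [div_le_one (by positivity)]; linarith
    refine le_trans ?_ (survHead_zero_ge F ht1)
    have h1 := hcdf F hF _ ⟨ht0, ht1⟩
    have h2 : (1 / (2 * C)) ^ m ≤ 1 / (2 * C) := pow_le_of_le_one ht0 ht1 (by omega)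
    have h3 : C * (1 / (2 * C)) ^ m ≤ 1 / 2 := by
      calc C * (1 / (2 * C)) ^ m ≤ C * (1 / (2 * C)) := by gcongr
        _ = 1 / 2 := by field_simp
    calc p = 1 / (2 * C) * (1 - 1 / 2) := by rw [hp]; field_simp; norm_num
      _ ≤ _ := by gcongr; linarith
  have hpD : p * D ≤ L :=
    (mul_le_mul_of_nonneg_right hmean hD0).trans (mean_mul_expectedPulled_le F hN hK S)
  have hmain : ∀ t : ℝ, 0 ≤ t → t ≤ 1 → t * K ≤ L + t * K * (C * t ^ m * D) := by
    intro t ht0 ht1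
    refine (mul_pulls_le F hN K S ht0 ht1).trans ?_
    gcongr
    refine le_trans ?_ (hcdf F hF t ⟨ht0, ht1⟩)
    rw [cdf_eq_real]
    exact measureReal_mono Iio_subset_Iic_self
  have h2C : 0 ≤ 2 * (2 * C) ^ (1 / m : ℝ) * L := by positivity
  have h2p : 0 ≤ 2 * (1 + C / p) * L := by positivity
  rcases le_total N ⌊(K : ℝ) ^ ((m : ℝ) / (m + 1))⌋₊ with h | h
  · rw [machines, min_eq_left h]
    -- With this t all N bandits together have means below t with probability at most C·t^m·N = 1/2.
    set t : ℝ := 1 / (2 * C * N) ^ (1 / m : ℝ) with ht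
    have hCN : 1 ≤ 2 * C * N := by
      have : (1 : ℝ) ≤ N := by exact_mod_cast hN
      nlinarith
    have ht1 : t ≤ 1 := by
      rw [ht, div_le_one (by positivity)]; exact Real.one_le_rpow hCN (by positivity)
    have htm : t ^ m = 1 / (2 * C * N) := by
      rw [ht, div_pow, one_pow, ← Real.rpow_natCast, ← Real.rpow_mul (by positivity),
        one_div_mul_cancel hm0.ne', Real.rpow_one]
    have h1 := hmain t (by positivity) ht1
    have h2 : C * t ^ m * D ≤ 1 / 2 := by
      rw [htm]
      calc C * (1 / (2 * C * N)) * D ≤ C * (1 / (2 * C * N)) * N := by gcongr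
        _ = 1 / 2 := by field_simp
    have h3 : t * K ≤ 2 * L := by
      have : t * K * (C * t ^ m * D) ≤ t * K * (1 / 2) := by gcongr
      linarith
    have h4 : K / (N : ℝ) ^ (1 / m : ℝ) = (2 * C) ^ (1 / m : ℝ) * (t * K) := by
      rw [ht, Real.mul_rpow (by positivity) hN0.le]
      field_simp
    rw [h4]
    have : (2 * C) ^ (1 / m : ℝ) * (t * K) ≤ (2 * C) ^ (1 / m : ℝ) * (2 * L) := by gcongr
    nlinarith
  · rw [machines, min_eq_right h]
    set y : ℝ := (K : ℝ) ^ ((m : ℝ) / (m + 1)) with hy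
    have hy1 : 1 ≤ y := Real.one_le_rpow (by exact_mod_cast hK) (by positivity)
    have hfl : y / 2 ≤ (⌊y⌋₊ : ℝ) := by
      have h1 := Nat.lt_floor_add_one y
      have h2 : (1 : ℝ) ≤ ⌊y⌋₊ := by exact_mod_cast Nat.one_le_floor_iff y |>.2 hy1
      linarith
    -- Now t^(m+1)·K = 1, so the correction is C·D, which the cost of the first pulls bounds by
    -- C·L/p.
    set t : ℝ := 1 / (K : ℝ) ^ (1 / (m + 1) : ℝ) with ht
    have ht1 : t ≤ 1 := by
      rw [ht, div_le_one (by positivity)]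
      exact Real.one_le_rpow (by exact_mod_cast hK) (by positivity)
    have htK : t ^ (m + 1) * K = 1 := by
      rw [ht, div_pow, one_pow, ← Real.rpow_natCast, ← Real.rpow_mul hK0.le]
      push_cast
      rw [one_div_mul_cancel (by positivity), Real.rpow_one]
      field_simp
    have h1 := hmain t (by positivity) ht1
    have h2 : t * K * (C * t ^ m * D) = C * D * (t ^ (m + 1) * K) := by ring
    have hDL : D ≤ L / p := by rw [le_div_iff₀ hp0]; linarith
    rw [h2, htK, mul_one] at h1
    have h3 : t * K ≤ (1 + C / p) * L := by
      have : C * D ≤ C * (L / p) := by gcongr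
      calc t * K ≤ L + C * (L / p) := by linarith
        _ = _ := by ring
    have h4 : K / (⌊y⌋₊ : ℝ) ^ (1 / m : ℝ) ≤ 2 * (t * K) := by
      have hyr : y ^ (1 / m : ℝ) = (K : ℝ) ^ (1 / (m + 1) : ℝ) := by
        rw [hy, ← Real.rpow_mul hK0.le]
        congr 1
        field_simp
      have h5 : (K : ℝ) ^ (1 / (m + 1) : ℝ) / 2 ≤ (⌊y⌋₊ : ℝ) ^ (1 / m : ℝ) := by
        calc (K : ℝ) ^ (1 / (m + 1) : ℝ) / 2 ≤ (K : ℝ) ^ (1 / (m + 1) : ℝ) / 2 ^ (1 / m : ℝ) := by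
              gcongr
              calc (2 : ℝ) ^ (1 / m : ℝ) ≤ 2 ^ (1 : ℝ) := by
                    gcongr
                    · norm_num
                    · rw [div_le_one hm0]; exact_mod_cast hm
                _ = 2 := Real.rpow_one 2
          _ = (y / 2) ^ (1 / m : ℝ) := by rw [Real.div_rpow (by positivity) (by norm_num), hyr]
          _ ≤ _ := by gcongr
      calc K / (⌊y⌋₊ : ℝ) ^ (1 / m : ℝ) ≤ K / ((K : ℝ) ^ (1 / (m + 1) : ℝ) / 2) := by gcongr
        _ = 2 * (t * K) := by rw [ht]; field_simp
    nlinarith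

/-! ### The number of tails before the first head -/

/-- The number of tails before the first head of a bandit. -/
def rowTails (r : ℝ × (ℕ → unitInterval)) : ℕ := sInf {j | r ∈ headSet j}

theorem tailsBeforeHead_eq (ω : Env) (i : ℕ) : tailsBeforeHead ω i = rowTails (ω i) := by
  simp only [tailsBeforeHead, rowTails, mem_headSet_iff]

theorem le_rowTails_iff {r : ℝ × (ℕ → unitInterval)} (h : ∃ j, r ∈ headSet j) (k : ℕ) :
    k ≤ rowTails r ↔ r ∈ tailSet k := by
  constructor
  · intro hk j hj hr
    exact Nat.notMem_of_lt_sInf (lt_of_lt_of_le hj hk) hr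
  · intro hr
    by_contra hk
    exact hr _ (not_le.1 hk) (Nat.sInf_mem (s := {j | r ∈ headSet j}) h)

/-- A row without any head has `sInf ∅ = 0` as its number of tails; this forces k ≥ 1 and the
intersection with the rows that have a head. -/
theorem setOf_le_rowTails {k : ℕ} (hk : 1 ≤ k) :
    {r | k ≤ rowTails r} = tailSet k ∩ ⋃ j, headSet j := by
  ext r
  rw [mem_inter_iff, mem_iUnion]
  by_cases h : ∃ j, r ∈ headSet j
  · simp [h, le_rowTails_iff h]
  · have h1 : {j | r ∈ headSet j} = ∅ := by
      ext j; simp only [mem_ofPred_eq, mem_empty_iff_false, iff_false]; exact fun hj => h ⟨j, hj⟩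
    have h2 : rowTails r = 0 := by rw [rowTails, h1, Nat.sInf_empty]
    simp only [mem_ofPred_eq, h2, h, and_false, iff_false]
    omega

theorem measurable_rowTails : Measurable rowTails := by
  refine measurable_of_Ici fun k => ?_
  rcases Nat.eq_zero_or_pos k with rfl | hk
  · have : rowTails ⁻¹' Ici 0 = univ := by ext; simp
    rw [this]; exact MeasurableSet.univ
  · have : rowTails ⁻¹' Ici k = tailSet k ∩ ⋃ j, headSet j := setOf_le_rowTails hk
    rw [this]
    exact (measurableSet_tailSet k).inter (MeasurableSet.iUnion measurableSet_headSet)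

theorem rowLaw_real_tailSet (F : ProbabilityMeasure ℝ) (k : ℕ) :
    (rowLaw F).real (tailSet k) = surv F k := by
  rw [measureReal_def, rowLaw_tailSet, ENNReal.toReal_ofReal (surv_nonneg F k)]

/-- Rows without a head form a null set: their probability is at most `surv F l` for every l, which
tends to 0. -/
theorem rowLaw_le_rowTails {F : ProbabilityMeasure ℝ}
    (hF : Filter.Tendsto (surv F) Filter.atTop (nhds 0)) {k : ℕ} (hk : 1 ≤ k) :
    (rowLaw F).real {r | k ≤ rowTails r} = surv F k := by
  have h0 : (rowLaw F).real (⋃ j, headSet j)ᶜ = 0 := by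
    refine le_antisymm (ge_of_tendsto hF ?_) measureReal_nonneg
    refine Filter.Eventually.of_forall fun l => ?_
    rw [← rowLaw_real_tailSet]
    refine measureReal_mono fun r hr j _ hj => hr (mem_iUnion.2 ⟨j, hj⟩)
  rw [setOf_le_rowTails hk, ← rowLaw_real_tailSet]
  refine measureReal_congr ?_
  have h1 : ∀ᵐ r ∂(rowLaw F), r ∈ ⋃ j, headSet j := by
    rw [ae_iff]
    rw [measureReal_def, ENNReal.toReal_eq_zero_iff] at h0
    exact h0.resolve_right (measure_ne_top _ _)
  filter_upwards [h1] with r hr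
  exact propext ⟨fun h => h.1, fun h => ⟨h, hr⟩⟩

/-- The sample `μ_i` obtained from a bandit. -/
def rowSample (r : ℝ × (ℕ → unitInterval)) : ℝ := recipTails (rowTails r)

theorem recipTails_pos (T : ℕ) : 0 < recipTails T :=
  one_div_pos.2 (lt_of_lt_of_le one_pos (le_max_right _ _))

theorem recipTails_le_one (T : ℕ) : recipTails T ≤ 1 := by
  rw [recipTails, div_le_one (lt_of_lt_of_le one_pos (le_max_right _ _))]
  exact le_max_right _ _

theorem measurable_rowSample : Measurable rowSample :=
  measurable_from_nat.comp measurable_rowTails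

theorem lt_recipTails_iff {t : ℝ} (ht0 : 0 < t) (ht1 : t < 1) (T : ℕ) :
    t < recipTails T ↔ ¬ ⌈1 / t⌉₊ ≤ T := by
  have h1 : 1 < 1 / t := (one_lt_div ht0).2 ht1
  rw [Nat.ceil_le, not_le, recipTails, lt_div_iff₀ (lt_of_lt_of_le one_pos (le_max_right _ _)),
    lt_div_iff₀ ht0, mul_comm]
  constructor
  · intro h
    exact lt_of_le_of_lt (mul_le_mul_of_nonneg_right (le_max_left _ _) ht0.le) h
  · intro h
    rcases max_cases (T : ℝ) 1 with ⟨h2, _⟩ | ⟨h2, _⟩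
    · rw [h2]; exact h
    · rw [h2, one_mul]; exact ht1

theorem rowLaw_lt_rowSample {F : ProbabilityMeasure ℝ}
    (hF : Filter.Tendsto (surv F) Filter.atTop (nhds 0)) {t : ℝ} (ht0 : 0 < t) (ht1 : t < 1) :
    (rowLaw F).real {r | t < rowSample r} = 1 - surv F ⌈1 / t⌉₊ := by
  have h1 : {r | t < rowSample r} = {r | ⌈1 / t⌉₊ ≤ rowTails r}ᶜ := by
    ext r; exact lt_recipTails_iff ht0 ht1 _
  have hk : 1 ≤ ⌈1 / t⌉₊ := Nat.one_le_ceil_iff.2 (by positivity)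
  rw [h1, probReal_compl_eq_one_sub, rowLaw_le_rowTails hF hk]
  exact measurable_rowTails measurableSet_Ici

/-! ### Minima of pools -/

/-- The minimum of the samples in a pool. -/
def poolMin (q : ℕ) (y : Fin q → ℝ × (ℕ → unitInterval)) : ℝ := ⨅ j, rowSample (y j)

theorem lt_iInf_fin_iff {q : ℕ} [Nonempty (Fin q)] (x : Fin q → ℝ) (t : ℝ) :
    t < ⨅ j, x j ↔ ∀ j, t < x j := by
  constructor
  · intro h j
    exact h.trans_le (ciInf_le (finite_range x).bddBelow j)
  · intro h
    obtain ⟨j, hj⟩ := (range_nonempty x).csInf_mem (finite_range x)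
    rw [iInf, ← hj]
    exact h j

theorem measurable_poolMin (q : ℕ) : Measurable (poolMin q) := by
  unfold poolMin
  exact Measurable.iInf fun j => measurable_rowSample.comp (measurable_pi_apply j)

theorem poolMin_mem_Icc {q : ℕ} (hq : 1 ≤ q) (y : Fin q → ℝ × (ℕ → unitInterval)) :
    poolMin q y ∈ Icc (0 : ℝ) 1 := by
  have : Nonempty (Fin q) := ⟨⟨0, hq⟩⟩
  refine ⟨le_ciInf fun j => (recipTails_pos _).le, ?_⟩
  exact (ciInf_le (finite_range _).bddBelow ⟨0, hq⟩).trans (recipTails_le_one _)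

/-- The bandits of pool `k`. -/
def pool (q k : ℕ) (ω : Env) : Fin q → ℝ × (ℕ → unitInterval) := fun j => ω (k * q + j)

theorem measurable_pool (q k : ℕ) : Measurable (pool q k) :=
  measurable_pi_iff.2 fun _ => measurable_pi_apply _

theorem pool_index_injective (q : ℕ) :
    Function.Injective fun p : ℕ × Fin q => p.1 * q + (p.2 : ℕ) := by
  rintro ⟨k, j⟩ ⟨k', j'⟩ h
  simp only at h
  have hq : 0 < q := lt_of_le_of_lt (Nat.zero_le _) j.2
  have h1 : k = k' := by
    have := congrArg (· / q) h
    simpa [Nat.mul_comm _ q, Nat.mul_add_div hq, Nat.div_eq_of_lt] using this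
  subst h1
  ext
  · rfl
  · simpa using h

/-- The index map (k, j) ↦ kq + j is injective, so the selected rows again have a product law.
Currying makes this a product over the pools, whose coordinates are independent, and independence is
pulled back along the map ω ↦ pools. -/
theorem iIndepFun_pool (F : ProbabilityMeasure ℝ) (q : ℕ) :
    iIndepFun (pool q) (envLaw F) := by
  have h1 : (envLaw F).map (fun ω k => pool q k ω)
      = Measure.infinitePi fun _ : ℕ => Measure.infinitePi fun _ : Fin q => rowLaw F := by
    have h2 := Measure.map_infinitePi_infinitePi_of_inj (P := fun _ : ℕ => rowLaw F)
      (pool_index_injective q)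
    have h3 := Measure.infinitePi_map_curry (ι := ℕ) (κ := Fin q) (fun _ _ => rowLaw F)
    have hme : Measurable fun (ω : Env) (p : ℕ × Fin q) => ω (p.1 * q + (p.2 : ℕ)) :=
      measurable_pi_iff.2 fun _ => measurable_pi_apply _
    rw [← h2, Measure.map_map (MeasurableEquiv.measurable _) hme] at h3
    exact h3
  have hm : Measurable fun (ω : Env) k => pool q k ω := measurable_pi_iff.2 (measurable_pool q)
  have h4 := iIndepFun_infinitePi (ι := ℕ)
    (P := fun _ : ℕ => Measure.infinitePi fun _ : Fin q => rowLaw F)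
    (X := fun _ y => y) (fun _ => measurable_id)
  rw [← h1] at h4
  rw [iIndepFun_iff_measure_inter_preimage_eq_mul] at h4 ⊢
  intro S sets hS
  have h5 := h4 S hS
  rw [Measure.map_apply hm] at h5
  · rw [Finset.prod_congr rfl fun i hi => Measure.map_apply hm
      ((measurable_pi_apply i) (hS i hi))] at h5
    rw [preimage_iInter₂] at h5
    exact h5
  · exact Finset.measurableSet_biInter _ fun i hi => (measurable_pi_apply i) (hS i hi)

theorem envLaw_lt_poolMin {F : ProbabilityMeasure ℝ}
    (hF : Filter.Tendsto (surv F) Filter.atTop (nhds 0)) {q : ℕ} (hq : 1 ≤ q) (k : ℕ) {t : ℝ}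
    (ht0 : 0 < t) (ht1 : t < 1) :
    (envLaw F).real {ω | t < poolMin q (pool q k ω)} = (1 - surv F ⌈1 / t⌉₊) ^ q := by
  have : Nonempty (Fin q) := ⟨⟨0, hq⟩⟩
  let e : Fin q ↪ ℕ := ⟨fun j => k * q + j, fun j j' h => by ext; simpa using h⟩
  have h1 : {ω | t < poolMin q (pool q k ω)}
      = ((Finset.univ.map e : Finset ℕ) : Set ℕ).pi fun _ => {r | t < rowSample r} := by
    ext ω
    simp only [poolMin, mem_ofPred_eq, lt_iInf_fin_iff, Set.mem_pi]
    constructor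
    · intro h x hx
      obtain ⟨j, -, rfl⟩ := Finset.mem_map.1 (Finset.mem_coe.1 hx)
      exact h j
    · intro h j
      exact h _ (Finset.mem_coe.2 (Finset.mem_map_of_mem e (Finset.mem_univ j)))
  have hms : MeasurableSet {r | t < rowSample r} := measurable_rowSample measurableSet_Ioi
  rw [h1, measureReal_def, envLaw_eq, Measure.infinitePi_pi _ fun _ _ => hms, Finset.prod_const, Finset.card_map, Finset.card_univ,
    Fintype.card_fin, ENNReal.toReal_pow, ← measureReal_def, rowLaw_lt_rowSample hF ht0 ht1]

/-- The expected minimum of a pool. -/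
theorem integral_poolMin {F : ProbabilityMeasure ℝ}
    (hF : Filter.Tendsto (surv F) Filter.atTop (nhds 0)) {q : ℕ} (hq : 1 ≤ q) (k : ℕ) :
    ∫ ω, poolMin q (pool q k ω) ∂(envLaw F)
      = ∫ t in Ioo (0 : ℝ) 1, (1 - surv F ⌈1 / t⌉₊) ^ q := by
  have hm : Measurable fun ω => poolMin q (pool q k ω) :=
    (measurable_poolMin q).comp (measurable_pool q k)
  have hint : Integrable (fun ω => poolMin q (pool q k ω)) (envLaw F) :=
    Integrable.of_mem_Icc 0 1 hm.aemeasurable (ae_of_all _ fun ω => poolMin_mem_Icc hq _)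
  rw [hint.integral_eq_integral_meas_lt (ae_of_all _ fun ω => (poolMin_mem_Icc hq _).1)]
  have h1 : ∫ t in Ioi (0 : ℝ), (envLaw F).real {ω | t < poolMin q (pool q k ω)}
      = ∫ t in Ioo (0 : ℝ) 1, (envLaw F).real {ω | t < poolMin q (pool q k ω)} := by
    refine setIntegral_eq_of_subset_of_forall_sdiff_eq_zero measurableSet_Ioi Ioo_subset_Ioi_self ?_
    intro t ht
    have : 1 ≤ t := by
      by_contra h
      exact ht.2 ⟨ht.1, not_le.1 h⟩
    have : {ω | t < poolMin q (pool q k ω)} = ∅ := by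
      ext ω
      simp only [mem_ofPred_eq, mem_empty_iff_false, iff_false, not_lt]
      exact (poolMin_mem_Icc hq _).2.trans this
    rw [this, measureReal_empty]
  rw [h1]
  exact setIntegral_congr_fun measurableSet_Ioo fun t ht => envLaw_lt_poolMin hF hq k ht.1 ht.2

/-- Hoeffding's inequality for the average of the pool minima. -/
theorem envLaw_average_poolMin {F : ProbabilityMeasure ℝ} {q P : ℕ} (hq : 1 ≤ q) (hP : 1 ≤ P)
    {E : ℝ} (hE : ∀ k, ∫ ω, poolMin q (pool q k ω) ∂(envLaw F) = E) {s : ℝ} (hs : 0 ≤ s) :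
    (envLaw F).real {ω | s ≤ |(∑ k ∈ Finset.range P, poolMin q (pool q k ω)) / P - E|}
      ≤ 2 * Real.exp (-(2 * P * s ^ 2)) := by
  have hP0 : (0 : ℝ) < P := by exact_mod_cast hP
  have hm : ∀ k, Measurable fun ω => poolMin q (pool q k ω) := fun k =>
    (measurable_poolMin q).comp (measurable_pool q k)
  -- Hoeffding's lemma: a centred variable with range in an interval of length 1 has variance proxy
  -- 1/4.
  have hsub : ∀ k, HasSubgaussianMGF (fun ω => poolMin q (pool q k ω) - E)
      ((‖(1 : ℝ) - 0‖₊ / 2) ^ 2) (envLaw F) := fun k => by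
    have := hasSubgaussianMGF_of_mem_Icc (μ := envLaw F) (hm k).aemeasurable
      (ae_of_all _ fun ω => poolMin_mem_Icc hq (pool q k ω))
    rwa [hE k] at this
  have hind : iIndepFun (fun k ω => poolMin q (pool q k ω) - E) (envLaw F) :=
    (iIndepFun_pool F q).comp (fun _ y => poolMin q y - E)
      fun _ => (measurable_poolMin q).sub_const E
  have hind' : iIndepFun (fun k ω => -(poolMin q (pool q k ω) - E)) (envLaw F) :=
    (iIndepFun_pool F q).comp (fun _ y => -(poolMin q y - E))
      fun _ => ((measurable_poolMin q).sub_const E).neg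
  have hexp : -(P * s) ^ 2 / (2 * P * ((((‖(1 : ℝ) - 0‖₊ / 2) ^ 2 : NNReal)) : ℝ))
      = -(2 * P * s ^ 2) := by
    simp
    field_simp
  have h1 := HasSubgaussianMGF.measure_sum_range_ge_le_of_iIndepFun hind (n := P)
    (fun k _ => hsub k) (ε := P * s) (by positivity)
  have h2 := HasSubgaussianMGF.measure_sum_range_ge_le_of_iIndepFun hind' (n := P)
    (fun k _ => (hsub k).neg) (ε := P * s) (by positivity)
  rw [hexp] at h1 h2
  calc _ ≤ (envLaw F).real ({ω | P * s ≤ ∑ k ∈ Finset.range P, (poolMin q (pool q k ω) - E)} ∪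
        {ω | P * s ≤ ∑ k ∈ Finset.range P, -(poolMin q (pool q k ω) - E)}) := by
        refine measureReal_mono fun ω hω => ?_
        have hω' : s ≤ |(∑ k ∈ Finset.range P, poolMin q (pool q k ω)) / P - E| := hω
        have hsum : ∑ k ∈ Finset.range P, (poolMin q (pool q k ω) - E)
            = P * ((∑ k ∈ Finset.range P, poolMin q (pool q k ω)) / P - E) := by
          rw [Finset.sum_sub_distrib]
          simp
          field_simp
        rw [mem_union, mem_ofPred_eq, mem_ofPred_eq, Finset.sum_neg_distrib, hsum]
        rcases le_abs.1 hω' with h | h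
        · left; gcongr
        · right; rw [← mul_neg]; gcongr
    _ ≤ _ := measureReal_union_le _ _
    _ ≤ _ := by linarith

/-- The estimator in terms of the pool minima. -/
theorem bernoulliEstimator_eq (m n : ℕ) (ω : Env) :
    bernoulliEstimator m n (tailsBeforeHead ω)
      = ((m ! : ℕ) : ℝ) ^ (1 / m : ℝ) * ((n : ℝ) ^ (1 / (5 * m) : ℝ) / Real.Gamma (1 + 1 / m) *
        ((∑ k ∈ Finset.range (poolCount n), poolMin (poolSize n) (pool (poolSize n) k ω)) /
          poolCount n)) := by
  rw [bernoulliEstimator, minEstimator]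
  simp_rw [← Real.mul_iInf_of_nonneg (show 0 ≤ ((m ! : ℕ) : ℝ) ^ (1 / m : ℝ) by positivity)]
  rw [← Finset.mul_sum]
  simp only [poolMin, pool, rowSample, tailsBeforeHead_eq]
  ring

/-! ### The mean of a pool minimum -/

theorem integral_exp_neg_mul_pow {m : ℕ} (hm : 1 ≤ m) {c : ℝ} (hc : 0 < c) :
    ∫ t in Ioi (0 : ℝ), Real.exp (-(c * t ^ m))
      = c ^ (-(1 / m) : ℝ) * Real.Gamma (1 + 1 / m) := by
  have h := integral_exp_neg_mul_rpow (p := m) (by exact_mod_cast hm) hc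
  simp only [Real.rpow_natCast, neg_mul] at h
  rw [h, neg_div, add_comm]

theorem Gamma_one_add_pos (m : ℕ) : 0 < Real.Gamma (1 + 1 / m) :=
  Real.Gamma_pos_of_pos (by positivity)

/-- A non-integrable function has integral 0 by convention, but this integral was found to be
non-zero. -/
theorem integrableOn_exp_neg_mul_pow {m : ℕ} (hm : 1 ≤ m) {c : ℝ} (hc : 0 < c) :
    IntegrableOn (fun t : ℝ => Real.exp (-(c * t ^ m))) (Ioi 0) := by
  by_contra h
  have h1 := integral_undef h
  rw [integral_exp_neg_mul_pow hm hc] at h1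
  have := Gamma_one_add_pos m
  exact (by positivity : c ^ (-(1 / m) : ℝ) * Real.Gamma (1 + 1 / m) ≠ 0) h1

/-- Up to t₀ use 1 - x ≤ e^(-x) to reach the Weibull integral. Beyond t₀ monotonicity of G bounds
the integrand by its value at t₀, on an interval of length at most 1. -/
theorem setIntegral_one_sub_pow_le {m : ℕ} (hm : 1 ≤ m) {G : ℝ → ℝ} {q : ℕ} {c t₀ : ℝ}
    (hq : 1 ≤ q) (hc : 0 < c) (ht₀ : t₀ ∈ Ioo (0 : ℝ) 1) (hG1 : ∀ t, G t ≤ 1)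
    (hmono : MonotoneOn G (Ioo 0 1)) (hG : ∀ t ∈ Ioc 0 t₀, c * t ^ m ≤ G t) :
    ∫ t in Ioo (0 : ℝ) 1, (1 - G t) ^ q
      ≤ (q * c) ^ (-(1 / m) : ℝ) * Real.Gamma (1 + 1 / m) + Real.exp (-(q * c * t₀ ^ m)) := by
  have hq0 : (0 : ℝ) < q := by exact_mod_cast hq
  have hqc : 0 < q * c := by positivity
  have hint := integrableOn_exp_neg_mul_pow hm hqc
  have hint1 : IntegrableOn (fun t : ℝ => Real.exp (-(q * c * t ^ m))) (Ioo 0 1) :=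
    hint.mono_set Ioo_subset_Ioi_self
  have hexp : ∀ t ∈ Ioc 0 t₀, (1 - G t) ^ q ≤ Real.exp (-(q * c * t ^ m)) := by
    intro t ht
    calc (1 - G t) ^ q ≤ Real.exp (-(c * t ^ m)) ^ q := by
          refine pow_le_pow_left₀ (by linarith [hG1 t]) ?_ q
          exact (Real.one_sub_le_exp_neg _).trans (Real.exp_le_exp.2 (by linarith [hG t ht]))
      _ = _ := by rw [← Real.exp_nat_mul]; ring_nf
  calc ∫ t in Ioo (0 : ℝ) 1, (1 - G t) ^ q
      ≤ ∫ t in Ioo (0 : ℝ) 1, (Real.exp (-(q * c * t ^ m)) + Real.exp (-(q * c * t₀ ^ m))) := by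
        refine integral_mono_of_nonneg (ae_of_all _ fun t => pow_nonneg (by linarith [hG1 t]) q)
          (hint1.add (integrable_const _)) ?_
        filter_upwards [ae_restrict_mem measurableSet_Ioo] with t ht
        rcases le_or_gt t t₀ with h | h
        · exact (hexp t ⟨ht.1, h⟩).trans (le_add_of_nonneg_right (Real.exp_pos _).le)
        · refine le_trans ?_ (le_add_of_nonneg_left (Real.exp_pos _).le)
          refine le_trans ?_ (hexp t₀ ⟨ht₀.1, le_rfl⟩)
          exact pow_le_pow_left₀ (by linarith [hG1 t]) (by linarith [hmono ht₀ ht h.le]) q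
    _ = (∫ t in Ioo (0 : ℝ) 1, Real.exp (-(q * c * t ^ m))) + Real.exp (-(q * c * t₀ ^ m)) := by
        rw [integral_add hint1 (integrable_const _)]
        simp
    _ ≤ _ := by
        rw [← integral_exp_neg_mul_pow hm hqc]
        gcongr
        · exact ae_of_all _ fun t => (Real.exp_pos _).le
        · exact Ioo_subset_Ioi_self

theorem exp_neg_le_one_sub {x : ℝ} (_ : 0 ≤ x) (h1 : x ≤ 1 / 2) :
    Real.exp (-(x * (1 + 2 * x))) ≤ 1 - x := by
  have hpos : 0 < 1 - x := by linarith
  rw [← Real.le_log_iff_exp_le hpos]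
  refine le_trans ?_ (Real.one_sub_inv_le_log_of_pos hpos)
  have : (1 - x)⁻¹ ≤ 1 + x * (1 + 2 * x) := by
    rw [inv_le_iff_one_le_mul₀ hpos]
    nlinarith [mul_nonneg ‹0 ≤ x› ‹0 ≤ x›]
  linarith

/-- Below t₀ the inequality 1 - x ≥ exp(-x(1+2x)) yields a Weibull integrand with the slightly
larger coefficient b. Its part beyond t₀ is subtracted: one half of the exponent is frozen at t₀ and
makes the term small, the other half keeps it integrable. -/
theorem le_setIntegral_one_sub_pow {m : ℕ} (hm : 1 ≤ m) {G : ℝ → ℝ} {q : ℕ} {c t₀ : ℝ}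
    (hq : 1 ≤ q) (hc : 0 < c) (ht₀ : t₀ ∈ Ioo (0 : ℝ) 1) (hct : c * t₀ ^ m ≤ 1 / 2)
    (hG0 : ∀ t, 0 ≤ G t) (hG1 : ∀ t, G t ≤ 1) (hmeas : Measurable G)
    (hG : ∀ t ∈ Ioc 0 t₀, G t ≤ c * t ^ m) {b : ℝ} (hb : b = c * (1 + 2 * (c * t₀ ^ m))) :
    (q * b) ^ (-(1 / m) : ℝ) * Real.Gamma (1 + 1 / m)
        - Real.exp (-(q * (b / 2) * t₀ ^ m)) *
          ((q * (b / 2)) ^ (-(1 / m) : ℝ) * Real.Gamma (1 + 1 / m))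
      ≤ ∫ t in Ioo (0 : ℝ) 1, (1 - G t) ^ q := by
  have hq0 : (0 : ℝ) < q := by exact_mod_cast hq
  have ht0 := ht₀.1
  have hb0 : 0 < b := by rw [hb]; positivity
  have h1 : 0 < q * b := by positivity
  have h2 : 0 < q * (b / 2) := by positivity
  have i1 := integrableOn_exp_neg_mul_pow hm h1
  have i2 := (integrableOn_exp_neg_mul_pow hm h2).const_mul (Real.exp (-(q * (b / 2) * t₀ ^ m)))
  have i3 : IntegrableOn (fun t => (1 - G t) ^ q) (Ioo (0 : ℝ) 1) := by
    refine Integrable.of_mem_Icc 0 1 (by fun_prop) (ae_of_all _ fun t => ?_)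
    exact ⟨pow_nonneg (by linarith [hG1 t]) q,
      pow_le_one₀ (by linarith [hG1 t]) (by linarith [hG0 t])⟩
  rw [← integral_exp_neg_mul_pow hm h1, ← integral_exp_neg_mul_pow hm h2, ← integral_const_mul,
    ← integral_sub i1 i2]
  have h3 : ∫ t in Ioo (0 : ℝ) 1, (1 - G t) ^ q
      = ∫ t in Ioi (0 : ℝ), (Ioo (0 : ℝ) 1).indicator (fun t => (1 - G t) ^ q) t := by
    rw [setIntegral_indicator measurableSet_Ioo, inter_eq_right.2 Ioo_subset_Ioi_self]
  rw [h3]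
  have i4 : IntegrableOn ((Ioo (0 : ℝ) 1).indicator fun t => (1 - G t) ^ q) (Ioi (0 : ℝ)) :=
    (i3.integrable_indicator measurableSet_Ioo).integrableOn
  refine integral_mono_ae (i1.sub i2) i4 ?_
  filter_upwards [ae_restrict_mem measurableSet_Ioi] with t ht
  have ht' : 0 < t := ht
  rcases le_or_gt t t₀ with h | h
  · rw [indicator_of_mem (show t ∈ Ioo (0 : ℝ) 1 from ⟨ht', h.trans_lt ht₀.2⟩)]
    refine (sub_le_self _ (by positivity)).trans ?_
    have hx0 : 0 ≤ c * t ^ m := by positivity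
    have hx1 : c * t ^ m ≤ c * t₀ ^ m := by gcongr
    calc Real.exp (-(q * b * t ^ m)) = Real.exp (-(b * t ^ m)) ^ q := by
          rw [← Real.exp_nat_mul]; ring_nf
      _ ≤ (1 - G t) ^ q := by
          refine pow_le_pow_left₀ (Real.exp_pos _).le ?_ q
          refine le_trans ?_ ((exp_neg_le_one_sub hx0 (hx1.trans hct)).trans
            (by linarith [hG t ⟨ht', h⟩]))
          rw [Real.exp_le_exp, neg_le_neg_iff, hb]
          calc c * t ^ m * (1 + 2 * (c * t ^ m)) ≤ c * t ^ m * (1 + 2 * (c * t₀ ^ m)) := by gcongr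
            _ = _ := by ring
  · refine le_trans ?_ (indicator_nonneg (fun t _ => pow_nonneg (by linarith [hG1 t]) q) t)
    rw [sub_nonpos, ← Real.exp_add, Real.exp_le_exp]
    have : t₀ ^ m ≤ t ^ m := by gcongr
    have : q * (b / 2) * t₀ ^ m ≤ q * (b / 2) * t ^ m := by gcongr
    linarith

theorem abs_rpow_neg_sub_le {p s x y : ℝ} (hp : 0 ≤ p) (hs : 0 < s) (hx : s ≤ x) (hy : s ≤ y) :
    |x ^ (-p) - y ^ (-p)| ≤ p * s ^ (-p - 1) * |x - y| := by
  have h := Convex.norm_image_sub_le_of_norm_hasDerivWithin_le (s := Ici s)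
    (f := fun x : ℝ => x ^ (-p)) (f' := fun x => -p * x ^ (-p - 1)) (C := p * s ^ (-p - 1))
    (x := y) (y := x) ?_ ?_ (convex_Ici s) hy hx
  · simpa using h
  · intro z hz
    exact (Real.hasDerivAt_rpow_const (Or.inl (hs.trans_le hz).ne')).hasDerivWithinAt
  · intro z hz
    have hz0 : 0 < z := hs.trans_le hz
    rw [norm_mul, norm_neg, Real.norm_of_nonneg hp, Real.norm_of_nonneg (by positivity)]
    gcongr ?_ * ?_
    exact Real.rpow_le_rpow_of_nonpos hs hz (by linarith)

theorem rpow_mul_rpow_neg {p Q q c : ℝ} (hQ : 0 < Q) (hq : 0 < q) (hc : 0 < c) :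
    Q ^ p * (q * c) ^ (-p) = (Q / q) ^ p * c ^ (-p) := by
  rw [Real.mul_rpow hq.le hc.le, Real.div_rpow hQ.le hq.le, Real.rpow_neg hq.le]
  ring

theorem exp_neg_le_two_div_sq {y : ℝ} (hy : 0 < y) : Real.exp (-y) ≤ 2 / y ^ 2 := by
  have h := Real.quadratic_le_exp_of_nonneg hy.le
  rw [Real.exp_neg, inv_eq_one_div, div_le_div_iff₀ (Real.exp_pos _) (by positivity)]
  nlinarith

-- The bias of the estimator, with all errors measured in powers of r. In the application G(t) is
-- the probability of a sample at most t and Q = N^(1/5). A relative error ρ of G near 0 shifts the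
-- coefficient a by O(ρ), rounding Q to q costs a factor 1 + 2r, and the part beyond the cut-off
-- r^(m+2) is O(r).
set_option maxHeartbeats 1000000 in
theorem mean_estimate {m : ℕ} (hm : 1 ≤ m) {B A : ℝ} (hB : 0 < B) (hA : 0 ≤ A) :
    ∃ A' > (0 : ℝ), ∃ r₁ > (0 : ℝ), ∀ (a r w Q : ℝ) (q : ℕ) (G : ℝ → ℝ), a ∈ Icc (1 / B) B →
      0 < r → r ≤ r₁ → 0 ≤ w → w ≤ 1 / (8 * B) → Q * r ^ (4 * (m + 2) ^ 2) = 1 → q = ⌊Q⌋₊ →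
      (∀ t, 0 ≤ G t) → (∀ t, G t ≤ 1) → Measurable G → MonotoneOn G (Ioo 0 1) →
      (∀ t ∈ Ioc 0 (r ^ (m + 2)), |G t - a * t ^ m| ≤ (w + A * r) * t ^ m) →
      |Q ^ (1 / m : ℝ) / Real.Gamma (1 + 1 / m) * (∫ t in Ioo (0 : ℝ) 1, (1 - G t) ^ q)
        - a ^ (-(1 / m) : ℝ)| ≤ A' * (r + w) := by
  have hm0 : (0 : ℝ) < m := by exact_mod_cast hm
  set g := Real.Gamma (1 + 1 / m) with hg
  have hg0 : 0 < g := Gamma_one_add_pos m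
  set p : ℝ := 1 / m with hp
  have hp0 : 0 < p := by positivity
  have hp1 : p ≤ 1 := by rw [hp, div_le_one hm0]; exact_mod_cast hm
  set H : ℝ := (1 / (2 * B)) ^ (-p) with hH
  have hH0 : 0 < H := by positivity
  set L : ℝ := p * (1 / (2 * B)) ^ (-p - 1) with hL
  have hL0 : 0 ≤ L := by positivity
  refine ⟨L * (1 + A + 8 * B ^ 2) + 2 * H + 32 * B ^ 2 / g + 64 * H * B ^ 2, by positivity,
    -- The first entry makes Q ≥ 2, the second gives ρ ≤ 1/(4B), so that a - ρ ≥ 1/(2B), and the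
    -- third keeps c·t₀^m ≤ 1/2.
    min (1 / 2) (min (1 / (8 * B * (A + 1))) (1 / (4 * B))), by positivity, ?_⟩
  intro a r w Q q G ha hr0 hr hw0 hw hQ hqQ hG0 hG1 hmeas hmono hG
  have hr2 : r ≤ 1 / 2 := hr.trans (min_le_left _ _)
  have hrA : r ≤ 1 / (8 * B * (A + 1)) := hr.trans ((min_le_right _ _).trans (min_le_left _ _))
  have hrB : r ≤ 1 / (4 * B) := hr.trans ((min_le_right _ _).trans (min_le_right _ _))
  have hr1 : r ≤ 1 := by linarith
  have ha0 : 0 < a := lt_of_lt_of_le (by positivity) ha.1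
  have hBa : 1 / (2 * B) ≤ a / 2 := by
    have : 1 / (2 * B) = 1 / B / 2 := by field_simp
    linarith [ha.1]
  -- the perturbation
  set ρ := w + A * r with hρ
  have hρ0 : 0 ≤ ρ := by positivity
  have hAr : A * r ≤ 1 / (8 * B) := by
    calc A * r ≤ (A + 1) * (1 / (8 * B * (A + 1))) := by gcongr; linarith
      _ = 1 / (8 * B) := by field_simp
  have hρa : ρ ≤ 1 / (4 * B) := by
    have : 1 / (4 * B) = 1 / (8 * B) + 1 / (8 * B) := by field_simp; norm_num
    linarith
  have h4B : 1 / (4 * B) ≤ a / 4 := by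
    have : 1 / (4 * B) = 1 / (2 * B) / 2 := by field_simp; norm_num
    linarith
  -- the pool size
  have hQ0 : 0 < Q := by
    by_contra h
    have : Q * r ^ (4 * (m + 2) ^ 2) ≤ 0 := mul_nonpos_of_nonpos_of_nonneg (not_lt.1 h)
      (by positivity)
    linarith
  have hrpow : r ^ (4 * (m + 2) ^ 2) ≤ r := pow_le_of_le_one hr0.le hr1 (by positivity)
  have hQr : 1 ≤ Q * r := by
    rw [← hQ]; gcongr
  have hQ2 : 2 ≤ Q := by nlinarith
  have hq1 : 1 ≤ q := by rw [hqQ]; exact Nat.le_floor (by push_cast; linarith)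
  have hqQ1 : (q : ℝ) ≤ Q := by rw [hqQ]; exact Nat.floor_le hQ0.le
  have hqQ2 : Q < q + 1 := by rw [hqQ]; exact Nat.lt_floor_add_one Q
  have hq0 : (0 : ℝ) < q := by exact_mod_cast hq1
  have hqQ3 : Q / 2 ≤ q := by linarith
  have hlam1 : 1 ≤ Q / q := (one_le_div hq0).2 hqQ1
  have hlam2 : Q / q ≤ 1 + 2 * r := by
    rw [div_le_iff₀ hq0]
    nlinarith
  have hlam3 : (Q / q) ^ p ≤ 1 + 2 * r :=
    (Real.rpow_le_self_of_one_le hlam1 hp1).trans hlam2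
  have hlam4 : 1 ≤ (Q / q) ^ p := Real.one_le_rpow hlam1 hp0.le
  -- the cut-off point
  set t₀ := r ^ (m + 2) with ht₀
  have ht0 : t₀ ∈ Ioo (0 : ℝ) 1 := ⟨by positivity, pow_lt_one₀ hr0.le (by linarith) (by omega)⟩
  have ht0r : t₀ ^ m ≤ r := by
    rw [ht₀, ← pow_mul]
    exact pow_le_of_le_one hr0.le hr1 (by positivity)
  -- By e^(-y) ≤ 2/y² the left side is O(1/(Q·t₀^(2m))). As Q = r^(-4(m+2)²) and 2m(m+2) + 1 ≤
  -- 4(m+2)², this is O(r).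
  have htail : ∀ c : ℝ, 1 / (2 * B) ≤ c → Q * Real.exp (-(q * c * t₀ ^ m)) ≤ 32 * B ^ 2 * r := by
    intro c hc
    have hy : 0 < Q / (4 * B) * t₀ ^ m := by have := ht0.1; positivity
    have h1 : Q / (4 * B) * t₀ ^ m ≤ q * c * t₀ ^ m := by
      have := ht0.1
      gcongr
      calc Q / (4 * B) = Q / 2 * (1 / (2 * B)) := by field_simp; norm_num
        _ ≤ q * c := by gcongr
    have h2 : 1 ≤ r * (Q * (t₀ ^ m) ^ 2) := by
      rw [← hQ, ht₀, mul_left_comm, ← pow_mul, ← pow_mul, ← pow_succ']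
      gcongr ?_ * ?_
      refine pow_le_pow_of_le_one hr0.le hr1 ?_
      nlinarith
    calc Q * Real.exp (-(q * c * t₀ ^ m)) ≤ Q * Real.exp (-(Q / (4 * B) * t₀ ^ m)) := by gcongr
      _ ≤ Q * (2 / (Q / (4 * B) * t₀ ^ m) ^ 2) := by
        gcongr; exact exp_neg_le_two_div_sq hy
      _ = 32 * B ^ 2 * (1 / (Q * (t₀ ^ m) ^ 2)) := by
        have := ht0.1
        field_simp
        norm_num
      _ ≤ 32 * B ^ 2 * r := by
        gcongr
        have := ht0.1
        rw [div_le_iff₀ (by positivity)]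
        exact h2
  have hQp : Q ^ p ≤ Q := Real.rpow_le_self_of_one_le (by linarith) hp1
  have hHle : ∀ c : ℝ, 1 / (2 * B) ≤ c → c ^ (-p) ≤ H := fun c hc =>
    Real.rpow_le_rpow_of_nonpos (by positivity) hc (by linarith)
  have hLip : ∀ c : ℝ, 1 / (2 * B) ≤ c → |c ^ (-p) - a ^ (-p)| ≤ L * |c - a| := fun c hc =>
    abs_rpow_neg_sub_le hp0.le (by positivity) hc (by linarith)
  set E := ∫ t in Ioo (0 : ℝ) 1, (1 - G t) ^ q with hE
  have hw' : 0 ≤ 2 * H * w := by positivity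
  have hw2 : 0 ≤ 32 * B ^ 2 / g * w := by positivity
  have hw3 : 0 ≤ 64 * H * B ^ 2 * w := by positivity
  have hw4 : 0 ≤ L * 8 * B ^ 2 * w := by positivity
  have hw5 : 0 ≤ L * A * w := by positivity
  have hr5 : 0 ≤ L * r := by positivity
  have hup : Q ^ p / g * E ≤ a ^ (-p) + L * ρ + 2 * r * H + 32 * B ^ 2 / g * r := by
    have hc : 1 / (2 * B) ≤ a - ρ := by linarith
    have hc0 : 0 < a - ρ := by linarith
    have h1 := setIntegral_one_sub_pow_le hm hq1 hc0 ht0 hG1 hmono (fun t ht => by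
      have := (abs_le.1 (hG t ht)).1; linarith)
    calc Q ^ p / g * E ≤ Q ^ p / g * ((q * (a - ρ)) ^ (-p) * g
          + Real.exp (-(q * (a - ρ) * t₀ ^ m))) := by gcongr
      _ = Q ^ p * (q * (a - ρ)) ^ (-p) + Q ^ p * Real.exp (-(q * (a - ρ) * t₀ ^ m)) / g := by
        field_simp
      _ ≤ (Q / q) ^ p * (a - ρ) ^ (-p) + Q * Real.exp (-(q * (a - ρ) * t₀ ^ m)) / g := by
        rw [rpow_mul_rpow_neg hQ0 hq0 hc0]; gcongr
      _ ≤ (1 + 2 * r) * (a - ρ) ^ (-p) + 32 * B ^ 2 * r / g := by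
        gcongr ?_ * _ + ?_ / _
        exact htail _ hc
      _ = (a - ρ) ^ (-p) + 2 * r * (a - ρ) ^ (-p) + 32 * B ^ 2 / g * r := by ring
      _ ≤ (a ^ (-p) + L * ρ) + 2 * r * H + 32 * B ^ 2 / g * r := by
        gcongr
        · have h2 := (abs_le.1 (hLip _ hc)).2
          rw [show a - ρ - a = -ρ by ring, abs_neg, abs_of_nonneg hρ0] at h2
          linarith
        · exact hHle _ hc
  have hlow : a ^ (-p) - L * (ρ + 8 * B ^ 2 * r) - 64 * H * B ^ 2 * r ≤ Q ^ p / g * E := by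
    set c := a + ρ with hc
    have hc0 : 0 < c := by positivity
    have hcB : c ≤ 2 * B := by linarith [ha.2]
    have hct : c * t₀ ^ m ≤ 2 * B * r := by have := ht0.1; gcongr
    have hct2 : c * t₀ ^ m ≤ 1 / 2 := by
      refine hct.trans ?_
      calc 2 * B * r ≤ 2 * B * (1 / (4 * B)) := by gcongr
        _ = 1 / 2 := by field_simp; norm_num
    set b := c * (1 + 2 * (c * t₀ ^ m)) with hb
    have hct0 : 0 ≤ c * t₀ ^ m := by have := ht0.1; positivity
    have hbc : c ≤ b := by rw [hb]; exact le_mul_of_one_le_right hc0.le (by linarith)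
    have hb0 : 0 < b := hc0.trans_le hbc
    have hba : |b - a| ≤ ρ + 8 * B ^ 2 * r := by
      rw [abs_of_nonneg (by linarith)]
      have : c * (c * t₀ ^ m) ≤ 2 * B * (2 * B * r) := by gcongr
      rw [hb]; linarith
    have hb2 : 1 / (2 * B) ≤ b / 2 := by linarith
    have h1 := le_setIntegral_one_sub_pow hm hq1 hc0 ht0 hct2 hG0 hG1 hmeas (fun t ht => by
      have := (abs_le.1 (hG t ht)).2; linarith) hb
    have h2 := (abs_le.1 (hLip b (by linarith))).1
    have h3 : L * |b - a| ≤ L * (ρ + 8 * B ^ 2 * r) := by gcongr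
    have h4 : (Q / q) ^ p * ((b / 2) ^ (-p) * Real.exp (-(q * (b / 2) * t₀ ^ m)))
        ≤ 2 * (H * (32 * B ^ 2 * r)) := by
      gcongr
      · linarith
      · exact hHle _ hb2
      · refine le_trans ?_ (htail _ hb2)
        exact le_mul_of_one_le_left (Real.exp_pos _).le (by linarith)
    calc _ ≤ b ^ (-p) - 64 * H * B ^ 2 * r := by linarith
      _ ≤ (Q / q) ^ p * b ^ (-p)
          - (Q / q) ^ p * ((b / 2) ^ (-p) * Real.exp (-(q * (b / 2) * t₀ ^ m))) := by
        have : b ^ (-p) ≤ (Q / q) ^ p * b ^ (-p) := le_mul_of_one_le_left (by positivity) hlam4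
        linarith
      _ = Q ^ p * (q * b) ^ (-p)
          - Q ^ p * (q * (b / 2)) ^ (-p) * Real.exp (-(q * (b / 2) * t₀ ^ m)) := by
        rw [rpow_mul_rpow_neg hQ0 hq0 hb0, rpow_mul_rpow_neg hQ0 hq0 (by positivity)]; ring
      _ = Q ^ p / g * ((q * b) ^ (-p) * g
          - Real.exp (-(q * (b / 2) * t₀ ^ m)) * ((q * (b / 2)) ^ (-p) * g)) := by
        field_simp
      _ ≤ Q ^ p / g * E := by gcongr
  have hLρ : L * ρ = L * w + L * A * r := by rw [hρ]; ring
  have hwL : 0 ≤ L * w := by positivity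
  have hHr : 0 ≤ H * r := by positivity
  have hHB : 0 ≤ 64 * H * B ^ 2 * r := by positivity
  have hBg : 0 ≤ 32 * B ^ 2 / g * r := by positivity
  have hLB : 0 ≤ L * 8 * B ^ 2 * r := by positivity
  have hexpand : (L * (1 + A + 8 * B ^ 2) + 2 * H + 32 * B ^ 2 / g + 64 * H * B ^ 2) * (r + w)
      = L * r + L * w + L * A * r + L * A * w + L * 8 * B ^ 2 * r + L * 8 * B ^ 2 * w + 2 * (H * r)
        + 2 * H * w + 32 * B ^ 2 / g * r + 32 * B ^ 2 / g * w + 64 * H * B ^ 2 * r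
        + 64 * H * B ^ 2 * w := by ring
  have hup' : 2 * r * H = 2 * (H * r) := by ring
  have hlow' : L * (ρ + 8 * B ^ 2 * r) = L * ρ + L * 8 * B ^ 2 * r := by ring
  rw [hlow'] at hlow
  rw [hup'] at hup
  rw [hexpand, abs_le]
  constructor <;> linarith only [hup, hlow, hLρ, hwL, hHr, hHB, hBg, hLB, hw', hw2, hw3, hw4, hw5,
    hr5]

/-- With k = ⌈1/t⌉ one has t(1-t) ≤ 1/k ≤ t, so the rounding costs a relative error of at most mt.
The cut-off r^(m+2) is what reduces the remainder A/(r^(m+1)·k) to A·r. -/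
theorem abs_surv_ceil_sub_le {F : ProbabilityMeasure ℝ} {m : ℕ} {a A B r w : ℝ} (ha : a ∈ Icc 0 B)
    (hA : 0 ≤ A) (hr0 : 0 < r) (hr1 : r ≤ 1) (hw : 0 ≤ w)
    (h : ∀ k : ℕ, 1 ≤ k → |surv F k - a / k ^ m| ≤ (w + A / r ^ (m + 1) / k) / k ^ m)
    {t : ℝ} (ht : t ∈ Ioc 0 (r ^ (m + 2))) :
    |surv F ⌈1 / t⌉₊ - a * t ^ m| ≤ (w + (A + B * m) * r) * t ^ m := by
  have ht0 := ht.1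
  have hB : 0 ≤ B := ha.1.trans ha.2
  have htr : t ≤ r := ht.2.trans (pow_le_of_le_one hr0.le hr1 (by omega))
  have ht1 : t ≤ 1 := htr.trans hr1
  set k := ⌈1 / t⌉₊ with hk
  have hk1 : 1 ≤ k := Nat.one_le_ceil_iff.2 (by positivity)
  have hk0 : (0 : ℝ) < k := by exact_mod_cast hk1
  have hkt : 1 / (k : ℝ) ≤ t := by
    rw [div_le_iff₀ hk0, mul_comm, ← div_le_iff₀ ht0]; exact Nat.le_ceil _
  have htk : t * (1 - t) ≤ 1 / k := by
    rw [le_div_iff₀ hk0]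
    have h1 : (k : ℝ) < 1 / t + 1 := Nat.ceil_lt_add_one (by positivity)
    have h2 : 0 ≤ t * (1 - t) := mul_nonneg ht0.le (by linarith)
    calc t * (1 - t) * k ≤ t * (1 - t) * (1 / t + 1) := by gcongr
      _ = 1 - t ^ 2 := by field_simp; ring
      _ ≤ 1 := by nlinarith
  have hkm : 1 / (k : ℝ) ^ m ≤ t ^ m := by
    rw [← one_div_pow]; gcongr
  have hmk : (1 - m * t) * t ^ m ≤ 1 / (k : ℝ) ^ m := by
    calc (1 - m * t) * t ^ m ≤ (1 - t) ^ m * t ^ m := by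
          gcongr
          have := one_add_mul_le_pow (a := -t) (by linarith) m
          simpa [sub_eq_add_neg] using this
      _ = (t * (1 - t)) ^ m := by rw [mul_pow]; ring
      _ ≤ (1 / (k : ℝ)) ^ m := pow_le_pow_left₀ (mul_nonneg ht0.le (by linarith)) htk m
      _ = _ := one_div_pow _ m
  have h1 : |a / k ^ m - a * t ^ m| ≤ B * m * r * t ^ m := by
    have h2 : a / (k : ℝ) ^ m - a * t ^ m = -(a * (t ^ m - 1 / k ^ m)) := by ring
    rw [h2, abs_neg, abs_mul, abs_of_nonneg ha.1, abs_of_nonneg (by linarith)]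
    calc a * (t ^ m - 1 / k ^ m) ≤ B * (m * t * t ^ m) := by
          gcongr ?_ * ?_
          · exact ha.2
          · linarith
      _ ≤ B * (m * r * t ^ m) := by gcongr
      _ = _ := by ring
  have h3 : A / r ^ (m + 1) / k ≤ A * r := by
    calc A / r ^ (m + 1) / k = A / r ^ (m + 1) * (1 / k) := by ring
      _ ≤ A / r ^ (m + 1) * r ^ (m + 2) := by gcongr; exact hkt.trans ht.2
      _ = A * r := by field_simp; ring
  calc |surv F k - a * t ^ m| ≤ |surv F k - a / k ^ m| + |a / k ^ m - a * t ^ m| :=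
        abs_sub_le _ _ _
    _ ≤ (w + A / r ^ (m + 1) / k) / k ^ m + B * m * r * t ^ m := add_le_add (h k hk1) h1
    _ = (w + A / r ^ (m + 1) / k) * (1 / k ^ m) + B * m * r * t ^ m := by ring
    _ ≤ (w + A * r) * t ^ m + B * m * r * t ^ m := by gcongr
    _ = _ := by ring

/-! ### Accuracy of the estimator -/

theorem tendsto_surv_of_cdf_le {F : ProbabilityMeasure ℝ} {m : ℕ} (hm : 1 ≤ m) {C : ℝ} (hC : 1 ≤ C)
    (h : ∀ x ∈ Icc (0 : ℝ) 1, cdf (F : Measure ℝ) x ≤ C * x ^ m) :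
    Filter.Tendsto (surv F) Filter.atTop (nhds 0) := by
  have h1 : Filter.Tendsto (fun k : ℕ => C * m ! * (1 / ((k : ℝ) + 1))) Filter.atTop
      (nhds (C * m ! * 0)) := tendsto_one_div_add_atTop_nhds_zero_nat.const_mul _
  rw [mul_zero] at h1
  refine squeeze_zero (surv_nonneg F) (fun k => ?_) h1
  refine (surv_le_of_cdf_le hC h k).trans ?_
  rw [mul_one_div]
  have : (1 : ℝ) ≤ (k : ℝ) + 1 := by linarith [(Nat.cast_nonneg k : (0 : ℝ) ≤ k)]
  gcongr
  exact le_self_pow₀ this (by omega)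

theorem monotoneOn_surv_ceil (F : ProbabilityMeasure ℝ) :
    MonotoneOn (fun t : ℝ => surv F ⌈1 / t⌉₊) (Ioo 0 1) := fun _ hs _ _ hst =>
  surv_antitone F (Nat.ceil_mono (one_div_le_one_div_of_le hs.1 hst))

theorem measurable_surv_ceil (F : ProbabilityMeasure ℝ) :
    Measurable fun t : ℝ => surv F ⌈1 / t⌉₊ :=
  (measurable_from_nat (f := surv F)).comp (Nat.measurable_ceil.comp (by fun_prop))

theorem IsAdmissibleFamily.exists_estimator_accurate {m : ℕ} (hm : 1 ≤ m) {B : ℝ} (hB : 0 < B)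
    {𝓕 : Set (ProbabilityMeasure ℝ)} (h𝓕 : IsAdmissibleFamily m B 𝓕) :
    ∃ ε > (0 : ℝ), ∃ A > (0 : ℝ), ∀ F ∈ 𝓕, ∀ N : ℕ, 1 ≤ N → ∀ w : ℝ,
      (∀ x ∈ Icc (0 : ℝ) ((N : ℝ) ^ (-ε)), |cdfDeriv F m x - cdfDeriv F m 0| ≤ w) →
      (envLaw F).real {ω | A * ((N : ℝ) ^ (-ε) + w) <
          |bernoulliEstimator m N (tailsBeforeHead ω) - leadingCoeff m F ^ (-(1 / m) : ℝ)|}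
        ≤ A * Real.exp (-(N : ℝ) ^ ε) := by
  have hm0 : (0 : ℝ) < m := by exact_mod_cast hm
  obtain ⟨C, hC, hcdf⟩ := h𝓕.exists_cdf_le hB
  obtain ⟨δ, hδ, hd⟩ := h𝓕.differentiable
  obtain ⟨δ', hδ', hequi⟩ := h𝓕.equicontinuous (1 / (8 * B)) (by positivity)
  set A₁ : ℝ := B * m ^ 2 + (1 + B) * (m + 1)! with hA₁
  have hA₁0 : 0 ≤ A₁ := by positivity
  obtain ⟨A', hA'0, r₁, hr₁0, hmean⟩ := mean_estimate hm hB (A := A₁ + B * m) (by positivity)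
  set g := Real.Gamma (1 + 1 / m) with hg
  have hg0 : 0 < g := Gamma_one_add_pos m
  -- With r = N^(-ε) this is the exponent for which N^(1/5)·r^(4(m+2)²) = 1.
  set ε : ℝ := 1 / (20 * ((m : ℝ) + 2) ^ 2) with hε
  have hε0 : 0 < ε := by positivity
  set M : ℝ := ((m ! : ℕ) : ℝ) ^ (1 / m : ℝ) with hM
  have hM0 : 0 < M := by positivity
  set r₀ : ℝ := min (min r₁ (min (δ / 2) (δ' / 2))) (g ^ 2) with hr₀
  have hr₀0 : 0 < r₀ := by positivity
  refine ⟨ε, hε0, M * (1 + A') + 2 + Real.exp (1 / r₀), by positivity, ?_⟩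
  intro F hF N hN w hw
  have hN1 : (1 : ℝ) ≤ N := by exact_mod_cast hN
  have hN0 : (0 : ℝ) < N := by linarith
  set r := (N : ℝ) ^ (-ε) with hr
  set R := (N : ℝ) ^ ε with hR
  have hR1 : 1 ≤ R := Real.one_le_rpow hN1 hε0.le
  have hrR : r = 1 / R := by rw [hr, Real.rpow_neg hN0.le, one_div]
  have hr0 : 0 < r := by positivity
  have hr1 : r ≤ 1 := by rw [hrR, div_le_one (by positivity)]; exact hR1
  have hw0 : 0 ≤ w := (abs_nonneg _).trans (hw 0 ⟨le_rfl, hr0.le⟩)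
  -- For r > r₀ the number N is bounded, and the summand exp(1/r₀) in the constant makes the claim
  -- trivial.
  rcases lt_or_ge r₀ r with hsmall | hlarge
  · refine measureReal_le_one.trans ?_
    have h1 : R ≤ 1 / r₀ := by
      rw [le_div_iff₀ hr₀0, ← le_div_iff₀' (by positivity), ← hrR]; exact hsmall.le
    calc (1 : ℝ) = Real.exp (1 / r₀) * Real.exp (-(1 / r₀)) := by
          rw [← Real.exp_add]; simp
      _ ≤ (M * (1 + A') + 2 + Real.exp (1 / r₀)) * Real.exp (-R) := by
          gcongr
          have : 0 ≤ M * (1 + A') := by positivity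
          linarith
  have hrr₁ : r ≤ r₁ := hlarge.trans ((min_le_left _ _).trans (min_le_left _ _))
  have hrδ : r < δ := by
    have : r ≤ δ / 2 := hlarge.trans ((min_le_left _ _).trans ((min_le_right _ _).trans
      (min_le_left _ _)))
    linarith
  have hrδ' : r < δ' := by
    have : r ≤ δ' / 2 := hlarge.trans ((min_le_left _ _).trans ((min_le_right _ _).trans
      (min_le_right _ _)))
    linarith
  have hrg : r ≤ g ^ 2 := hlarge.trans (min_le_right _ _)
  -- The bias estimate needs a modulus of at most 1/(8B). Equicontinuity supplies it on [0, r], so w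
  -- may be truncated.
  set w' := min w (1 / (8 * B)) with hw'
  have hw'0 : 0 ≤ w' := le_min hw0 (by positivity)
  have hww' : ∀ x ∈ Icc (0 : ℝ) r, |cdfDeriv F m x - cdfDeriv F m 0| ≤ w' := fun x hx =>
    le_min (hw x hx) (hequi F hF x ⟨hx.1, hx.2.trans_lt hrδ'⟩)
  set a := cdfDeriv F m 0 with ha
  have ha' : a ∈ Icc 0 B := h𝓕.deriv_mem_Icc hB hF
  have ha0 : 0 < a := lt_of_lt_of_le (by positivity) (h𝓕.deriv_mem F hF).1
  have htend := tendsto_surv_of_cdf_le hm hC (hcdf F hF)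
  set Q : ℝ := (N : ℝ) ^ (1 / 5 : ℝ) with hQ
  have hQ1 : 1 ≤ Q := Real.one_le_rpow hN1 (by norm_num)
  have hRpow : ∀ k : ℕ, R ^ k = (N : ℝ) ^ (ε * k) := fun k => by
    rw [hR, ← Real.rpow_natCast, ← Real.rpow_mul hN0.le]
  have hQR : Q = R ^ (4 * (m + 2) ^ 2) := by
    rw [hRpow, hQ, hε]; congr 1; push_cast; field_simp; norm_num
  have hQr : Q * r ^ (4 * (m + 2) ^ 2) = 1 := by
    rw [hQR, hrR, ← mul_pow, mul_one_div_cancel (by positivity), one_pow]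
  have hq1 : 1 ≤ poolSize N := Nat.one_le_floor_iff _ |>.2 hQ1
  have hest := hmean a r w' Q (poolSize N) (fun t => surv F ⌈1 / t⌉₊) (h𝓕.deriv_mem F hF) hr0 hrr₁
    hw'0 (min_le_right _ _) hQr rfl (fun t => surv_nonneg F _) (fun t => surv_le_one F _)
    (measurable_surv_ceil F) (monotoneOn_surv_ceil F) (fun t ht =>
      abs_surv_ceil_sub_le ha' hA₁0 hr0 hr1 hw'0 (fun k hk => surv_estimate hrδ hr0 hr1 (hd F hF)
        (h𝓕.lower_deriv_zero F hF) ha' hww' hk) ht)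
  set E := ∫ t in Ioo (0 : ℝ) 1, (1 - surv F ⌈1 / t⌉₊) ^ poolSize N with hE
  have hQm : (N : ℝ) ^ (1 / (5 * m) : ℝ) = Q ^ (1 / m : ℝ) := by
    rw [hQ, ← Real.rpow_mul hN0.le]; congr 1; field_simp
  -- The deviation of the average that becomes r after multiplication by Q^(1/m)/g.
  set s : ℝ := g * r / Q ^ (1 / m : ℝ) with hs
  have hs0 : 0 ≤ s := by positivity
  have hN7 : (1 : ℝ) ≤ (N : ℝ) ^ (7 / 10 : ℝ) := Real.one_le_rpow hN1 (by norm_num)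
  have hP1 : 1 ≤ poolCount N := Nat.one_le_floor_iff _ |>.2 hN7
  have hP2 : (N : ℝ) ^ (7 / 10 : ℝ) ≤ 2 * poolCount N := by
    have h1 := Nat.lt_floor_add_one ((N : ℝ) ^ (7 / 10 : ℝ))
    have h2 : (1 : ℝ) ≤ poolCount N := by exact_mod_cast hP1
    rw [poolCount] at h2 ⊢
    linarith
  have hhoeff := envLaw_average_poolMin (F := F) hq1 hP1 (fun k => integral_poolMin htend hq1 k) hs0
  rw [← hE] at hhoeff
  -- Since Q^(1/m) ≤ N^(1/5), the right side is at least N^(7/10 - 2/5)·g²r², a high power of R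
  -- times g². The condition r ≤ g² absorbs the constant.
  have hexp : R ≤ 2 * poolCount N * s ^ 2 := by
    have h1 : Q ^ (1 / m : ℝ) ≤ Q := Real.rpow_le_self_of_one_le hQ1
      (by rw [div_le_one hm0]; exact_mod_cast hm)
    have h2 : (N : ℝ) ^ (7 / 10 : ℝ) = R ^ (14 * (m + 2) ^ 2) := by
      rw [hRpow, hε]; congr 1; push_cast; field_simp; norm_num
    calc R = r * (R ^ 4 * (1 / R) ^ 2) := by rw [hrR]; field_simp
      _ ≤ g ^ 2 * (R ^ (6 * (m + 2) ^ 2) * (1 / R) ^ 2) := by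
        gcongr
        nlinarith
      _ = R ^ (14 * (m + 2) ^ 2) * (g * r / R ^ (4 * (m + 2) ^ 2)) ^ 2 := by
        have h3 : R ^ (14 * (m + 2) ^ 2) = R ^ (6 * (m + 2) ^ 2) * (R ^ (4 * (m + 2) ^ 2)) ^ 2 := by
          rw [← pow_mul, ← pow_add]; congr 1; ring
        have h4 : 0 < R ^ (4 * (m + 2) ^ 2) := by positivity
        rw [h3, hrR]
        generalize R ^ (6 * (m + 2) ^ 2) = u at *
        generalize R ^ (4 * (m + 2) ^ 2) = v at *
        field_simp
      _ ≤ 2 * poolCount N * s ^ 2 := by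
        rw [hs, ← h2, ← hQR]
        gcongr
  have hset : {ω | (M * (1 + A') + 2 + Real.exp (1 / r₀)) * (r + w) <
      |bernoulliEstimator m N (tailsBeforeHead ω) - leadingCoeff m F ^ (-(1 / m) : ℝ)|}
      ⊆ {ω | s ≤ |(∑ k ∈ Finset.range (poolCount N), poolMin (poolSize N) (pool (poolSize N) k ω))
        / poolCount N - E|} := by
    intro ω hω
    by_contra hcon
    rw [mem_ofPred_eq, not_le] at hcon
    rw [mem_ofPred_eq] at hω
    refine absurd hω (not_lt.2 ?_)
    rw [bernoulliEstimator_eq, hQm]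
    set avg := (∑ k ∈ Finset.range (poolCount N), poolMin (poolSize N) (pool (poolSize N) k ω))
        / poolCount N with havg
    have hlc : leadingCoeff m F ^ (-(1 / m) : ℝ) = M * a ^ (-(1 / m) : ℝ) := by
      rw [leadingCoeff, ← ha, Real.div_rpow ha0.le (by positivity), Real.rpow_neg (by positivity),
        Real.rpow_neg (by positivity), hM]
      field_simp
    rw [hlc, ← mul_sub, abs_mul, abs_of_pos hM0]
    have h1 : |Q ^ (1 / m : ℝ) / g * avg - Q ^ (1 / m : ℝ) / g * E| ≤ r := by
      rw [← mul_sub, abs_mul, abs_of_pos (by positivity)]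
      calc Q ^ (1 / m : ℝ) / g * |avg - E| ≤ Q ^ (1 / m : ℝ) / g * s := by gcongr
        _ = r := by rw [hs]; field_simp
    have h2 : |Q ^ (1 / m : ℝ) / g * avg - a ^ (-(1 / m) : ℝ)| ≤ r + A' * (r + w') :=
      (abs_sub_le _ _ _).trans (add_le_add h1 hest)
    have h3 : w' ≤ w := min_le_left _ _
    calc M * |Q ^ (1 / m : ℝ) / g * avg - a ^ (-(1 / m) : ℝ)| ≤ M * (r + A' * (r + w')) := by gcongr
      _ ≤ M * ((r + w) + A' * (r + w)) := by gcongr; linarith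
      _ = (M * (1 + A')) * (r + w) := by ring
      _ ≤ _ := by
        gcongr
        have := Real.exp_pos (1 / r₀)
        linarith
  calc _ ≤ 2 * Real.exp (-(2 * poolCount N * s ^ 2)) := (measureReal_mono hset).trans hhoeff
    _ ≤ 2 * Real.exp (-R) := by gcongr
    _ ≤ _ := by
      gcongr
      have h1 := Real.exp_pos (1 / r₀)
      have h2 : 0 ≤ M * (1 + A') := by positivity
      linarith

/-! ### The course of the algorithm -/

theorem minEstimator_congr {m n : ℕ} {x y : ℕ → ℝ} (h : ∀ i < sampleCount n, x i = y i) :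
    minEstimator m n x = minEstimator m n y := by
  unfold minEstimator
  congr 2
  refine Finset.sum_congr rfl fun k hk => ?_
  congr 1
  ext j
  refine h _ ?_
  have h1 : k + 1 ≤ poolCount n := Finset.mem_range.1 hk
  calc k * poolSize n + j < k * poolSize n + poolSize n := by have := j.2; omega
    _ = (k + 1) * poolSize n := by ring
    _ ≤ sampleCount n := Nat.mul_le_mul_right _ h1

theorem bernoulliEstimator_congr {m n : ℕ} {T T' : ℕ → ℕ} (h : ∀ i < sampleCount n, T i = T' i) :
    bernoulliEstimator m n T = bernoulliEstimator m n T' :=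
  minEstimator_congr fun i hi => by rw [h i hi]

/-- The number of tails of bandit `i` before its first head. -/
def firstHead (X : ℕ → ℕ → Bool) (i : ℕ) : ℕ := sInf {j | X i j = true}

/-- The settling time that the algorithm computes from the outcomes of the estimation phase. -/
def algSettle (m n : ℕ) (X : ℕ → ℕ → Bool) (i : ℕ) : ℝ :=
  settleTime m n (bernoulliEstimator m n (firstHead X)) i

/-- What holds throughout the course of the algorithm, with `n` machines. -/
structure AlgInvariant (m n : ℕ) (X : ℕ → ℕ → Bool) (h : History) : Prop where
  pos_lt : h.pos < n
  count_eq : ∀ i, h.countAt i true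
    = ∑ j ∈ Finset.range (h.pullsAt i), if X i j = true then 1 else 0
  est_le : ∀ i < sampleCount n, h.countAt i true ≤ 1
  est_eq : ∀ i < sampleCount n, h.countAt i true ≠ 0 → h.countAt i false = firstHead X i
  est_done : ∀ i < sampleCount n, i < h.pos → h.countAt i true ≠ 0
  passed : ∀ i, sampleCount n ≤ i → i < h.pos →
    h.countAt i true ≤ 1 ∧ ∃ j : ℕ, (j : ℝ) + 1 ≤ algSettle m n X i ∧ X i j = true
  current : sampleCount n ≤ h.pos → h.pos + 1 < n →
    ((h.pullsAt h.pos : ℝ) ≤ algSettle m n X h.pos ∧ h.countAt h.pos true ≤ 1) ∨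
    (algSettle m n X h.pos < h.pullsAt h.pos ∧
      ∀ j : ℕ, (j : ℝ) + 1 ≤ algSettle m n X h.pos → X h.pos j = false)

theorem AlgInvariant.eq_false {m n : ℕ} {X : ℕ → ℕ → Bool} {h : History} (H : AlgInvariant m n X h)
    {i : ℕ} (h0 : h.countAt i true = 0) {j : ℕ} (hj : j < h.pullsAt i) : X i j = false := by
  have h1 := H.count_eq i
  rw [h0, eq_comm, Finset.sum_eq_zero_iff] at h1
  simpa using h1 j (Finset.mem_range.2 hj)

theorem AlgInvariant.exists_true {m n : ℕ} {X : ℕ → ℕ → Bool} {h : History}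
    (H : AlgInvariant m n X h) {i : ℕ} (h0 : h.countAt i true ≠ 0) :
    ∃ j < h.pullsAt i, X i j = true := by
  by_contra hcon
  push Not at hcon
  refine h0 ?_
  rw [H.count_eq i]
  exact Finset.sum_eq_zero fun j hj => if_neg (hcon j (Finset.mem_range.1 hj))

theorem AlgInvariant.estimator_eq {m n : ℕ} {X : ℕ → ℕ → Bool} {h : History}
    (H : AlgInvariant m n X h) (hpos : sampleCount n ≤ h.pos) (i : ℕ) :
    settleTime m n (bernoulliEstimator m n fun j => h.countAt j false) i = algSettle m n X i := by
  rw [algSettle, bernoulliEstimator_congr]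
  exact fun j hj => H.est_eq j hj (H.est_done j hj (hj.trans_le hpos))

theorem algorithm_eq_of_lt {m N K : ℕ} {h : History} (h1 : h.pos + 1 < machines m N K)
    (h2 : h.pos < sampleCount (machines m N K)) :
    algorithm m N K h = decide (h.countAt h.pos true = 0) := by
  simp only [algorithm, if_neg (not_le.2 h1), if_pos h2]

theorem algorithm_eq_of_ge {m N K : ℕ} {X : ℕ → ℕ → Bool} {h : History}
    (h1 : h.pos + 1 < machines m N K) (h2 : sampleCount (machines m N K) ≤ h.pos)
    (H : AlgInvariant m (machines m N K) X h) :
    algorithm m N K h = true ↔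
      (h.countAt h.pos true = 0 ∧ (h.pullsAt h.pos : ℝ) ≤ algSettle m (machines m N K) X h.pos) ∨
        algSettle m (machines m N K) X h.pos < h.pullsAt h.pos := by
  simp only [algorithm, if_neg (not_le.2 h1), if_neg (not_lt.2 h2), H.estimator_eq h2,
    decide_eq_true_eq]

theorem algInvariant_run {m N K : ℕ} (hn : sampleCount (machines m N K) < machines m N K)
    (X : ℕ → ℕ → Bool) (t : ℕ) :
    AlgInvariant m (machines m N K) X (run N K (algorithm m N K) X t) := by
  set n := machines m N K with hndef
  have hnN : n ≤ N := min_le_left _ _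
  refine run_induction (P := AlgInvariant m n X) ?_ ?_ ?_ t
  · refine ⟨lt_of_le_of_lt (Nat.zero_le _) hn, fun i => rfl, fun i _ => Nat.zero_le _,
      fun i _ h => absurd rfl h, fun i _ h => absurd h (Nat.not_lt_zero i),
      fun i _ h => absurd h (Nat.not_lt_zero i), fun _ _ => ?_⟩
    -- The sign of the settling time is not used. If it is negative, the bandit counts as settled
    -- from the start and the condition on j is void.
    rcases le_or_gt 0 (algSettle m n X 0) with h | h
    · left; exact ⟨by simpa [pullsAt, countAt, History.pos] using h, Nat.zero_le _⟩
    · right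
      refine ⟨by simpa [pullsAt, countAt, History.pos] using h, fun j hj => ?_⟩
      have h1 : (j : ℝ) + 1 ≤ algSettle m n X 0 := hj
      have : (0 : ℝ) ≤ j := Nat.cast_nonneg j
      linarith
  · intro h H hK hN hS
    have hpn : h.pos + 1 < n := by
      by_contra hcon
      simp [algorithm, ← hndef, not_lt.1 hcon] at hS
    refine ⟨by rw [pos_none_cons]; exact hpn, H.count_eq, H.est_le, H.est_eq, ?_, ?_, ?_⟩
    · intro i hi hip
      rw [pos_none_cons] at hip
      rcases Nat.lt_succ_iff_lt_or_eq.1 hip with h' | rfl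
      · exact H.est_done i hi h'
      · rw [algorithm_eq_of_lt hpn hi] at hS
        rw [countAt_none_cons]
        simpa using hS
    · intro i hi hip
      rw [pos_none_cons] at hip
      rcases Nat.lt_succ_iff_lt_or_eq.1 hip with h' | rfl
      · exact H.passed i hi h'
      · have h1 := (algorithm_eq_of_ge hpn hi H).not.1 (by simp [hS])
        rw [not_or, not_lt, not_and'] at h1
        have hc := h1.1 h1.2
        rcases H.current hi hpn with ⟨_, h3⟩ | ⟨h3, _⟩
        · obtain ⟨j, hj, hX⟩ := H.exists_true hc
          refine ⟨h3, j, le_trans ?_ h1.2, hX⟩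
          exact_mod_cast hj
        · exact absurd h3 (not_lt.2 h1.2)
    · intro _ _
      rw [pos_none_cons, pullsAt_none_cons, pullsAt_eq_zero (Nat.lt_succ_self h.pos),
        countAt_none_cons, countAt_eq_zero _ (Nat.lt_succ_self h.pos)]
      rcases le_or_gt 0 (algSettle m n X (h.pos + 1)) with h | h
      · left; exact ⟨by simpa using h, Nat.zero_le _⟩
      · right
        refine ⟨by simpa using h, fun j hj => ?_⟩
        have : (0 : ℝ) ≤ j := Nat.cast_nonneg j
        linarith
  · intro h H hK hS
    have hne : ∀ i, i < h.pos → i ≠ h.pos := fun i hi => hi.ne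
    refine ⟨by rw [pos_some_cons]; exact H.pos_lt, ?_, ?_, ?_, ?_, ?_, ?_⟩
    · intro i
      by_cases hi : i = h.pos
      · subst hi
        rw [countAt_some_cons_self, pullsAt_some_cons_self, Finset.sum_range_succ, H.count_eq]
      · rw [countAt_some_cons_of_ne _ _ hi, pullsAt_some_cons_of_ne _ hi, H.count_eq]
    · intro i hi
      by_cases hip : i = h.pos
      · subst hip
        have hpn : h.pos + 1 < n := by omega
        have h1 := hS (by omega)
        rw [algorithm_eq_of_lt hpn hi, decide_eq_true_eq] at h1
        rw [countAt_some_cons_self, h1]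
        split_ifs <;> simp
      · rw [countAt_some_cons_of_ne _ _ hip]; exact H.est_le i hi
    · intro i hi hc
      by_cases hip : i = h.pos
      · subst hip
        have hpn : h.pos + 1 < n := by omega
        have h1 := hS (by omega)
        rw [algorithm_eq_of_lt hpn hi, decide_eq_true_eq] at h1
        rw [countAt_some_cons_self, h1, zero_add] at hc
        have hX : X h.pos (h.pullsAt h.pos) = true := by
          by_contra hX; exact hc (if_neg hX)
        have hp : h.pullsAt h.pos = h.countAt h.pos false := by rw [pullsAt, h1, zero_add]
        rw [countAt_some_cons_self, hX, if_neg (by simp), add_zero, firstHead, ← hp]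
        -- All earlier pulls were tails, so the index of the present pull is both the number of
        -- tails and the position of the first head.
        refine le_antisymm ?_ (Nat.sInf_le (show _ ∈ {j | X h.pos j = true} from hX))
        refine le_csInf ⟨_, (show _ ∈ {j | X h.pos j = true} from hX)⟩ fun j hj => ?_
        by_contra hcon
        have := H.eq_false h1 (not_le.1 hcon)
        rw [mem_ofPred_eq, this] at hj
        exact Bool.false_ne_true hj
      · rw [countAt_some_cons_of_ne _ _ hip] at hc ⊢
        exact H.est_eq i hi hc
    · intro i hi hip
      rw [pos_some_cons] at hip
      rw [countAt_some_cons_of_ne _ _ (hne i hip)]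
      exact H.est_done i hi hip
    · intro i hi hip
      rw [pos_some_cons] at hip
      rw [countAt_some_cons_of_ne _ _ (hne i hip)]
      exact H.passed i hi hip
    · intro hi hpn
      rw [pos_some_cons] at hi hpn ⊢
      have h1 := (algorithm_eq_of_ge hpn hi H).1 (hS (by omega))
      rw [pullsAt_some_cons_self, countAt_some_cons_self]
      push_cast
      rcases H.current hi hpn with ⟨h2, h3⟩ | ⟨h2, h3⟩
      · have hc : h.countAt h.pos true = 0 := by
          rcases h1 with h1 | h1
          · exact h1.1
          · exact absurd h1 (not_lt.2 h2)
        -- The pull that crosses the settling time f settles the bandit whatever its outcome. Only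
        -- the outcomes j with j + 1 ≤ f are known to be tails.
        rcases le_or_gt ((h.pullsAt h.pos : ℝ) + 1) (algSettle m n X h.pos) with h4 | h4
        · left
          refine ⟨h4, ?_⟩
          rw [hc]; split_ifs <;> simp
        · right
          refine ⟨h4, fun j hj => H.eq_false hc ?_⟩
          have : (j : ℝ) < h.pullsAt h.pos := by linarith
          exact_mod_cast this
      · right; exact ⟨by linarith, h3⟩

/-! ### Cost of the estimation phase -/

theorem estimationLoss_le {m N K : ℕ} (hn : sampleCount (machines m N K) < machines m N K)
    (X : ℕ → ℕ → Bool) : estimationLoss m N K X ≤ sampleCount (machines m N K) := by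
  have H := algInvariant_run hn X (N + K)
  calc estimationLoss m N K X ≤ ∑ _i ∈ Finset.range (sampleCount (machines m N K)), 1 :=
        Finset.sum_le_sum fun i hi => H.est_le i (Finset.mem_range.1 hi)
    _ = _ := by simp

theorem sampleCount_le (n : ℕ) : (sampleCount n : ℝ) ≤ (n : ℝ) ^ (9 / 10 : ℝ) := by
  have hn : (0 : ℝ) ≤ n := Nat.cast_nonneg n
  rcases Nat.eq_zero_or_pos n with rfl | hpos
  · simp [sampleCount, poolCount]
  have hpos' : (0 : ℝ) < n := by exact_mod_cast hpos
  calc (sampleCount n : ℝ) = poolCount n * poolSize n := by rw [sampleCount]; push_cast; rfl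
    _ ≤ (n : ℝ) ^ (7 / 10 : ℝ) * (n : ℝ) ^ (1 / 5 : ℝ) := by
      gcongr
      · exact Nat.floor_le (by positivity)
      · exact Nat.floor_le (by positivity)
    _ = _ := by rw [← Real.rpow_add hpos']; norm_num

/-- Strictness ensures that the estimation phase ends before the n-th bandit, where the algorithm
would stay. It fails for n = 1, where one sample is taken. -/
theorem sampleCount_lt {n : ℕ} (hn : 2 ≤ n) : sampleCount n < n := by
  have hn1 : (1 : ℝ) < n := by exact_mod_cast hn
  have h : (sampleCount n : ℝ) < n := by
    refine (sampleCount_le n).trans_lt ?_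
    calc (n : ℝ) ^ (9 / 10 : ℝ) < (n : ℝ) ^ (1 : ℝ) :=
          Real.rpow_lt_rpow_of_exponent_lt hn1 (by norm_num)
      _ = n := Real.rpow_one _
  exact_mod_cast h

/-- The number of pulls is large in terms of the number of machines that are used. -/
theorem machines_le_div {m : ℕ} (hm : 1 ≤ m) (N K : ℕ) :
    (machines m N K : ℝ) ≤ K / (machines m N K : ℝ) ^ (1 / m : ℝ) := by
  have hm0 : (0 : ℝ) < m := by exact_mod_cast hm
  set n := machines m N K with hn
  rcases Nat.eq_zero_or_pos n with h0 | hpos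
  · rw [h0]; simp; positivity
  have hpos' : (0 : ℝ) < n := by exact_mod_cast hpos
  have h1 : (n : ℝ) ≤ (K : ℝ) ^ ((m : ℝ) / (m + 1)) := by
    refine le_trans ?_ (Nat.floor_le (by positivity))
    exact Nat.cast_le.2 (min_le_right _ _)
  rw [le_div_iff₀ (by positivity)]
  calc (n : ℝ) * (n : ℝ) ^ (1 / m : ℝ) = (n : ℝ) ^ (((m : ℝ) + 1) / m) := by
        nth_rw 1 [← Real.rpow_one (n : ℝ)]
        rw [← Real.rpow_add hpos']; congr 1; field_simp
    _ ≤ ((K : ℝ) ^ ((m : ℝ) / (m + 1))) ^ (((m : ℝ) + 1) / m) := by gcongr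
    _ = K := by
      rw [← Real.rpow_mul (Nat.cast_nonneg K)]
      have : (m : ℝ) / (m + 1) * ((m + 1) / m) = 1 := by field_simp
      rw [this, Real.rpow_one]

theorem exists_estimationLoss_le {m : ℕ} (hm : 1 ≤ m) {η : ℝ} (hη : 0 < η) :
    ∃ n₀ : ℕ, ∀ N K n : ℕ, n = machines m N K → n₀ ≤ n → ∀ X : ℕ → ℕ → Bool,
      (estimationLoss m N K X : ℝ) ≤ (n : ℝ) ^ (9 / 10 : ℝ) ∧
      (n : ℝ) ^ (9 / 10 : ℝ) ≤ η * (K / (n : ℝ) ^ (1 / m : ℝ)) := by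
  -- For n ≥ η^(-10) one has n^(9/10) = n·n^(-1/10) ≤ ηn, and n ≤ K/n^(1/m). The summand 2 gives n ≥
  -- 2.
  refine ⟨⌈(1 / η) ^ 10⌉₊ + 2, fun N K n hn hn₀ X => ?_⟩
  have hn2 : 2 ≤ n := by omega
  have hpos : (0 : ℝ) < n := by exact_mod_cast (by omega : 0 < n)
  have hlt := sampleCount_lt hn2
  constructor
  · refine le_trans ?_ (sampleCount_le n)
    rw [hn] at hlt ⊢
    exact_mod_cast estimationLoss_le hlt X
  · have h1 := machines_le_div hm N K
    rw [← hn] at h1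
    have h2 : (1 / η) ^ 10 ≤ n := by
      refine (Nat.le_ceil _).trans ?_
      exact_mod_cast (by omega : ⌈(1 / η) ^ 10⌉₊ ≤ n)
    have h3 : 1 / η ≤ (n : ℝ) ^ (1 / 10 : ℝ) := by
      calc 1 / η = ((1 / η) ^ 10) ^ (1 / 10 : ℝ) := by
            rw [← Real.rpow_natCast, ← Real.rpow_mul (by positivity)]; norm_num
        _ ≤ _ := by gcongr
    have h4 : (n : ℝ) = (n : ℝ) ^ (9 / 10 : ℝ) * (n : ℝ) ^ (1 / 10 : ℝ) := by
      rw [← Real.rpow_add hpos]; norm_num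
    calc (n : ℝ) ^ (9 / 10 : ℝ) = η * ((n : ℝ) ^ (9 / 10 : ℝ) * (1 / η)) := by field_simp
      _ ≤ η * ((n : ℝ) ^ (9 / 10 : ℝ) * (n : ℝ) ^ (1 / 10 : ℝ)) := by gcongr
      _ = η * n := by rw [← h4]
      _ ≤ _ := by gcongr

/-! ### Loss of the algorithm on a sample path -/

open Classical in
/-- A bound for the loss of the algorithm, when its settling times are between `l` and `u`. -/
theorem heads_algorithm_le {m N K : ℕ} (hn : sampleCount (machines m N K) < machines m N K)
    {X : ℕ → ℕ → Bool} {l u : ℕ → ℕ}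
    (hl : ∀ i, sampleCount (machines m N K) ≤ i → i + 1 < machines m N K →
      (l i : ℝ) ≤ algSettle m (machines m N K) X i)
    (hu : ∀ i, sampleCount (machines m N K) ≤ i → i + 1 < machines m N K →
      algSettle m (machines m N K) X i < u i + 1) :
    (play N K (algorithm m N K) X).heads ≤ machines m N K
      + (∑ i ∈ Finset.Ico (sampleCount (machines m N K)) (machines m N K - 1),
          if ∀ j ∈ Finset.Ico (sampleCount (machines m N K)) i, ∃ j' < u j, X j j' = true then
            ∑ j ∈ Finset.Ico (l i) K, if (∀ j' < l i, X i j' = false) ∧ X i j = true then 1 else 0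
          else 0)
      + if ∀ j ∈ Finset.Ico (sampleCount (machines m N K)) (machines m N K - 1),
          ∃ j' < u j, X j j' = true then K else 0 := by
  set n := machines m N K with hndef
  set M := sampleCount n with hM
  have H := algInvariant_run hn X (N + K)
  rw [← play_eq_run] at H
  set h := play N K (algorithm m N K) X with hh
  have hpulls : h.pulls ≤ K := pulls_run_le _ _ _ _ _
  have hpass : ∀ i, i ≤ h.pos → i ≤ n - 1 → ∀ j ∈ Finset.Ico M i, ∃ j' < u j, X j j' = true := by
    intro i hi hin j hj
    rw [Finset.mem_Ico] at hj
    obtain ⟨j', h1, h2⟩ := (H.passed j hj.1 (by omega)).2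
    refine ⟨j', ?_, h2⟩
    have h3 := hu j hj.1 (by omega)
    have : (j' : ℝ) < u j := by linarith
    exact_mod_cast this
  have hterm : ∀ i ∈ Finset.Ico M (n - 1), h.countAt i true ≤ 1 +
      if ∀ j ∈ Finset.Ico M i, ∃ j' < u j, X j j' = true then
        ∑ j ∈ Finset.Ico (l i) K, if (∀ j' < l i, X i j' = false) ∧ X i j = true then 1 else 0
      else 0 := by
    intro i hi
    rw [Finset.mem_Ico] at hi
    rcases lt_trichotomy i h.pos with hip | hip | hip
    · exact le_add_right (H.passed i hi.1 hip).1
    -- A bandit on which the game ends before settling has at most one head. One that is settled has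
    -- shown tails in its first l i outcomes and can give heads only later, which the inner sum
    -- counts.
    · rcases H.current (hip ▸ hi.1) (by omega) with ⟨_, h2⟩ | ⟨h1, h2⟩
      · rw [hip]; exact le_add_right h2
      · rw [← hip] at h1 h2
        have hfalse : ∀ j' < l i, X i j' = false := by
          intro j' hj'
          refine h2 j' (le_trans ?_ (hl i hi.1 (by omega)))
          exact_mod_cast hj'
        rw [if_pos (hpass i hip.le (by omega))]
        refine le_add_left ?_
        rw [H.count_eq i]
        have hle : h.pullsAt i ≤ K := by
          refine le_trans ?_ hpulls
          rw [pulls_eq_sum (L := n) H.pos_lt]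
          exact Finset.single_le_sum (f := fun i => h.pullsAt i) (fun _ _ => Nat.zero_le _)
            (Finset.mem_range.2 (by omega))
        rw [← Finset.sum_filter, ← Finset.sum_filter]
        refine Finset.sum_le_sum_of_subset fun j hj => ?_
        rw [Finset.mem_filter, Finset.mem_range] at hj
        rw [Finset.mem_filter, Finset.mem_Ico]
        refine ⟨⟨?_, by omega⟩, hfalse, hj.2⟩
        by_contra hcon
        have := hfalse j (not_le.1 hcon)
        rw [hj.2] at this
        exact Bool.false_ne_true this.symm
    · rw [countAt_eq_zero _ hip]; exact Nat.zero_le _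
  have hlast : h.countAt (n - 1) true ≤
      if ∀ j ∈ Finset.Ico M (n - 1), ∃ j' < u j, X j j' = true then K else 0 := by
    rcases lt_or_ge h.pos (n - 1) with hp | hp
    · rw [countAt_eq_zero _ hp]; exact Nat.zero_le _
    · rw [if_pos (hpass (n - 1) hp le_rfl)]
      refine le_trans ?_ ((heads_le_pulls h).trans hpulls)
      rw [heads_eq_sum (L := n) H.pos_lt]
      exact Finset.single_le_sum (f := fun i => h.countAt i true) (fun _ _ => Nat.zero_le _)
        (Finset.mem_range.2 (by omega))
  have hsplit : h.heads = (∑ i ∈ Finset.range M, h.countAt i true)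
      + (∑ i ∈ Finset.Ico M (n - 1), h.countAt i true) + h.countAt (n - 1) true := by
    rw [heads_eq_sum (L := n) H.pos_lt, Finset.sum_range_add_sum_Ico _ (by omega : M ≤ n - 1),
      ← Finset.sum_range_succ]
    congr 2; omega
  have h1 : ∑ i ∈ Finset.range M, h.countAt i true ≤ M := by
    calc ∑ i ∈ Finset.range M, h.countAt i true ≤ ∑ _i ∈ Finset.range M, 1 :=
          Finset.sum_le_sum fun i hi => H.est_le i (Finset.mem_range.1 hi)
      _ = M := by simp
  have h2 := Finset.sum_le_sum hterm
  rw [Finset.sum_add_distrib] at h2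
  simp only [Finset.sum_const, Nat.card_Ico, smul_eq_mul, mul_one] at h2
  rw [hsplit]
  omega

/-! ### The expected loss of the algorithm -/

/-- Every bandit `j` with `M ≤ j < i` gives a head among its first `u j` outcomes. -/
def passSet (M : ℕ) (u : ℕ → ℕ) (i : ℕ) : Set Env := {ω | ∀ j ∈ Finset.Ico M i, ω j ∉ tailSet (u j)}

theorem passSet_eq (M : ℕ) (u : ℕ → ℕ) (i : ℕ) :
    passSet M u i = ((Finset.Ico M i : Finset ℕ) : Set ℕ).pi fun j => (tailSet (u j))ᶜ := by
  ext ω; simp [passSet, Set.mem_pi]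

theorem measurableSet_passSet (M : ℕ) (u : ℕ → ℕ) (i : ℕ) : MeasurableSet (passSet M u i) := by
  rw [passSet_eq]
  exact MeasurableSet.pi (Finset.countable_toSet _) fun j _ => (measurableSet_tailSet _).compl

theorem envLaw_passSet (F : ProbabilityMeasure ℝ) (M : ℕ) (u : ℕ → ℕ) (i : ℕ) :
    envLaw F (passSet M u i) = ENNReal.ofReal (∏ j ∈ Finset.Ico M i, (1 - surv F (u j))) := by
  rw [passSet_eq, envLaw_eq, Measure.infinitePi_pi _ fun j _ => (measurableSet_tailSet _).compl,
    ENNReal.ofReal_prod_of_nonneg fun j _ => sub_nonneg.2 (surv_le_one F _)]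
  refine Finset.prod_congr rfl fun j _ => ?_
  rw [prob_compl_eq_one_sub (measurableSet_tailSet _), rowLaw_tailSet,
    ENNReal.ofReal_sub _ (surv_nonneg F _), ENNReal.ofReal_one]

theorem notMem_tailSet_iff (ω : Env) (i k : ℕ) :
    ω i ∉ tailSet k ↔ ∃ j < k, outcome ω i j = true := by
  rw [mem_tailSet_iff]; push Not; simp

/-- As l and u are deterministic, the event of passing the bandits before i does not involve bandit
i. It is therefore independent of the loss after settling on i, and its probability is a product. On
`bad` the loss is bounded by K. -/
theorem expectedLoss_algorithm_le {m N K : ℕ} (F : ProbabilityMeasure ℝ)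
    (hn : sampleCount (machines m N K) < machines m N K) {l u : ℕ → ℕ} {bad : Set Env}
    (hl : ∀ ω ∉ bad, ∀ i, sampleCount (machines m N K) ≤ i → i + 1 < machines m N K →
      (l i : ℝ) ≤ algSettle m (machines m N K) (outcome ω) i)
    (hu : ∀ ω ∉ bad, ∀ i, sampleCount (machines m N K) ≤ i → i + 1 < machines m N K →
      algSettle m (machines m N K) (outcome ω) i < u i + 1) :
    expectedLoss F N K (algorithm m N K) ≤ K * (envLaw F).real bad + machines m N K
      + (K * ∑ i ∈ Finset.Ico (sampleCount (machines m N K)) (machines m N K - 1),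
          (∏ j ∈ Finset.Ico (sampleCount (machines m N K)) i, (1 - surv F (u j)))
            * survHead F (l i))
      + K * ∏ j ∈ Finset.Ico (sampleCount (machines m N K)) (machines m N K - 1),
          (1 - surv F (u j)) := by
  classical
  set n := machines m N K with hndef
  set M := sampleCount n with hM
  have hR : ∀ i, 0 ≤ ∏ j ∈ Finset.Ico M i, (1 - surv F (u j)) := fun i =>
    Finset.prod_nonneg fun j _ => sub_nonneg.2 (surv_le_one F _)
  let g : ℕ → ℝ × (ℕ → unitInterval) → ENNReal := fun i r =>
    ∑ j ∈ Finset.Ico (l i) K, (tailSet (l i) ∩ headSet j).indicator 1 r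
  have hsets : ∀ i j, MeasurableSet (tailSet (l i) ∩ headSet j) := fun i j =>
    (measurableSet_tailSet _).inter (measurableSet_headSet _)
  have hg : ∀ i, Measurable (g i) := fun i =>
    Finset.measurable_sum _ fun j _ => measurable_one.indicator (hsets i j)
  have hgint : ∀ i, ∫⁻ r, g i r ∂(rowLaw F) ≤ K * ENNReal.ofReal (survHead F (l i)) := by
    intro i
    rw [lintegral_finsetSum _ fun j _ => measurable_one.indicator (hsets i j)]
    calc ∑ j ∈ Finset.Ico (l i) K, ∫⁻ r, (tailSet (l i) ∩ headSet j).indicator 1 r ∂(rowLaw F)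
        = ∑ j ∈ Finset.Ico (l i) K, ENNReal.ofReal (survHead F (l i)) := by
          refine Finset.sum_congr rfl fun j hj => ?_
          rw [lintegral_indicator_one (hsets i j),
            rowLaw_tailSet_inter_headSet F (Finset.mem_Ico.1 hj).1]
      _ ≤ _ := by
          rw [Finset.sum_const, Nat.card_Ico, nsmul_eq_mul]
          gcongr
          omega
  have hpt : ∀ ω, ((play N K (algorithm m N K) (outcome ω)).heads : ENNReal)
      ≤ ((n : ENNReal) + (∑ i ∈ Finset.Ico M (n - 1),
          (passSet M u i).indicator (fun ω => g i (ω i)) ω)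
        + (passSet M u (n - 1)).indicator (fun _ => (K : ENNReal)) ω)
        + bad.indicator (fun _ => (K : ENNReal)) ω := by
    intro ω
    by_cases hω : ω ∈ bad
    · refine le_add_left ?_
      rw [indicator_of_mem hω]
      exact_mod_cast (heads_le_pulls _).trans (pulls_run_le _ _ _ _ _)
    · refine le_add_right ?_
      have h1 := heads_algorithm_le hn (hl ω hω) (hu ω hω)
      refine (Nat.cast_le.2 h1).trans ?_
      rw [← hndef, ← hM]
      push_cast
      gcongr with i hi
      · by_cases hp : ω ∈ passSet M u i
        · have hp' : ∀ j ∈ Finset.Ico M i, ∃ j' < u j, outcome ω j j' = true := fun j hj =>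
            (notMem_tailSet_iff ω j (u j)).1 (hp j hj)
          rw [if_pos hp', indicator_of_mem hp]
          refine Finset.sum_le_sum fun j _ => ?_
          by_cases hq : (∀ j' < l i, outcome ω i j' = false) ∧ outcome ω i j = true
          · have : ω i ∈ tailSet (l i) ∩ headSet j :=
              ⟨(mem_tailSet_iff ω i _).2 hq.1, (mem_headSet_iff ω i j).2 hq.2⟩
            rw [if_pos hq, indicator_of_mem this]; rfl
          · rw [if_neg hq]; exact zero_le
        · have hp' : ¬ ∀ j ∈ Finset.Ico M i, ∃ j' < u j, outcome ω j j' = true := fun h =>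
            hp fun j hj => (notMem_tailSet_iff ω j (u j)).2 (h j hj)
          rw [if_neg hp']; exact zero_le
      · by_cases hp : ω ∈ passSet M u (n - 1)
        · rw [indicator_of_mem hp]
          split_ifs
          · exact le_rfl
          · exact zero_le
        · have hp' : ¬ ∀ j ∈ Finset.Ico M (n - 1), ∃ j' < u j, outcome ω j j' = true := fun h =>
            hp fun j hj => (notMem_tailSet_iff ω j (u j)).2 (h j hj)
          rw [if_neg hp']; exact zero_le
  have hm1 : ∀ i, Measurable ((passSet M u i).indicator fun ω : Env => g i (ω i)) := fun i =>
    ((hg i).comp (measurable_pi_apply i)).indicator (measurableSet_passSet M u i)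
  have hm2 : Measurable ((passSet M u (n - 1)).indicator fun _ : Env => (K : ENNReal)) :=
    measurable_const.indicator (measurableSet_passSet M u _)
  have hm3 : Measurable fun ω : Env => (n : ENNReal) + ∑ i ∈ Finset.Ico M (n - 1),
      (passSet M u i).indicator (fun ω => g i (ω i)) ω :=
    measurable_const.add (Finset.measurable_sum _ fun i _ => hm1 i)
  have hm4 : Measurable fun ω : Env => (n : ENNReal) + (∑ i ∈ Finset.Ico M (n - 1),
      (passSet M u i).indicator (fun ω => g i (ω i)) ω)
      + (passSet M u (n - 1)).indicator (fun _ => (K : ENNReal)) ω := hm3.add hm2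
  have hterm : ∀ i, ∫⁻ ω, (passSet M u i).indicator (fun ω => g i (ω i)) ω ∂(envLaw F)
      ≤ ENNReal.ofReal (K * ((∏ j ∈ Finset.Ico M i, (1 - surv F (u j))) * survHead F (l i))) := by
    intro i
    rw [lintegral_envLaw_indicator_mul F i (measurableSet_passSet M u i) _ (hg i), envLaw_passSet]
    · refine (mul_le_mul_right (hgint i) _).trans (le_of_eq ?_)
      rw [ENNReal.ofReal_mul (Nat.cast_nonneg K), ENNReal.ofReal_mul (hR i), ENNReal.ofReal_natCast]
      ring
    · intro ω r
      refine forall₂_congr fun j hj => ?_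
      have : j ≠ i := by have := Finset.mem_Ico.1 hj; omega
      rw [Function.update_of_ne this]
  rw [← ENNReal.ofReal_le_ofReal_iff, expectedLoss_eq_lintegral]
  · calc ∫⁻ ω, ((play N K (algorithm m N K) (outcome ω)).heads : ENNReal) ∂(envLaw F)
        ≤ ∫⁻ ω, (((n : ENNReal) + (∑ i ∈ Finset.Ico M (n - 1),
          (passSet M u i).indicator (fun ω => g i (ω i)) ω)
        + (passSet M u (n - 1)).indicator (fun _ => (K : ENNReal)) ω)
        + bad.indicator (fun _ => (K : ENNReal)) ω) ∂(envLaw F) := lintegral_mono hpt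
      _ = (n : ENNReal) + (∑ i ∈ Finset.Ico M (n - 1), ∫⁻ ω,
          (passSet M u i).indicator (fun ω => g i (ω i)) ω ∂(envLaw F))
        + K * envLaw F (passSet M u (n - 1))
        + ∫⁻ ω, bad.indicator (fun _ => (K : ENNReal)) ω ∂(envLaw F) := by
          rw [lintegral_add_left hm4, lintegral_add_left hm3,
            lintegral_add_left measurable_const, lintegral_finsetSum _ fun i _ => hm1 i,
            lintegral_indicator_const (measurableSet_passSet M u _)]
          simp
      _ ≤ (n : ENNReal) + (∑ i ∈ Finset.Ico M (n - 1),
          ENNReal.ofReal (K * ((∏ j ∈ Finset.Ico M i, (1 - surv F (u j))) * survHead F (l i))))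
        + K * envLaw F (passSet M u (n - 1)) + K * envLaw F bad := by
          gcongr with i hi
          · exact hterm i
          -- An upper bound suffices, so `bad` need not be measurable.
          · exact lintegral_indicator_const_le bad _
      _ = _ := by
          rw [← ENNReal.ofReal_sum_of_nonneg fun i _ => mul_nonneg (Nat.cast_nonneg K)
              (mul_nonneg (hR i) (survHead_nonneg F _)), envLaw_passSet,
            ← ofReal_measureReal (μ := envLaw F) (s := bad), ← ENNReal.ofReal_natCast,
            ← ENNReal.ofReal_natCast, ← ENNReal.ofReal_mul (Nat.cast_nonneg K),
            ← ENNReal.ofReal_mul (Nat.cast_nonneg K), ← Finset.mul_sum]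
          have h1 : 0 ≤ ∑ i ∈ Finset.Ico M (n - 1),
              (∏ j ∈ Finset.Ico M i, (1 - surv F (u j))) * survHead F (l i) :=
            Finset.sum_nonneg fun i _ => mul_nonneg (hR i) (survHead_nonneg F _)
          have h2 := hR (n - 1)
          rw [← ENNReal.ofReal_add (by positivity) (by positivity),
            ← ENNReal.ofReal_add (by positivity) (by positivity),
            ← ENNReal.ofReal_add (by positivity) (by positivity)]
          congr 1; ring
  · have h1 : 0 ≤ ∑ i ∈ Finset.Ico M (n - 1),
        (∏ j ∈ Finset.Ico M i, (1 - surv F (u j))) * survHead F (l i) :=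
      Finset.sum_nonneg fun i _ => mul_nonneg (hR i) (survHead_nonneg F _)
    have h2 := hR (n - 1)
    positivity

/-! ### Estimates for the terms of the bound -/

theorem IsAdmissibleFamily.exists_surv_ge {m : ℕ} {B : ℝ} (hB : 0 < B)
    {𝓕 : Set (ProbabilityMeasure ℝ)} (h𝓕 : IsAdmissibleFamily m B 𝓕) :
    ∃ k₀ : ℕ, 1 ≤ k₀ ∧ ∀ F ∈ 𝓕, ∀ k ≥ k₀, 7 / 8 * (cdfDeriv F m 0 / k ^ m) ≤ surv F k := by
  obtain ⟨δ, hδ, hd⟩ := h𝓕.differentiable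
  obtain ⟨δ', hδ', hw⟩ := h𝓕.equicontinuous (1 / (16 * B)) (by positivity)
  set r := min 1 (min (δ / 2) (δ' / 2)) with hr
  have hr0 : 0 < r := by positivity
  have hr1 : r ≤ 1 := min_le_left _ _
  have hrδ : r < δ := by
    have : r ≤ δ / 2 := (min_le_right _ _).trans (min_le_left _ _)
    linarith
  have hrδ' : r < δ' := by
    have : r ≤ δ' / 2 := (min_le_right _ _).trans (min_le_right _ _)
    linarith
  set A : ℝ := (B * m ^ 2 + (1 + B) * (m + 1)!) / r ^ (m + 1) with hA
  have hA0 : 0 ≤ A := by positivity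
  refine ⟨⌈16 * B * A⌉₊ + 1, by omega, fun F hF k hk => ?_⟩
  have hk1 : 1 ≤ k := by omega
  have hk0 : (0 : ℝ) < k := by exact_mod_cast hk1
  have h1 := (abs_le.1 (surv_estimate hrδ hr0 hr1 (hd F hF) (h𝓕.lower_deriv_zero F hF)
    (h𝓕.deriv_mem_Icc hB hF) (fun x hx => hw F hF x ⟨hx.1, hx.2.trans_lt hrδ'⟩) hk1)).1
  have ha := (h𝓕.deriv_mem F hF).1
  set a := cdfDeriv F m 0
  have h2 : A / k ≤ 1 / (16 * B) := by
    rw [div_le_div_iff₀ hk0 (by positivity), one_mul]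
    have : (⌈16 * B * A⌉₊ : ℝ) ≤ k := by exact_mod_cast (by omega : ⌈16 * B * A⌉₊ ≤ k)
    have := Nat.le_ceil (16 * B * A)
    linarith
  -- Each of the two errors is at most a/16, since a ≥ 1/B; this leaves the factor 7/8.
  have h3 : 1 / (16 * B) = 1 / B / 16 := by field_simp
  have h4 : (1 / (16 * B) + A / k) / (k : ℝ) ^ m ≤ a / 8 / k ^ m := by gcongr; linarith
  have h5 : 7 / 8 * (a / (k : ℝ) ^ m) = a / k ^ m - a / 8 / k ^ m := by ring
  linarith

/-- The product of the probabilities of not settling. -/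
theorem prod_one_sub_le {n M L : ℕ} {p : ℕ → ℝ} (hL : 1 ≤ L) (hM : M + L ≤ n)
    (hp0 : ∀ j, 0 ≤ p j) (hp1 : ∀ j, p j ≤ 1)
    (hp : ∀ j, M ≤ j → j + L ≤ n → 3 / 2 / ((n : ℝ) - j) ≤ p j) {i : ℕ} (hi : M ≤ i)
    (hin : i < n) :
    ∏ j ∈ Finset.Ico M i, (1 - p j)
      ≤ (max ((n : ℝ) - i) L / ((n : ℝ) - M)) ^ (3 / 2 : ℝ) := by
  have hnM : (0 : ℝ) < (n : ℝ) - M := by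
    have : (M : ℝ) < n := by exact_mod_cast (by omega : M < n)
    linarith
  induction i, hi using Nat.le_induction with
  | base =>
    have : (L : ℝ) ≤ (n : ℝ) - M := by
      have : (M : ℝ) + L ≤ n := by exact_mod_cast hM
      linarith
    rw [max_eq_left this, div_self hnM.ne', Real.one_rpow]
    simp
  | succ i hi ih =>
    rw [Finset.prod_Ico_succ_top hi]
    have ih' := ih (by omega)
    have h0 : 0 ≤ 1 - p i := sub_nonneg.2 (hp1 i)
    have hin' : (i : ℝ) + 2 ≤ n := by exact_mod_cast (by omega : i + 2 ≤ n)
    have hni : 0 < (n : ℝ) - i := by linarith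
    rcases le_or_gt (i + 1 + L) n with h | h
    · have hL' : (L : ℝ) + 1 ≤ (n : ℝ) - i := by
        have : (i : ℝ) + 1 + L ≤ n := by exact_mod_cast h
        linarith
      push_cast
      rw [max_eq_left (by linarith)] at ih'
      rw [max_eq_left (by linarith)]
      -- Bernoulli's inequality with exponent 3/2 for 1 - 1/(n-i), after which the product
      -- telescopes.
      have h1 : 1 - p i ≤ (((n : ℝ) - (i + 1)) / (n - i)) ^ (3 / 2 : ℝ) := by
        have h2 := one_add_mul_self_le_rpow_one_add (s := -(1 / ((n : ℝ) - i))) (p := 3 / 2)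
          (by rw [neg_le_neg_iff, div_le_one hni]; linarith) (by norm_num)
        have h3 : 1 + -(1 / ((n : ℝ) - i)) = ((n : ℝ) - (i + 1)) / (n - i) := by
          field_simp; ring
        rw [h3] at h2
        refine le_trans ?_ h2
        have h4 := hp i hi (by omega)
        have h5 : 3 / 2 * -(1 / ((n : ℝ) - i)) = -(3 / 2 / ((n : ℝ) - i)) := by ring
        rw [h5]; linarith
      calc (∏ j ∈ Finset.Ico M i, (1 - p j)) * (1 - p i)
          ≤ (((n : ℝ) - i) / (n - M)) ^ (3 / 2 : ℝ)
            * (((n : ℝ) - (i + 1)) / (n - i)) ^ (3 / 2 : ℝ) := by gcongr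
        _ = _ := by
          rw [← Real.mul_rpow (by positivity) (div_nonneg (by linarith) hni.le)]
          congr 1; field_simp
    -- Near the end nothing is known about p, and the factors are just bounded by 1; the maximum
    -- with L accounts for this.
    · have hL' : (n : ℝ) - i ≤ L := by
        have : (n : ℝ) ≤ i + L := by exact_mod_cast (by omega : n ≤ i + L)
        linarith
      rw [max_eq_right hL'] at ih'
      rw [max_eq_right (by push_cast; linarith)]
      refine le_trans (mul_le_of_le_one_right ?_ (by linarith [hp0 i])) ih'
      exact Finset.prod_nonneg fun j _ => sub_nonneg.2 (hp1 j)

theorem sum_one_div_sqrt_le (n : ℕ) :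
    ∑ k ∈ Finset.range n, 1 / √((k : ℝ) + 1) ≤ 2 * √n := by
  induction n with
  | zero => simp
  | succ n ih =>
    rw [Finset.sum_range_succ]
    have h0 : 0 < √((n : ℝ) + 1) := Real.sqrt_pos.2 (by positivity)
    have h1 := Real.sq_sqrt (show (0 : ℝ) ≤ n by positivity)
    have h2 := Real.sq_sqrt (show (0 : ℝ) ≤ (n : ℝ) + 1 by positivity)
    have h3 : 1 / √((n : ℝ) + 1) ≤ 2 * (√((n : ℝ) + 1) - √n) := by
      rw [div_le_iff₀ h0]
      nlinarith [sq_nonneg (√((n : ℝ) + 1) - √n)]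
    push_cast
    linarith

/-- The sum of the expected losses at the settling bandits. -/
theorem sum_settle_le {n M : ℕ} {p : ℝ} (hn : 1 ≤ n) (hp1 : p ≤ 1) :
    ∑ i ∈ Finset.Ico M (n - 1), ((n : ℝ) - i) ^ (3 / 2 : ℝ) / (((n : ℝ) - i) * ((n : ℝ) - i) ^ p)
      ≤ 2 * (n : ℝ) ^ (3 / 2 : ℝ) / (n : ℝ) ^ p := by
  have hn0 : (0 : ℝ) < n := by exact_mod_cast hn
  have hsqrt : ∀ x : ℝ, 0 < x → x ^ (3 / 2 : ℝ) = x * √x := fun x hx => by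
    rw [Real.sqrt_eq_rpow, ← Real.rpow_one_add' hx.le (by norm_num)]; norm_num
  have hterm : ∀ i ∈ Finset.Ico M (n - 1),
      ((n : ℝ) - i) ^ (3 / 2 : ℝ) / (((n : ℝ) - i) * ((n : ℝ) - i) ^ p)
        ≤ n / (n : ℝ) ^ p * (1 / √((n : ℝ) - i)) := by
    intro i hi
    rw [Finset.mem_Ico] at hi
    have hv : 0 < (n : ℝ) - i := by
      have : (i : ℝ) < n := by exact_mod_cast (by omega : i < n)
      linarith
    have hvn : (n : ℝ) - i ≤ n := by linarith [(Nat.cast_nonneg i : (0 : ℝ) ≤ i)]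
    set v := (n : ℝ) - i
    have h1 : v ^ (1 - p) ≤ (n : ℝ) ^ (1 - p) := Real.rpow_le_rpow hv.le hvn (by linarith)
    rw [Real.rpow_sub hv, Real.rpow_sub hn0, Real.rpow_one, Real.rpow_one] at h1
    have hs : 0 < √v := Real.sqrt_pos.2 hv
    -- As p ≤ 1, v^(1-p) is at most n^(1-p), and what remains is the sum of 1/√v, which is O(√n).
    calc v ^ (3 / 2 : ℝ) / (v * v ^ p) = v / v ^ p * (1 / √v) := by
          rw [hsqrt v hv]
          have h2 : v ^ p ≠ 0 := (Real.rpow_pos_of_pos hv p).ne'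
          have h3 := Real.mul_self_sqrt hv.le
          field_simp
          nlinarith
      _ ≤ _ := by gcongr
  calc _ ≤ ∑ i ∈ Finset.Ico M (n - 1), n / (n : ℝ) ^ p * (1 / √((n : ℝ) - i)) :=
        Finset.sum_le_sum hterm
    _ = n / (n : ℝ) ^ p * ∑ i ∈ Finset.Ico M (n - 1), 1 / √((n : ℝ) - i) := by
        rw [Finset.mul_sum]
    _ ≤ n / (n : ℝ) ^ p * ∑ i ∈ Finset.range n, 1 / √((n : ℝ) - i) := by
        gcongr
        intro i hi
        rw [Finset.mem_Ico] at hi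
        rw [Finset.mem_range]; omega
    _ = n / (n : ℝ) ^ p * ∑ k ∈ Finset.range n, 1 / √((k : ℝ) + 1) := by
        congr 1
        rw [← Finset.sum_range_reflect]
        refine Finset.sum_congr rfl fun i hi => ?_
        have : i + 1 ≤ n := Finset.mem_range.1 hi
        rw [Nat.cast_sub (by omega), Nat.cast_sub (by omega)]
        congr 2; push_cast; ring
    _ ≤ n / (n : ℝ) ^ p * (2 * √n) := by gcongr; exact sum_one_div_sqrt_le n
    _ = _ := by rw [hsqrt n hn0]; ring

/-! ### The upper bound -/

/-- An estimate with a small relative error gives a settling time with a small relative error. -/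
theorem settleTime_mem_Icc {m n i : ℕ} {a e η : ℝ} (ha : 0 < a) (hi : i < n)
    (hη1 : η < 1) (he : |e - (a / m !) ^ (-(1 / m) : ℝ)| ≤ η * (a / m !) ^ (-(1 / m) : ℝ)) :
    settleTime m n e i ∈ Icc ((a * ((n : ℝ) - i) / 2) ^ (1 / m : ℝ) / (1 + η))
      ((a * ((n : ℝ) - i) / 2) ^ (1 / m : ℝ) / (1 - η)) := by
  have hv : 0 < (n : ℝ) - i := by
    have : (i : ℝ) < n := by exact_mod_cast hi
    linarith
  have hf : (0 : ℝ) < m ! := by exact_mod_cast m.factorial_pos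
  set v := (n : ℝ) - i with hvdef
  set c := (a / m !) ^ (-(1 / m) : ℝ) with hc
  have hc0 : 0 < c := Real.rpow_pos_of_pos (by positivity) _
  set y := (a * v / 2) ^ (1 / m : ℝ) with hy
  have hy0 : 0 < y := Real.rpow_pos_of_pos (by positivity) _
  have hst : settleTime m n e i = y * c / e := by
    rw [settleTime, ← hvdef, hy, hc, Real.rpow_neg (by positivity), ← Real.inv_rpow (by positivity),
      ← Real.mul_rpow (by positivity) (by positivity)]
    congr 2; field_simp
  obtain ⟨h1, h2⟩ := abs_le.1 he
  have h3 : 0 < c * (1 - η) := mul_pos hc0 (by linarith)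
  have he0 : 0 < e := by linarith
  have hη0 : 0 ≤ η := by
    by_contra h
    have := (abs_nonneg _).trans he
    nlinarith
  rw [hst]
  constructor
  · rw [div_le_div_iff₀ (by linarith) he0]
    nlinarith
  · rw [div_le_div_iff₀ he0 (by linarith)]
    nlinarith

/-- Without the error, y^m = av/2 gives a/y^m = 2/v. The factor 7/8 from the asymptotics and (1 -
1/(8m))^m ≥ 7/8 from the estimate leave 2·(7/8)² = 49/32 > 3/2. -/
theorem surv_floor_ge {F : ProbabilityMeasure ℝ} {m k₀ : ℕ} (hm : 1 ≤ m) {a v : ℝ} (ha : 0 < a)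
    (hk₀ : 1 ≤ k₀) (h : ∀ k ≥ k₀, 7 / 8 * (a / (k : ℝ) ^ m) ≤ surv F k)
    (hv : 2 * (k₀ : ℝ) ^ m ≤ a * v) :
    3 / 2 / v ≤ surv F ⌊(a * v / 2) ^ (1 / m : ℝ) / (1 - 1 / (8 * m))⌋₊ := by
  have hm1 : (1 : ℝ) ≤ m := by exact_mod_cast hm
  have hk1 : (1 : ℝ) ≤ k₀ := by exact_mod_cast hk₀
  have hη : 1 / (8 * (m : ℝ)) ≤ 1 / 8 := by
    apply one_div_le_one_div_of_le <;> linarith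
  have hη0 : 0 < 1 / (8 * (m : ℝ)) := by positivity
  set η := 1 / (8 * (m : ℝ)) with hηdef
  have hav : 0 < a * v := lt_of_lt_of_le (by positivity) hv
  have hv0 : 0 < v := pos_of_mul_pos_right hav ha.le
  set y := (a * v / 2) ^ (1 / m : ℝ) with hy
  have hym : y ^ m = a * v / 2 := by
    rw [hy, one_div, Real.rpow_inv_natCast_pow (by positivity) (by omega)]
  have hyk : (k₀ : ℝ) ≤ y := by
    refine le_of_pow_le_pow_left₀ (n := m) (by omega) (by positivity) ?_
    rw [hym]; linarith
  have h1η : 0 < 1 - η := by linarith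
  have hyη : y ≤ y / (1 - η) := by
    rw [le_div_iff₀ h1η]; nlinarith
  have hfl : k₀ ≤ ⌊y / (1 - η)⌋₊ := Nat.le_floor (hyk.trans hyη)
  set u := ⌊y / (1 - η)⌋₊
  have hu0 : (0 : ℝ) < u := by exact_mod_cast (by omega : 0 < u)
  have huy : (u : ℝ) ≤ y / (1 - η) := Nat.floor_le (by positivity)
  refine le_trans ?_ (h u hfl)
  have hb : 7 / 8 ≤ (1 - η) ^ m := by
    have := one_add_mul_le_pow (a := -η) (by linarith) m
    have h2 : 1 + (m : ℝ) * -η = 7 / 8 := by rw [hηdef]; field_simp; norm_num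
    rw [h2] at this
    simpa [sub_eq_add_neg] using this
  calc 3 / 2 / v ≤ 7 / 8 * (2 * (7 / 8) / v) := by
        rw [← mul_div_assoc]; gcongr; norm_num
    _ ≤ 7 / 8 * (2 * (1 - η) ^ m / v) := by gcongr
    _ = 7 / 8 * (a / (y / (1 - η)) ^ m) := by
        rw [div_pow, hym]; field_simp
    _ ≤ _ := by gcongr

theorem survHead_floor_le {F : ProbabilityMeasure ℝ} {m : ℕ} (hm : 1 ≤ m) {B C a v η : ℝ}
    (hB : 0 < B) (hC : 0 ≤ C)
    (h : ∀ k : ℕ, survHead F k ≤ C / ((k : ℝ) + 1) ^ (m + 1)) (ha : 1 / B ≤ a) (hv : 0 < v)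
    (hη : 0 ≤ η) (hη1 : η ≤ 1) :
    survHead F ⌊(a * v / 2) ^ (1 / m : ℝ) / (1 + η)⌋₊
      ≤ C * 2 ^ (m + 1) * ((2 * B) * (2 * B) ^ (1 / m : ℝ)) / (v * v ^ (1 / m : ℝ)) := by
  have hx : v / (2 * B) ≤ a * v / 2 := by
    have : 1 / B * v ≤ a * v := by gcongr
    calc v / (2 * B) = 1 / B * v / 2 := by field_simp
      _ ≤ _ := by linarith
  have hx0 : 0 < v / (2 * B) := by positivity
  set y := (a * v / 2) ^ (1 / m : ℝ) with hy
  have hav : 0 < a * v / 2 := by linarith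
  have hy0 : 0 < y := Real.rpow_pos_of_pos hav _
  have hym : y ^ m = a * v / 2 := by
    rw [hy, one_div, Real.rpow_inv_natCast_pow (by positivity) (by omega)]
  have hl : y / 2 ≤ (⌊y / (1 + η)⌋₊ : ℝ) + 1 := by
    have h1 := Nat.lt_floor_add_one (y / (1 + η))
    have h2 : y / 2 ≤ y / (1 + η) := by gcongr; linarith
    linarith
  have hz : v * v ^ (1 / m : ℝ) / ((2 * B) * (2 * B) ^ (1 / m : ℝ)) ≤ y ^ (m + 1) := by
    rw [pow_succ, hym]
    calc _ = v / (2 * B) * (v / (2 * B)) ^ (1 / m : ℝ) := by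
          rw [Real.div_rpow hv.le (by positivity)]; field_simp
      _ ≤ _ := by rw [hy]; gcongr
  have hv1 : 0 < v ^ (1 / m : ℝ) := Real.rpow_pos_of_pos hv _
  have hB1 : 0 < (2 * B) ^ (1 / m : ℝ) := Real.rpow_pos_of_pos (by positivity) _
  calc _ ≤ C / ((⌊y / (1 + η)⌋₊ : ℝ) + 1) ^ (m + 1) := h _
    _ ≤ C / (y / 2) ^ (m + 1) := by gcongr
    _ = C * 2 ^ (m + 1) / y ^ (m + 1) := by rw [div_pow]; field_simp
    _ ≤ C * 2 ^ (m + 1) / (v * v ^ (1 / m : ℝ) / ((2 * B) * (2 * B) ^ (1 / m : ℝ))) := by gcongr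
    _ = _ := by field_simp

/-- One term of the exponential series, of an order j with jε ≥ 1, already exceeds x/j!. -/
theorem exp_neg_rpow_le {ε x : ℝ} (hε : 0 < ε) (hx : 1 ≤ x) :
    Real.exp (-x ^ ε) ≤ (⌈1 / ε⌉₊ ! : ℝ) / x := by
  have hx0 : 0 < x := by linarith
  have h1 := Real.pow_div_factorial_le_exp (x ^ ε) (by positivity) ⌈1 / ε⌉₊
  have h2 : x ≤ (x ^ ε) ^ ⌈1 / ε⌉₊ := by
    rw [← Real.rpow_mul_natCast hx0.le]
    refine Real.self_le_rpow_of_one_le hx ?_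
    have := Nat.le_ceil (1 / ε)
    rwa [div_le_iff₀ hε, mul_comm] at this
  have hf : (0 : ℝ) < ⌈1 / ε⌉₊ ! := by exact_mod_cast Nat.factorial_pos _
  rw [Real.exp_neg, inv_eq_one_div, div_le_div_iff₀ (Real.exp_pos _) hx0, one_mul]
  rw [div_le_iff₀ hf] at h1
  linarith

/-- 1024 = 2^10 makes n^(1/10) ≥ 2, while the sample count is at most n^(9/10). -/
theorem two_mul_sampleCount_le {n : ℕ} (hn : 1024 ≤ n) : 2 * (sampleCount n : ℝ) ≤ n := by
  have hn' : ((2 : ℝ) ^ (10 : ℝ)) ≤ n := by norm_num; exact_mod_cast hn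
  have hn0 : (0 : ℝ) < n := lt_of_lt_of_le (by positivity) hn'
  have h1 : (2 : ℝ) ≤ (n : ℝ) ^ (1 / 10 : ℝ) := by
    calc (2 : ℝ) = ((2 : ℝ) ^ (10 : ℝ)) ^ (1 / 10 : ℝ) := by
          rw [← Real.rpow_mul (by norm_num)]; norm_num
      _ ≤ _ := by gcongr
  calc 2 * (sampleCount n : ℝ) ≤ (n : ℝ) ^ (1 / 10 : ℝ) * (n : ℝ) ^ (9 / 10 : ℝ) := by
        gcongr; exact sampleCount_le n
    _ = n := by rw [← Real.rpow_add hn0]; norm_num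

theorem one_le_machines {m N K : ℕ} (hN : 1 ≤ N) (hK : 1 ≤ K) : 1 ≤ machines m N K := by
  refine le_min hN (Nat.le_floor ?_)
  rw [Nat.cast_one]
  exact Real.one_le_rpow (by exact_mod_cast hK) (by positivity)

/-- The bound for the loss of the algorithm if the estimate is accurate off the event `bad`. -/
theorem expectedLoss_algorithm_le_of_accurate {m N K k₀ L : ℕ} (hm : 1 ≤ m) {B C a q : ℝ}
    (hB : 0 < B) (hC : 0 ≤ C) {F : ProbabilityMeasure ℝ} (ha : 1 / B ≤ a)
    (hk₀ : 1 ≤ k₀) (hsurv : ∀ k ≥ k₀, 7 / 8 * (a / (k : ℝ) ^ m) ≤ surv F k)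
    (hhead : ∀ k : ℕ, survHead F k ≤ C / ((k : ℝ) + 1) ^ (m + 1))
    (hL : 1 ≤ L) (hLB : 2 * B * (k₀ : ℝ) ^ m ≤ L)
    (hn : 1024 ≤ machines m N K) (hLn : 2 * L ≤ machines m N K)
    (hbad : (envLaw F).real {ω | 1 / (8 * m) * (a / m !) ^ (-(1 / m) : ℝ) <
      |bernoulliEstimator m (machines m N K) (tailsBeforeHead ω) - (a / m !) ^ (-(1 / m) : ℝ)|}
      ≤ q / machines m N K) :
    expectedLoss F N K (algorithm m N K) ≤
      (q + 1 + 2 * (2 * L : ℝ) ^ (3 / 2 : ℝ)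
          * (C * 2 ^ (m + 1) * ((2 * B) * (2 * B) ^ (1 / m : ℝ))) + (2 * L : ℝ) ^ (3 / 2 : ℝ))
        * (K / (machines m N K : ℝ) ^ (1 / m : ℝ)) := by
  have hlast := machines_le_div hm N K
  set n := machines m N K with hndef
  set M := sampleCount n with hM
  have hm1 : (1 : ℝ) ≤ m := by exact_mod_cast hm
  have hp1 : (1 / m : ℝ) ≤ 1 := by rw [div_le_one (by positivity)]; exact hm1
  have ha0 : 0 < a := lt_of_lt_of_le (by positivity) ha
  have hη : 1 / (8 * (m : ℝ)) ≤ 1 / 8 := by apply one_div_le_one_div_of_le <;> linarith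
  have hη0 : 0 < 1 / (8 * (m : ℝ)) := by positivity
  set C₃ := C * 2 ^ (m + 1) * ((2 * B) * (2 * B) ^ (1 / m : ℝ)) with hC₃
  have hC₃0 : 0 ≤ C₃ := by positivity
  have hn1 : (1 : ℝ) ≤ n := by exact_mod_cast (by omega : 1 ≤ n)
  have hn0 : (0 : ℝ) < n := by linarith
  have h2M : 2 * (M : ℝ) ≤ n := two_mul_sampleCount_le hn
  have h2M' : 2 * M ≤ n := by exact_mod_cast h2M
  have hMn : M < n := by omega
  have hL1 : (1 : ℝ) ≤ L := by exact_mod_cast hL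
  have hnp : (n : ℝ) ^ (1 / m : ℝ) ≤ n := by
    simpa using Real.rpow_le_rpow_of_exponent_le hn1 hp1
  have hnp0 : 0 < (n : ℝ) ^ (1 / m : ℝ) := Real.rpow_pos_of_pos hn0 _
  let y : ℕ → ℝ := fun i => (a * ((n : ℝ) - i) / 2) ^ (1 / m : ℝ)
  -- Deterministic bounds for the settling times when the estimate has relative error at most
  -- 1/(8m).
  let l : ℕ → ℕ := fun i => ⌊y i / (1 + 1 / (8 * m))⌋₊
  let u : ℕ → ℕ := fun i => ⌊y i / (1 - 1 / (8 * m))⌋₊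
  set bad : Set Env := {ω | 1 / (8 * m) * (a / m !) ^ (-(1 / m) : ℝ) <
      |bernoulliEstimator m n (tailsBeforeHead ω) - (a / m !) ^ (-(1 / m) : ℝ)|} with hbaddef
  have hmem : ∀ ω ∉ bad, ∀ i, M ≤ i → i + 1 < n → algSettle m n (outcome ω) i ∈
      Icc (y i / (1 + 1 / (8 * m))) (y i / (1 - 1 / (8 * m))) := fun ω hω i _ hi =>
    settleTime_mem_Icc ha0 (by omega) (by linarith) (not_lt.1 hω)
  have hy0 : ∀ i, i + 1 < n → 0 ≤ y i := fun i hi => by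
    have : (i : ℝ) < n := by exact_mod_cast (by omega : i < n)
    exact Real.rpow_nonneg (by have : 0 < (n : ℝ) - i := by linarith
                               positivity) _
  have hmain := expectedLoss_algorithm_le (m := m) (N := N) (K := K) F (l := l) (u := u) (bad := bad)
    hMn (fun ω hω i hi hi' => (Nat.floor_le (div_nonneg (hy0 i hi') (by positivity))).trans
      (hmem ω hω i hi hi').1)
    (fun ω hω i hi hi' => (hmem ω hω i hi hi').2.trans_lt (Nat.lt_floor_add_one _))
  rw [← hndef, ← hM] at hmain
  have hR : ∀ i, M ≤ i → i < n → ∏ j ∈ Finset.Ico M i, (1 - surv F (u j))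
      ≤ (2 * L : ℝ) ^ (3 / 2 : ℝ) * ((n : ℝ) - i) ^ (3 / 2 : ℝ) / (n : ℝ) ^ (3 / 2 : ℝ) := by
    intro i hi hin
    have hv1 : (1 : ℝ) ≤ (n : ℝ) - i := by
      have : (i : ℝ) + 1 ≤ n := by exact_mod_cast hin
      linarith
    refine (prod_one_sub_le hL (by omega) (fun j => surv_nonneg F _) (fun j => surv_le_one F _)
      (fun j hj hjL => ?_) hi hin).trans ?_
    · refine surv_floor_ge hm ha0 hk₀ hsurv ?_
      have h1 : (L : ℝ) ≤ (n : ℝ) - j := by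
        have : (j : ℝ) + L ≤ n := by exact_mod_cast hjL
        linarith
      calc 2 * (k₀ : ℝ) ^ m = 1 / B * (2 * B * (k₀ : ℝ) ^ m) := by field_simp
        _ ≤ a * ((n : ℝ) - j) := by gcongr; linarith
    · rw [← Real.mul_rpow (by positivity) (by linarith), ← Real.div_rpow (by nlinarith) hn0.le]
      have hnM : 0 < (n : ℝ) - M := by linarith
      -- Both L and n - i are at least 1. Together with n - M ≥ n/2 this gives the factor 2L.
      have h1 : max ((n : ℝ) - i) L ≤ L * ((n : ℝ) - i) := max_le (by nlinarith) (by nlinarith)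
      refine Real.rpow_le_rpow (by positivity) ?_ (by norm_num)
      rw [div_le_div_iff₀ hnM hn0]
      have h2 : 0 ≤ (L : ℝ) * ((n : ℝ) - i) := by nlinarith
      nlinarith
  have hsum : ∑ i ∈ Finset.Ico M (n - 1), (∏ j ∈ Finset.Ico M i, (1 - surv F (u j)))
      * survHead F (l i) ≤ 2 * (2 * L : ℝ) ^ (3 / 2 : ℝ) * C₃ / (n : ℝ) ^ (1 / m : ℝ) := by
    calc _ ≤ ∑ i ∈ Finset.Ico M (n - 1),
          (2 * L : ℝ) ^ (3 / 2 : ℝ) * ((n : ℝ) - i) ^ (3 / 2 : ℝ) / (n : ℝ) ^ (3 / 2 : ℝ)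
            * (C₃ / (((n : ℝ) - i) * ((n : ℝ) - i) ^ (1 / m : ℝ))) := by
          refine Finset.sum_le_sum fun i hi => ?_
          rw [Finset.mem_Ico] at hi
          have hv0 : 0 < (n : ℝ) - i := by
            have : (i : ℝ) < n := by exact_mod_cast (by omega : i < n)
            linarith
          exact mul_le_mul (hR i hi.1 (by omega))
            (survHead_floor_le hm hB hC hhead ha hv0 hη0.le (by linarith))
            (survHead_nonneg F _) (by positivity)
      _ = (2 * L : ℝ) ^ (3 / 2 : ℝ) * C₃ / (n : ℝ) ^ (3 / 2 : ℝ)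
          * ∑ i ∈ Finset.Ico M (n - 1), ((n : ℝ) - i) ^ (3 / 2 : ℝ)
            / (((n : ℝ) - i) * ((n : ℝ) - i) ^ (1 / m : ℝ)) := by
          rw [Finset.mul_sum]
          refine Finset.sum_congr rfl fun i _ => ?_
          ring
      _ ≤ (2 * L : ℝ) ^ (3 / 2 : ℝ) * C₃ / (n : ℝ) ^ (3 / 2 : ℝ)
          * (2 * (n : ℝ) ^ (3 / 2 : ℝ) / (n : ℝ) ^ (1 / m : ℝ)) := by
          gcongr
          exact sum_settle_le (by omega) hp1
      _ = _ := by
          have : 0 < (n : ℝ) ^ (3 / 2 : ℝ) := Real.rpow_pos_of_pos hn0 _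
          field_simp
  have hfin : ∏ j ∈ Finset.Ico M (n - 1), (1 - surv F (u j))
      ≤ (2 * L : ℝ) ^ (3 / 2 : ℝ) / (n : ℝ) ^ (1 / m : ℝ) := by
    have h1 := hR (n - 1) (by omega) (by omega)
    have h2 : (n : ℝ) - ((n - 1 : ℕ) : ℝ) = 1 := by
      rw [Nat.cast_sub (by omega)]; push_cast; ring
    rw [h2, Real.one_rpow, mul_one] at h1
    exact h1.trans (div_le_div_of_nonneg_left (by positivity) hnp0
      (Real.rpow_le_rpow_of_exponent_le hn1 (by linarith)))
  have hq : (envLaw F).real bad ≤ q / (n : ℝ) ^ (1 / m : ℝ) := by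
    refine hbad.trans ?_
    have hq0 : 0 ≤ q := by
      by_contra hq0
      exact absurd (measureReal_nonneg.trans hbad) (not_le.2 (div_neg_of_neg_of_pos (not_le.1 hq0) hn0))
    gcongr
  have hK0 : (0 : ℝ) ≤ K := Nat.cast_nonneg K
  calc _ ≤ _ := hmain
    _ ≤ K * (q / (n : ℝ) ^ (1 / m : ℝ)) + K / (n : ℝ) ^ (1 / m : ℝ)
        + K * (2 * (2 * L : ℝ) ^ (3 / 2 : ℝ) * C₃ / (n : ℝ) ^ (1 / m : ℝ))
        + K * ((2 * L : ℝ) ^ (3 / 2 : ℝ) / (n : ℝ) ^ (1 / m : ℝ)) := by gcongr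
    _ = _ := by ring

/-- The upper bound for the loss of the algorithm. -/
theorem IsAdmissibleFamily.exists_upper_bound {m : ℕ} (hm : 1 ≤ m) {B : ℝ} (hB : 0 < B)
    {𝓕 : Set (ProbabilityMeasure ℝ)} (h𝓕 : IsAdmissibleFamily m B 𝓕) :
    ∃ c > (0 : ℝ), ∀ F ∈ 𝓕, ∀ N K : ℕ, 1 ≤ N → 1 ≤ K →
      expectedLoss F N K (algorithm m N K) ≤ c * (K / (machines m N K : ℝ) ^ (1 / m : ℝ)) := by
  obtain ⟨ε, hε, A, hA, hest⟩ := h𝓕.exists_estimator_accurate hm hB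
  obtain ⟨C₁, hC₁, hcdf⟩ := h𝓕.exists_cdf_le hB
  obtain ⟨k₀, hk₀, hsurv⟩ := h𝓕.exists_surv_ge hB
  set C₂ : ℝ := C₁ * m ! * 2 ^ (m + 1) with hC₂
  have hC₂0 : 0 ≤ C₂ := by positivity
  set L := ⌈2 * B * (k₀ : ℝ) ^ m⌉₊ with hLdef
  have hL : 1 ≤ L := Nat.one_le_ceil_iff.2 (by positivity)
  set β : ℝ := B ^ (-(1 / m) : ℝ) with hβ
  have hβ0 : 0 < β := Real.rpow_pos_of_pos hB _
  -- Chosen so that A(w + w) is β/(8m), where β is a lower bound for C_F^(-1/m) over the family; the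
  -- estimate then has relative error at most 1/(8m).
  set w : ℝ := 1 / (8 * m) * β / (2 * A) with hw
  have hw0 : 0 < w := by positivity
  obtain ⟨δ, hδ, hδw⟩ := h𝓕.equicontinuous w hw0
  have hlim : Filter.Tendsto (fun n : ℕ => (n : ℝ) ^ (-ε)) Filter.atTop (nhds 0) :=
    (tendsto_rpow_neg_atTop hε).comp tendsto_natCast_atTop_atTop
  obtain ⟨n₀, hn₀⟩ := Filter.eventually_atTop.1
    (hlim.eventually_lt_const (lt_min hδ hw0))
  set n₁ := n₀ + 1024 + 2 * L with hn₁
  set q : ℝ := A * (⌈1 / ε⌉₊ ! : ℝ) with hq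
  have hq0 : 0 ≤ q := by positivity
  set c : ℝ := q + 1 + 2 * (2 * L : ℝ) ^ (3 / 2 : ℝ)
    * (C₂ * 2 ^ (m + 1) * ((2 * B) * (2 * B) ^ (1 / m : ℝ))) + (2 * L : ℝ) ^ (3 / 2 : ℝ) with hc
  have hc0 : 0 < c := by positivity
  refine ⟨c + (n₁ : ℝ) ^ (1 / m : ℝ), by positivity, fun F hF N K hN hK => ?_⟩
  have hn1 : 1 ≤ machines m N K := one_le_machines hN hK
  have hn0 : (0 : ℝ) < machines m N K := by exact_mod_cast hn1
  have hT : 0 ≤ K / (machines m N K : ℝ) ^ (1 / m : ℝ) := by positivity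
  -- For few machines the trivial bound K is already of the right order, because n^(1/m) is bounded.
  rcases lt_or_ge (machines m N K) n₁ with h | h
  · refine (expectedLoss_le_pulls F N K _).trans ?_
    calc (K : ℝ) = (machines m N K : ℝ) ^ (1 / m : ℝ)
          * (K / (machines m N K : ℝ) ^ (1 / m : ℝ)) := by
          have := Real.rpow_pos_of_pos hn0 (1 / m : ℝ)
          field_simp
      _ ≤ _ := by
          gcongr
          have : (machines m N K : ℝ) ^ (1 / m : ℝ) ≤ (n₁ : ℝ) ^ (1 / m : ℝ) := by gcongr
          linarith
  · have ha := h𝓕.deriv_mem F hF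
    have hsmall := hn₀ (machines m N K) (by omega)
    have hc' := expectedLoss_algorithm_le_of_accurate (F := F) (N := N) (K := K) (k₀ := k₀) (L := L)
      (q := q) hm hB hC₂0 ha.1 hk₀ (fun k hk => by have := hsurv F hF k hk; linarith)
      (fun k => survHead_le_of_cdf_le hC₁ (hcdf F hF) k) hL (Nat.le_ceil _) (by omega) (by omega) ?_
    · refine hc'.trans (mul_le_mul_of_nonneg_right ?_ hT)
      exact le_add_of_nonneg_right (by positivity)
    · have h1 := hest F hF (machines m N K) hn1 w fun x hx =>
        hδw F hF x ⟨hx.1, hx.2.trans_lt (hsmall.trans_le (min_le_left _ _))⟩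
      have h2 : β ≤ (cdfDeriv F m 0 / m !) ^ (-(1 / m) : ℝ) := by
        have ha0 : 0 < cdfDeriv F m 0 := lt_of_lt_of_le (by positivity) ha.1
        refine Real.rpow_le_rpow_of_nonpos (by positivity) ?_ (by
          rw [neg_nonpos]; positivity)
        refine (div_le_self ha0.le ?_).trans ha.2
        exact_mod_cast m.factorial_pos
      have h3 : A * ((machines m N K : ℝ) ^ (-ε) + w)
          ≤ 1 / (8 * m) * (cdfDeriv F m 0 / m !) ^ (-(1 / m) : ℝ) := by
        calc _ ≤ A * (w + w) := by
              gcongr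
              exact (hsmall.trans_le (min_le_right _ _)).le
          _ = 1 / (8 * m) * β := by rw [hw]; field_simp; norm_num
          _ ≤ _ := by gcongr
      calc _ ≤ (envLaw F).real {ω | A * ((machines m N K : ℝ) ^ (-ε) + w) <
            |bernoulliEstimator m (machines m N K) (tailsBeforeHead ω)
              - leadingCoeff m F ^ (-(1 / m) : ℝ)|} :=
            measureReal_mono fun ω hω => h3.trans_lt hω
        _ ≤ A * Real.exp (-(machines m N K : ℝ) ^ ε) := h1
        _ ≤ A * ((⌈1 / ε⌉₊ ! : ℝ) / machines m N K) := by
            gcongr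
            exact exp_neg_rpow_le hε (by exact_mod_cast hn1)
        _ = q / machines m N K := by rw [hq]; ring

end StreamingBandit

end

/-! ### Assembly of the three claims -/

theorem mainTheorem9 (m : ℕ) (hm : 1 ≤ m) (B : ℝ) (hB : 0 < B)
    (𝓕 : Set (ProbabilityMeasure ℝ)) (h𝓕 : StreamingBandit.IsAdmissibleFamily m B 𝓕) :
    -- the estimator is accurate when the reciprocals of the numbers of tails are used as samples
    (∃ ε > (0 : ℝ), ∃ A > (0 : ℝ), ∀ F ∈ 𝓕, ∀ N : ℕ, 1 ≤ N → ∀ w : ℝ,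
      (∀ x ∈ Icc (0 : ℝ) ((N : ℝ) ^ (-ε)),
        |StreamingBandit.cdfDeriv F m x - StreamingBandit.cdfDeriv F m 0| ≤ w) →
      (StreamingBandit.envLaw F).real
        {ω | A * ((N : ℝ) ^ (-ε) + w) <
          |StreamingBandit.bernoulliEstimator m N (StreamingBandit.tailsBeforeHead ω) -
            StreamingBandit.leadingCoeff m F ^ (-(1 / m) : ℝ)|}
        ≤ A * Real.exp (-(N : ℝ) ^ ε)) ∧
    -- the estimation phase costs `o(K / n ^ (1/m))`, on every sample path
    (∀ η > (0 : ℝ), ∃ n₀ : ℕ, ∀ N K n : ℕ, n = StreamingBandit.machines m N K → n₀ ≤ n →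
      ∀ X : ℕ → ℕ → Bool,
        (StreamingBandit.estimationLoss m N K X : ℝ) ≤ (n : ℝ) ^ (9 / 10 : ℝ) ∧
        (n : ℝ) ^ (9 / 10 : ℝ) ≤ η * (K / (n : ℝ) ^ (1 / m : ℝ))) ∧
    -- the expected loss is optimal up to a constant factor, and of order `K / n ^ (1/m)`
    (∃ c > (0 : ℝ), ∀ F ∈ 𝓕, ∀ N K n : ℕ, 1 ≤ N → 1 ≤ K → n = StreamingBandit.machines m N K →
      StreamingBandit.expectedLoss F N K (StreamingBandit.algorithm m N K)
        ≤ c * (K / (n : ℝ) ^ (1 / m : ℝ)) ∧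
      ∀ S : StreamingBandit.Strategy,
        K / (n : ℝ) ^ (1 / m : ℝ) ≤ c * StreamingBandit.expectedLoss F N K S ∧
        StreamingBandit.expectedLoss F N K (StreamingBandit.algorithm m N K)
          ≤ c * StreamingBandit.expectedLoss F N K S) := by
  obtain ⟨c₁, hc₁, hlower⟩ := h𝓕.exists_lower_bound hm hB
  obtain ⟨c₂, hc₂, hupper⟩ := h𝓕.exists_upper_bound hm hB
  refine ⟨h𝓕.exists_estimator_accurate hm hB,
    fun η hη => StreamingBandit.exists_estimationLoss_le hm hη,
    c₁ + c₂ + c₂ * c₁, by positivity, ?_⟩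
  rintro F hF N K n hN hK rfl
  have hU := hupper F hF N K hN hK
  set T : ℝ := K / (StreamingBandit.machines m N K : ℝ) ^ (1 / m : ℝ)
  have hT : 0 ≤ T := by positivity
  refine ⟨hU.trans ?_, fun S => ?_⟩
  · gcongr
    have : 0 < c₂ * c₁ := by positivity
    linarith
  · have hLow := hlower F hF N K hN hK S
    have hS := StreamingBandit.expectedLoss_nonneg F N K S
    set s := StreamingBandit.expectedLoss F N K S
    have h1 : 0 ≤ c₁ * s := by positivity
    have h2 : 0 ≤ c₂ * s := by positivity
    have h3 : 0 ≤ c₂ * c₁ * s := by positivity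
    have h4 : c₂ * T ≤ c₂ * (c₁ * s) := by gcongr
    constructor <;> nlinarith
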